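/- A hypergraph $\mathcal H=(X,R)$ consists of a finite vertex set $X$ and a set $R\subseteq 2^X$ of hyperedges; its size is $m=\sum_{q\in R}|q|$, and $n=|X|$. A set $Y\subseteq X$ is shattered if every $Y'\subseteq Y$ equals $Y\cap q$ for some $q\in R$; the VC-dimension of $\mathcal H$ is the largest cardinality of a shattered set. A spanning path is a total ordering of $X$; its edges are the pairs $uv$ of consecutive vertices. A hyperedge $q$ stabs $uv$ if $|q\cap\{u,v\}|=1$, and the stabbing number of the path is the least $k$ such that every hyperedge stabs at most $k$ of its edges. **Theorem.** There are a universal constant $c>2$ and a deterministic algorithm (a random access machine program, with running time measured by the logarithmic cost criterion) such that the following holds for every integer $d>0$. Put $$\varepsilon_d=\frac{1}{2^{d+1}\,[\,c(d+1)-1\,]+1}\in(0,1).$$ Given $d$ and an $n$-vertex hypergraph $\mathcal H$ of VC-dimension at most $d$ and size $m$ (vertices numbered $0,\dots,n-1$, each hyperedge given once as a list of its vertices, in any order), the algorithm computes a spanning path of $\mathcal H$ of stabbing number $\tilde{\mathcal O}(n^{1-\varepsilon_d})$ in time $\tilde{\mathcal O}(m+n^{2-\varepsilon_d})$. That is, there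 are constants $C$ and $k$ depending only on $d$ such that, for all such inputs, the stabbing number is at most $C\,n^{1-\varepsilon_d}\log^k(n+2)$ and the running time is at most $C\,(m+n^{2-\varepsilon_d}+1)\log^k(n+2)$. -/

import Mathlib

/-! ### Spanning paths and their stabbing number

A hypergraph on the vertex set `Fin n` is given by its set of hyperedges `R : Finset (Finset (Fin n))`.
Its VC-dimension is Mathlib's `Finset.vcDim`. -/

namespace Stabbing

/-- The size of a hypergraph: the sum of the cardinalities of its hyperedges. -/
def hypergraphSize {n : ℕ} (R : Finset (Finset (Fin n))) : ℕ :=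
  ∑ q ∈ R, q.card

/-- A spanning path, written as the list of vertices in the order in which it visits them:
a total ordering of the vertex set. -/
def IsSpanningPath {n : ℕ} (P : List (Fin n)) : Prop :=
  P.Nodup ∧ ∀ v : Fin n, v ∈ P

/-- The edges of a path: the pairs of consecutive vertices. -/
def pathEdges {n : ℕ} (P : List (Fin n)) : List (Fin n × Fin n) :=
  P.zip P.tail

/-- The edges `uv` of the path `P` that are stabbed by `q`, i.e. `|q ∩ {u, v}| = 1`. -/
def stabbedEdges {n : ℕ} (P : List (Fin n)) (q : Finset (Fin n)) : List (Fin n × Fin n) :=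
  (pathEdges P).filter fun e => (q ∩ {e.1, e.2}).card = 1

/-- The stabbing number of the path `P`: the least `k` such that every hyperedge stabs at most `k`
edges of `P`, i.e. the maximum over all hyperedges of the number of stabbed edges. -/
def stabbingNumber {n : ℕ} (R : Finset (Finset (Fin n))) (P : List (Fin n)) : ℕ :=
  R.sup fun q => (stabbedEdges P q).length

/-! ### Deterministic random access machines with logarithmic cost

A program works on natural-number registers and on natural-number arrays with random (indirect)
access. Names of registers and of arrays are literals of the program, so that a program uses only
finitely many of them; indices into an array are computed values. Every operation is charged the
bit lengths of all numbers that it handles, array indices included. -/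

/-- The number of bits charged for handling `k` (at least one). -/
def bits (k : ℕ) : ℕ := Nat.size k + 1

/-- The memory of the machine: registers `reg x` and array cells `arr a i`. -/
structure State where
  reg : ℕ → ℕ
  arr : ℕ → ℕ → ℕ

/-- The arithmetic operations: addition, truncated subtraction, multiplication, and division rounded
down (with value `0` if the divisor is `0`). -/
inductive Op where
  | add
  | sub
  | mul
  | div

/-- The value of an arithmetic operation. -/
def Op.eval : Op → ℕ → ℕ → ℕ
  | .add, a, b => a + b
  | .sub, a, b => a - b
  | .mul, a, b => a * b
  | .div, a, b => a / b

/-- Expressions: constants, registers, array cells, arithmetic operations. -/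
inductive Expr where
  | const (k : ℕ)
  | reg (x : ℕ)
  | get (a : ℕ) (i : Expr)
  | bin (o : Op) (e f : Expr)

/-- The value of an expression. -/
def Expr.eval (s : State) : Expr → ℕ
  | .const k => k
  | .reg x => s.reg x
  | .get a i => s.arr a (i.eval s)
  | .bin o e f => o.eval (e.eval s) (f.eval s)

/-- The logarithmic cost of evaluating an expression. -/
def Expr.cost (s : State) : Expr → ℕ
  | .const k => bits k
  | .reg x => bits (s.reg x)
  | .get a i => i.cost s + bits (i.eval s) + bits (s.arr a (i.eval s))
  | .bin o e f =>
      e.cost s + f.cost s + bits (e.eval s) + bits (f.eval s) +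
        bits (o.eval (e.eval s) (f.eval s))

/-- Programs. A test succeeds if its value is not `0`. -/
inductive Program where
  | skip
  | assign (x : ℕ) (e : Expr)
  | store (a : ℕ) (i e : Expr)
  | seq (p q : Program)
  | ite (e : Expr) (p q : Program)
  | while (e : Expr) (p : Program)

/-- The memory after writing `v` to register `x`. -/
def State.setReg (s : State) (x v : ℕ) : State :=
  { s with reg := Function.update s.reg x v }

/-- The memory after writing `v` to cell `i` of array `a`. -/
def State.setArr (s : State) (a i v : ℕ) : State :=
  { s with arr := Function.update s.arr a (Function.update (s.arr a) i v) }

/-- `Exec p s t s'`: started in memory `s`, the program `p` halts in memory `s'`, after operations of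
total logarithmic cost `t`. -/
inductive Exec : Program → State → ℕ → State → Prop where
  | skip (s : State) : Exec .skip s 1 s
  | assign (x : ℕ) (e : Expr) (s : State) :
      Exec (.assign x e) s (e.cost s + bits (e.eval s)) (s.setReg x (e.eval s))
  | store (a : ℕ) (i e : Expr) (s : State) :
      Exec (.store a i e) s (i.cost s + e.cost s + bits (i.eval s) + bits (e.eval s))
        (s.setArr a (i.eval s) (e.eval s))
  | seq {p q : Program} {s s₁ s₂ : State} {t₁ t₂ : ℕ} :
      Exec p s t₁ s₁ → Exec q s₁ t₂ s₂ → Exec (.seq p q) s (t₁ + t₂) s₂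
  | ite_true {e : Expr} {p q : Program} {s s₁ : State} {t : ℕ} :
      e.eval s ≠ 0 → Exec p s t s₁ → Exec (.ite e p q) s (e.cost s + t) s₁
  | ite_false {e : Expr} {p q : Program} {s s₁ : State} {t : ℕ} :
      e.eval s = 0 → Exec q s t s₁ → Exec (.ite e p q) s (e.cost s + t) s₁
  | while_false {e : Expr} {p : Program} {s : State} :
      e.eval s = 0 → Exec (.while e p) s (e.cost s) s
  | while_true {e : Expr} {p : Program} {s s₁ s₂ : State} {t₁ t₂ : ℕ} :
      e.eval s ≠ 0 → Exec p s t₁ s₁ → Exec (.while e p) s₁ t₂ s₂ →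
        Exec (.while e p) s (e.cost s + t₁ + t₂) s₂

/-- The machine is deterministic: the running time and the final memory are unique. -/
theorem Exec.deterministic {p : Program} {s s₁ s₂ : State} {t₁ t₂ : ℕ}
    (h₁ : Exec p s t₁ s₁) (h₂ : Exec p s t₂ s₂) : t₁ = t₂ ∧ s₁ = s₂ := by
  induction h₁ generalizing t₂ s₂ with
  | skip => cases h₂; exact ⟨rfl, rfl⟩
  | assign => cases h₂; exact ⟨rfl, rfl⟩
  | store => cases h₂; exact ⟨rfl, rfl⟩
  | seq _ _ ih₁ ih₂ =>
    cases h₂ with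
    | seq h h' =>
      obtain ⟨rfl, rfl⟩ := ih₁ h
      obtain ⟨rfl, rfl⟩ := ih₂ h'
      exact ⟨rfl, rfl⟩
  | ite_true he _ ih =>
    cases h₂ with
    | ite_true _ h => obtain ⟨rfl, rfl⟩ := ih h; exact ⟨rfl, rfl⟩
    | ite_false he' _ => exact absurd he' he
  | ite_false he _ ih =>
    cases h₂ with
    | ite_true he' _ => exact absurd he he'
    | ite_false _ h => obtain ⟨rfl, rfl⟩ := ih h; exact ⟨rfl, rfl⟩
  | while_false he =>
    cases h₂ with
    | while_false => exact ⟨rfl, rfl⟩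
    | while_true he' => exact absurd he he'
  | while_true he _ _ ih₁ ih₂ =>
    cases h₂ with
    | while_false he' => exact absurd he' he
    | while_true _ h h' =>
      obtain ⟨rfl, rfl⟩ := ih₁ h
      obtain ⟨rfl, rfl⟩ := ih₂ h'
      exact ⟨rfl, rfl⟩

/-- The initial memory on the input word `w`: array `0` holds `w`, everything else is `0`. -/
def initState (w : List ℕ) : State where
  reg := fun _ => 0
  arr := fun a i => if a = 0 then w.getD i 0 else 0

/-- The first `k` cells of the output array, which is array `1`. -/
def State.output (s : State) (k : ℕ) : List ℕ :=
  (List.range k).map (s.arr 1)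

/-! ### Hypergraphs as inputs -/

/-- The list of lists `L` presents the hypergraph `R`: each hyperedge appears exactly once, as a list
of its vertices without repetition. The orders in both kinds of lists are arbitrary. -/
def Presents {n : ℕ} (L : List (List (Fin n))) (R : Finset (Finset (Fin n))) : Prop :=
  (∀ l ∈ L, l.Nodup) ∧ (L.map List.toFinset).Nodup ∧
    ∀ q : Finset (Fin n), q ∈ L.map List.toFinset ↔ q ∈ R

/-- The input word: the bound `d` on the VC-dimension, the number of vertices, the number of
hyperedges, and then, for each hyperedge, its cardinality followed by its vertices. -/
def encodeInput (d n : ℕ) (L : List (List (Fin n))) : List ℕ :=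
  d :: n :: L.length :: L.flatMap fun l => l.length :: l.map Fin.val

/-- The exponent `ε_d = 1 / (2^(d+1) (c (d+1) - 1) + 1)`. -/
noncomputable def stabbingEps (c : ℝ) (d : ℕ) : ℝ :=
  1 / (2 ^ (d + 1) * (c * ((d : ℝ) + 1) - 1) + 1)

end Stabbing

namespace Stabbing

open Finset

/-! ### Notation for expressions and programs -/

/-! Suppose `S` is a small set of hyperedges such that every hyperedge `q` differs from some `p ∈ S`
in at most `δ` vertices. Call two vertices equivalent if the same members of `S` contain them, and
let the path visit the classes one after another. An edge stabbed by `q` either joins two classes or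
lies inside one. In the second case `p` does not stab it, so it has an endpoint in `p ∆ q`; every
vertex lies on at most two edges, so there are at most `2δ` such edges (`length_stabbedEdges_le`,
`stabbingNumber_le`). The dual VC-dimension is below `2^(d+1)`, hence there are at most `(#S +
1)^(2^(d+1))` classes (`VCBound.card_dual_traces_le`).

The set `S` comes from a sample of `g = 2K²` vertices on which hyperedges with equal traces are
close: one hyperedge is taken for each trace, and by Sauer–Shelah there are at most `(g + 1)^(d+1)`
of them. The sample arises by repeated halving from the vertex set, padded to `N = 2^J` elements.
Each sample is cut into groups of `g` positions, and of every pair of neighbouring positions in a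
group one is kept. Multiplicative weights on all pairs of traces of the group make the choice
deterministic: for any two hyperedges, the dropped positions in their symmetric difference outnumber
the kept ones by at most `K(B + 2)`, where `B = O(log n)` bounds the bit length of all numbers
(`sum_le_of_prod_le`, `runs_halveGroup`). This one-sided estimate suffices. The errors of the groups
add up, and every level contributes the same amount `2^L K(B + 2)` after scaling back to the full
set. Since `2^L · 2K² = N`, the `L` levels give `δ ≤ L N (B + 2) / (2K)` (`runs_reduceSample`).

The traces on a group are held in a trie whose construction touches only actual incidences
(`runs_buildTrie`). Halving never increases the sum of the degrees over the sample, so the tries of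
one level cost `O(m)` instructions. A trie has at most `τ = (g + 1)^(d+1)` nodes, as its nodes are
prefixes of traces, and reweighting all pairs of nodes costs about `N τ²` per level.

With `c = 5` the reciprocal of `ε_d` is the integer `E = 2^(d+1)(5d + 4) + 1`, and `K = 2^⌊J/E⌋` is
about `N^(1/E)`. The classes number about `K^(2(d+1)2^(d+1))` and the weights cost about `N
K^(4(d+1))`; both exponents of `K` are at most `E - 1`, which gives `N^(1-1/E)` and `N^(2-1/E)`
(`classes_bound`, `time_bound`). The predicate `Runs` counts instructions. Because `r ≤ (n + 1)^d`
for `r` hyperedges, all entries have at most `(E + 3) J` bits (`entries_lt`), so that logarithmic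
cost is the instruction count times `O(log n)`. -/

instance : Add Expr := ⟨.bin .add⟩
instance : Sub Expr := ⟨.bin .sub⟩
instance : Mul Expr := ⟨.bin .mul⟩
instance : Div Expr := ⟨.bin .div⟩
instance (k : ℕ) : OfNat Expr k := ⟨.const k⟩

@[simp] theorem Expr.eval_add (s : State) (e f : Expr) :
    (e + f).eval s = e.eval s + f.eval s := rfl
@[simp] theorem Expr.eval_sub (s : State) (e f : Expr) :
    (e - f).eval s = e.eval s - f.eval s := rfl
@[simp] theorem Expr.eval_mul (s : State) (e f : Expr) :
    (e * f).eval s = e.eval s * f.eval s := rfl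
@[simp] theorem Expr.eval_div (s : State) (e f : Expr) :
    (e / f).eval s = e.eval s / f.eval s := rfl
@[simp] theorem Expr.eval_ofNat (s : State) (k : ℕ) [k.AtLeastTwo] :
    (ofNat(k) : Expr).eval s = k := rfl
@[simp] theorem Expr.eval_zero (s : State) : (0 : Expr).eval s = 0 := rfl
@[simp] theorem Expr.eval_one (s : State) : (1 : Expr).eval s = 1 := rfl
@[simp] theorem Expr.eval_reg (s : State) (x : ℕ) : (Expr.reg x).eval s = s.reg x := rfl
@[simp] theorem Expr.eval_get (s : State) (a : ℕ) (i : Expr) :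
    (Expr.get a i).eval s = s.arr a (i.eval s) := rfl

@[simp] theorem State.reg_setReg (s : State) (x v y : ℕ) :
    (s.setReg x v).reg y = if y = x then v else s.reg y := by
  simp [State.setReg, Function.update_apply]
@[simp] theorem State.arr_setReg (s : State) (x v : ℕ) : (s.setReg x v).arr = s.arr := rfl
@[simp] theorem State.reg_setArr (s : State) (a i v : ℕ) : (s.setArr a i v).reg = s.reg := rfl
@[simp] theorem State.arr_setArr (s : State) (a i v b : ℕ) :
    (s.setArr a i v).arr b = if b = a then Function.update (s.arr a) i v else s.arr b := by
  simp [State.setArr, Function.update_apply]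

/-- Sequential composition of a list of programs. -/
def block : List Program → Program
  | [] => .skip
  | p :: ps => .seq p (block ps)

/-- The loop running `p` for `x = 0, 1, …` as long as `x < e`. -/
def forLoop (x : ℕ) (e : Expr) (p : Program) : Program :=
  .seq (.assign x 0) (.while (e - .reg x) (.seq p (.assign x (.reg x + 1))))

/-! ### Frames -/

/-- Whether the program assigns to the register `x`. -/
def Program.writesReg (x : ℕ) : Program → Bool
  | .skip => false
  | .assign y _ => x == y
  | .store _ _ _ => false
  | .seq p q => p.writesReg x || q.writesReg x
  | .ite _ p q => p.writesReg x || q.writesReg x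
  | .while _ p => p.writesReg x

/-- Whether the program writes to the array `a`. -/
def Program.writesArr (a : ℕ) : Program → Bool
  | .skip => false
  | .assign _ _ => false
  | .store b _ _ => a == b
  | .seq p q => p.writesArr a || q.writesArr a
  | .ite _ p q => p.writesArr a || q.writesArr a
  | .while _ p => p.writesArr a

/-- `s'` agrees with `s` on everything that `p` does not write. -/
structure Frame (p : Program) (s s' : State) : Prop where
  reg : ∀ x, p.writesReg x = false → s'.reg x = s.reg x
  arr : ∀ a, p.writesArr a = false → s'.arr a = s.arr a

theorem Frame.refl (p : Program) (s : State) : Frame p s s := ⟨fun _ _ => rfl, fun _ _ => rfl⟩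

theorem Frame.trans {p : Program} {s s₁ s₂ : State} (h : Frame p s s₁) (h' : Frame p s₁ s₂) :
    Frame p s s₂ :=
  ⟨fun x hx => (h'.reg x hx).trans (h.reg x hx), fun a ha => (h'.arr a ha).trans (h.arr a ha)⟩

theorem Frame.mono {p q : Program} {s s' : State} (h : Frame p s s')
    (hr : ∀ x, q.writesReg x = false → p.writesReg x = false)
    (ha : ∀ a, q.writesArr a = false → p.writesArr a = false) : Frame q s s' :=
  ⟨fun x hx => h.reg x (hr x hx), fun a h' => h.arr a (ha a h')⟩

/-- What a program may write is read off its syntax, so the survival of a literal register or array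
through a subprogram is later settled by `rfl`. -/
theorem Exec.frame {p : Program} {s s' : State} {t : ℕ} (h : Exec p s t s') : Frame p s s' := by
  induction h with
  | skip s => exact Frame.refl _ _
  | assign x e s =>
    exact ⟨fun y hy => by simp_all [Program.writesReg], fun a _ => rfl⟩
  | store a i e s =>
    exact ⟨fun y _ => rfl, fun b hb => by simp_all [Program.writesArr]⟩
  | seq _ _ ih₁ ih₂ =>
    exact (ih₁.mono (by simp +contextual [Program.writesReg])
      (by simp +contextual [Program.writesArr])).trans
      (ih₂.mono (by simp +contextual [Program.writesReg])
      (by simp +contextual [Program.writesArr]))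
  | ite_true _ _ ih =>
    exact ih.mono (by simp +contextual [Program.writesReg])
      (by simp +contextual [Program.writesArr])
  | ite_false _ _ ih =>
    exact ih.mono (by simp +contextual [Program.writesReg])
      (by simp +contextual [Program.writesArr])
  | while_false => exact Frame.refl _ _
  | while_true _ _ _ ih₁ ih₂ =>
    exact (ih₁.mono (by simp [Program.writesReg]) (by simp [Program.writesArr])).trans ih₂

/-! ### Costs over memories with bounded entries -/

/-- All entries of the memory have at most `B` bits. -/
structure Bdd (B : ℕ) (s : State) : Prop where
  pos : 0 < B
  reg : ∀ x, s.reg x < 2 ^ B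
  arr : ∀ a i, s.arr a i < 2 ^ B

/-- The value of an expression has at most `size * B` bits if the memory has `B`-bit entries. -/
def Expr.size : Expr → ℕ
  | .const k => k
  | .reg _ => 1
  | .get _ _ => 1
  | .bin _ e f => e.size + f.size + 1

/-- The cost of an expression is at most `weight * B` if the memory has `B`-bit entries. -/
def Expr.weight : Expr → ℕ
  | .const k => k + 1
  | .reg _ => 2
  | .get _ i => i.weight + (i.size + 1) + 2
  | .bin _ e f => e.weight + f.weight + (e.size + 1) + (f.size + 1) + (e.size + f.size + 2)

theorem Bdd.eval_lt {B : ℕ} {s : State} (h : Bdd B s) (e : Expr) :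
    e.eval s < 2 ^ (e.size * B) := by
  induction e with
  | const k =>
    -- A constant is given as many bits as its value. This is crude, but the programs contain only
    -- small literals.
    exact k.lt_two_pow_self.trans_le
      (Nat.pow_le_pow_right two_pos (Nat.le_mul_of_pos_right _ h.pos))
  | reg x => simpa [Expr.size] using h.reg x
  | get a i => simpa [Expr.size] using h.arr a _
  | bin o e f ihe ihf =>
    have hB := h.pos
    set a := e.eval s
    set b := f.eval s
    have h₁ : a < 2 ^ ((e.size + f.size + 1) * B) :=
      ihe.trans_le (Nat.pow_le_pow_right two_pos (Nat.mul_le_mul_right _ (by omega)))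
    cases o with
    | add =>
      have : a + b < 2 ^ (e.size * B) + 2 ^ (f.size * B) := by omega
      refine lt_of_lt_of_le this ?_
      calc 2 ^ (e.size * B) + 2 ^ (f.size * B)
          ≤ 2 ^ ((e.size + f.size) * B) + 2 ^ ((e.size + f.size) * B) :=
            Nat.add_le_add
              (Nat.pow_le_pow_right two_pos (Nat.mul_le_mul_right _ (by omega)))
              (Nat.pow_le_pow_right two_pos (Nat.mul_le_mul_right _ (by omega)))
        _ = 2 ^ ((e.size + f.size) * B + 1) := by ring
        -- The summand `1` in the size of a binary expression pays for the carry bit.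
        _ ≤ _ := Nat.pow_le_pow_right two_pos (by
            simp only [Expr.size, Nat.add_mul]; omega)
    | sub => exact lt_of_le_of_lt (Nat.sub_le _ _) h₁
    | mul =>
      calc a * b < 2 ^ (e.size * B) * 2 ^ (f.size * B) := Nat.mul_lt_mul'' ihe ihf
        _ = 2 ^ ((e.size + f.size) * B) := by ring
        _ ≤ _ := Nat.pow_le_pow_right two_pos (Nat.mul_le_mul_right _ (Nat.le_succ _))
    | div => exact lt_of_le_of_lt (Nat.div_le_self _ _) h₁

theorem bits_le_of_lt {B k v : ℕ} (hB : 0 < B) (h : v < 2 ^ (k * B)) : bits v ≤ (k + 1) * B := by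
  have : Nat.size v ≤ k * B := Nat.size_le.2 h
  unfold bits
  rw [Nat.add_mul]
  omega

theorem Bdd.bits_eval_le {B : ℕ} {s : State} (h : Bdd B s) (e : Expr) :
    bits (e.eval s) ≤ (e.size + 1) * B := bits_le_of_lt h.pos (h.eval_lt e)

theorem Bdd.cost_le {B : ℕ} {s : State} (h : Bdd B s) (e : Expr) :
    e.cost s ≤ e.weight * B := by
  induction e with
  | const k => exact h.bits_eval_le (.const k)
  | reg x => exact h.bits_eval_le (.reg x)
  | get a i ih =>
    have h₁ := h.bits_eval_le i
    have h₂ := h.bits_eval_le (.get a i)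
    simp only [Expr.cost, Expr.weight, Expr.size, Expr.eval, Nat.add_mul] at *
    omega
  | bin o e f ihe ihf =>
    have h₁ := h.bits_eval_le e
    have h₂ := h.bits_eval_le f
    have h₃ := h.bits_eval_le (.bin o e f)
    simp only [Expr.cost, Expr.weight, Expr.size, Expr.eval, Nat.add_mul] at *
    omega

/-! ### A Hoare logic with running times -/

/-- Every instruction of the programs below costs at most `instrWeight * B`. -/
def instrWeight : ℕ := 1000

/-- Started in `s`, the program halts after at most `T` instructions on `B`-bit entries, in a memory
with property `Q`. -/
def Runs (B : ℕ) (p : Program) (s : State) (T : ℕ) (Q : State → Prop) : Prop :=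
  Bdd B s → ∃ t s', Exec p s t s' ∧ t ≤ T * (instrWeight * B) ∧ Bdd B s' ∧ Q s'

variable {B : ℕ} {p q : Program} {ps : List Program} {s : State} {T T₁ T₂ : ℕ}
  {Q Q₁ : State → Prop}

theorem Runs.mono (h : Runs B p s T₁ Q) (hT : T₁ ≤ T₂) : Runs B p s T₂ Q := fun hb =>
  let ⟨t, s', h₁, h₂, h₃⟩ := h hb
  ⟨t, s', h₁, h₂.trans (Nat.mul_le_mul_right _ hT), h₃⟩

theorem Runs.of_bdd (h : Bdd B s → Runs B p s T Q) : Runs B p s T Q := fun hb => h hb hb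

theorem Runs.imp (h : Runs B p s T Q₁) (hQ : ∀ s', Frame p s s' → Bdd B s' → Q₁ s' → Q s') :
    Runs B p s T Q := fun hb =>
  let ⟨t, s', h₁, h₂, h₃, h₄⟩ := h hb
  ⟨t, s', h₁, h₂, h₃, hQ s' h₁.frame h₃ h₄⟩

theorem instrWeight_le (hB : 0 < B) : 1 ≤ instrWeight * B := by unfold instrWeight; omega

theorem Runs.skip (hQ : Q s) : Runs B .skip s 1 Q := fun hb =>
  ⟨1, s, .skip s, by simpa using instrWeight_le hb.pos, hb, hQ⟩

/-- The hypothesis `hv` is where overflow is excluded: the value written must again fit into `B`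
bits. The condition on the weight is decided by evaluating a literal expression. -/
theorem Runs.assign {x : ℕ} {e : Expr} (hv : Bdd B s → e.eval s < 2 ^ B)
    (hQ : Q (s.setReg x (e.eval s))) (hw : e.weight + e.size + 1 ≤ instrWeight := by decide) :
    Runs B (.assign x e) s 1 Q := fun hb => by
  refine ⟨_, _, .assign x e s, ?_, ⟨hb.pos, fun y => ?_, hb.arr⟩, hQ⟩
  · have h₁ := hb.cost_le e
    have h₂ := hb.bits_eval_le e
    have h₃ := Nat.mul_le_mul_right B hw
    simp only [Nat.add_mul] at *
    omega
  · simp only [State.reg_setReg]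
    split
    exacts [hv hb, hb.reg y]

theorem Runs.store {a : ℕ} {i e : Expr} (hv : Bdd B s → e.eval s < 2 ^ B)
    (hQ : Q (s.setArr a (i.eval s) (e.eval s)))
    (hw : i.weight + e.weight + i.size + e.size + 2 ≤ instrWeight := by decide) :
    Runs B (.store a i e) s 1 Q := fun hb => by
  refine ⟨_, _, .store a i e s, ?_, ⟨hb.pos, hb.reg, fun b j => ?_⟩, hQ⟩
  · have h₁ := hb.cost_le e
    have h₂ := hb.bits_eval_le e
    have h₄ := hb.cost_le i
    have h₅ := hb.bits_eval_le i
    have h₃ := Nat.mul_le_mul_right B hw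
    simp only [Nat.add_mul] at *
    omega
  · simp only [State.arr_setArr]
    split
    · rw [Function.update_apply]
      split
      exacts [hv hb, hb.arr _ _]
    · exact hb.arr b j

theorem Runs.seq (h : Runs B p s T₁ fun s₁ => Runs B q s₁ T₂ Q) :
    Runs B (.seq p q) s (T₁ + T₂) Q := fun hb => by
  obtain ⟨t₁, s₁, e₁, ht₁, hb₁, h₂⟩ := h hb
  obtain ⟨t₂, s₂, e₂, ht₂, hb₂, hQ⟩ := h₂ hb₁
  exact ⟨_, _, .seq e₁ e₂, by rw [Nat.add_mul]; omega, hb₂, hQ⟩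

theorem Runs.nil (hQ : Q s) : Runs B (block []) s 1 Q := Runs.skip hQ

theorem Runs.cons (h : Runs B p s T₁ Q₁)
    (h' : ∀ s₁, Frame p s s₁ → Bdd B s₁ → Q₁ s₁ → Runs B (block ps) s₁ T₂ Q) :
    Runs B (block (p :: ps)) s (T₁ + T₂) Q :=
  Runs.seq (h.imp h')

theorem Runs.cons_assign {x : ℕ} {e : Expr} (hv : Bdd B s → e.eval s < 2 ^ B)
    (h : Runs B (block ps) (s.setReg x (e.eval s)) T Q)
    (hw : e.weight + e.size + 1 ≤ instrWeight := by decide) :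
    Runs B (block (.assign x e :: ps)) s (T + 1) Q :=
  (Runs.seq (Runs.assign hv h hw)).mono (by omega)

theorem Runs.cons_store {a : ℕ} {i e : Expr} (hv : Bdd B s → e.eval s < 2 ^ B)
    (h : Runs B (block ps) (s.setArr a (i.eval s) (e.eval s)) T Q)
    (hw : i.weight + e.weight + i.size + e.size + 2 ≤ instrWeight := by decide) :
    Runs B (block (.store a i e :: ps)) s (T + 1) Q :=
  (Runs.seq (Runs.store hv h hw)).mono (by omega)

theorem Runs.ite {e : Expr} (ht : e.eval s ≠ 0 → Runs B p s T Q)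
    (hf : e.eval s = 0 → Runs B q s T Q)
    (hw : e.weight ≤ instrWeight := by decide) : Runs B (.ite e p q) s (T + 1) Q := fun hb => by
  have hc : e.cost s ≤ instrWeight * B := (hb.cost_le e).trans (Nat.mul_le_mul_right _ hw)
  by_cases he : e.eval s = 0
  · obtain ⟨t, s', h₁, h₂, h₃⟩ := hf he hb
    exact ⟨_, _, .ite_false he h₁, by rw [Nat.add_mul]; omega, h₃⟩
  · obtain ⟨t, s', h₁, h₂, h₃⟩ := ht he hb
    exact ⟨_, _, .ite_true he h₁, by rw [Nat.add_mul]; omega, h₃⟩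

/-- The loop bound is evaluated anew at every test, so it has to be constant on all memories that
agree with `s` outside the loop's writes. A round pays `2` for test and increment; the last `2` pays
for the initialization and the failing test. -/
theorem Runs.forLoop {x : ℕ} {e : Expr} (k : ℕ) (I : ℕ → State → Prop) (c : ℕ → ℕ)
    (hk : k < 2 ^ B)
    (he : ∀ s', Frame (forLoop x e p) s s' → e.eval s' = k)
    (h₀ : I 0 (s.setReg x 0))
    (hstep : ∀ i < k, ∀ s', Frame (Stabbing.forLoop x e p) s s' → s'.reg x = i → I i s' →
      Runs B p s' (c i) fun s'' => I (i + 1) (s''.setReg x (i + 1)))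
    (hQ : ∀ s', Frame (Stabbing.forLoop x e p) s s' → s'.reg x = k → I k s' → Q s')
    (hx : p.writesReg x = false := by rfl)
    (hw : (e - .reg x).weight ≤ instrWeight := by decide) :
    Runs B (Stabbing.forLoop x e p) s (∑ i ∈ Finset.range k, (c i + 2) + 2) Q := fun hb => by
  -- Induction on the number `j` of rounds still to come.
  have key : ∀ j ≤ k, ∀ s', Bdd B s' → Frame (Stabbing.forLoop x e p) s s' → s'.reg x = k - j →
      I (k - j) s' → ∃ t s'',
        Exec (.while (e - .reg x) (.seq p (.assign x (.reg x + 1)))) s' t s'' ∧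
        t ≤ (∑ i ∈ Finset.Ico (k - j) k, (c i + 2) + 1) * (instrWeight * B) ∧ Bdd B s'' ∧ Q s'' := by
    intro j
    induction j with
    | zero =>
      intro _ s' hb' hf hr hI
      refine ⟨_, s', .while_false ?_, ?_, hb', hQ s' hf hr hI⟩
      · simp [he s' hf, hr]
      · have := (hb'.cost_le (e - .reg x)).trans (Nat.mul_le_mul_right _ hw)
        simpa using this
    | succ j ih =>
      intro hj s' hb' hf hr hI
      obtain ⟨t₁, s₁, e₁, ht₁, hb₁, hI₁⟩ := hstep (k - (j + 1)) (by omega) s' hf hr hI hb'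
      have hr₁ : s₁.reg x = k - (j + 1) := (e₁.frame.reg x hx).trans hr
      have hkj : k - (j + 1) + 1 = k - j := by omega
      obtain ⟨t₂, s₂, e₂, ht₂, hb₂, hs₂⟩ := (show Runs B (.assign x (.reg x + 1)) s₁ 1
          (fun s₂ => s₂ = s₁.setReg x (k - j)) by
        refine Runs.assign (fun _ => ?_) ?_ (Nat.le_of_ble_eq_true rfl)
        · simp only [Expr.eval_add, Expr.eval_reg, Expr.eval_one, hr₁]; omega
        · simp [hr₁, hkj]) hb₁
      subst hs₂
      have hlp : Frame (Stabbing.forLoop x e p) s' (s₁.setReg x (k - j)) := by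
        refine Frame.trans (s₁ := s₁) (e₁.frame.mono ?_ ?_) (e₂.frame.mono ?_ ?_) <;>
          simp +contextual [Stabbing.forLoop, Program.writesReg, Program.writesArr]
      obtain ⟨t₃, s₃, e₃, ht₃, hb₃, hQ₃⟩ := ih (by omega) _ hb₂ (hf.trans hlp) (by simp)
        (by rw [hkj] at hI₁; exact hI₁)
      have hne : (e - .reg x).eval s' ≠ 0 := by
        simp [he s' hf, hr]; omega
      refine ⟨_, s₃, .while_true hne (.seq e₁ e₂) e₃, ?_, hb₃, hQ₃⟩
      have hc := (hb'.cost_le (e - .reg x)).trans (Nat.mul_le_mul_right _ hw)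
      rw [Finset.sum_eq_sum_Ico_succ_bot (by omega), hkj]
      simp only [Nat.add_mul] at *
      omega
  obtain ⟨t₀, s₀, e₀, ht₀, hb₀, hs₀⟩ := (show
      Runs B (.assign x 0) s 1 (fun s₂ => s₂ = s.setReg x 0) from
    Runs.assign (fun _ => by simp) (by simp)) hb
  subst hs₀
  obtain ⟨t, s', h₁, h₂, h₃⟩ := key k le_rfl _ hb₀ (e₀.frame.mono
    (by simp +contextual [Stabbing.forLoop, Program.writesReg])
    (by simp +contextual [Stabbing.forLoop, Program.writesArr])) (by simp) (by simpa using h₀)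
  refine ⟨_, s', .seq e₀ h₁, ?_, h₃⟩
  rw [Nat.sub_self, ← Finset.range_eq_Ico] at h₂
  simp only [Nat.add_mul] at *
  omega

/-! ### Shatter functions -/

/-- A family has at most as many members as it shatters sets. Here these are subsets of `X` with at
most `d` elements, and `∑ k ≤ d, (#X).choose k` is dominated term by term by the binomial expansion
of `(#X + 1) ^ d`. -/
theorem card_le_pow_of_shatters {α : Type*} [DecidableEq α] {𝒜 : Finset (Finset α)}
    {X : Finset α} {d : ℕ} (hX : ∀ a ∈ 𝒜, a ⊆ X) (hd : ∀ Y, 𝒜.Shatters Y → #Y ≤ d) :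
    #𝒜 ≤ (#X + 1) ^ d := by
  refine (card_le_card_shatterer 𝒜).trans ?_
  have h₁ : 𝒜.shatterer ⊆ (range (d + 1)).biUnion fun k => powersetCard k X := by
    intro s hs
    rw [mem_shatterer] at hs
    obtain ⟨t, ht, hst⟩ := hs.exists_superset
    exact mem_biUnion.2 ⟨#s, mem_range.2 (Nat.lt_succ_of_le (hd s hs)),
      mem_powersetCard.2 ⟨hst.trans (hX t ht), rfl⟩⟩
  refine (card_le_card h₁).trans (card_biUnion_le.trans ?_)
  rw [add_pow]
  refine sum_le_sum fun k hk => ?_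
  rw [card_powersetCard, one_pow, mul_one]
  calc (#X).choose k ≤ #X ^ k := Nat.choose_le_pow _ _
    _ ≤ #X ^ k * d.choose k :=
      Nat.le_mul_of_pos_right _ (Nat.choose_pos (Nat.le_of_lt_succ (mem_range.1 hk)))

/-- The sets `e 0, …, e (r - 1)` shatter no set of more than `d` elements. -/
def VCBound (e : ℕ → Finset ℕ) (r d : ℕ) : Prop :=
  ∀ Y : Finset ℕ, (∀ t ⊆ Y, ∃ q < r, Y ∩ e q = t) → #Y ≤ d

variable {e : ℕ → Finset ℕ} {r d : ℕ}

/-- Traces are recorded by positions, and `f` may repeat a vertex. Positions of the same vertex are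
never separated, so `f` is injective on a shattered set of positions, whose image is then a
shattered set of vertices. -/
theorem VCBound.card_traces_le (h : VCBound e r d) (f : ℕ → ℕ) (X : Finset ℕ)
    {𝒜 : Finset (Finset ℕ)} (h𝒜 : ∀ a ∈ 𝒜, ∃ q < r, a = X.filter fun k => f k ∈ e q) :
    #𝒜 ≤ (#X + 1) ^ d := by
  refine card_le_pow_of_shatters (X := X) (fun a ha => ?_) fun Y hY => ?_
  · obtain ⟨q, -, rfl⟩ := h𝒜 a ha
    exact filter_subset _ _
  have hYX : Y ⊆ X := by
    obtain ⟨a, ha, hYa⟩ := hY.exists_superset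
    obtain ⟨q, -, rfl⟩ := h𝒜 a ha
    exact hYa.trans (filter_subset _ _)
  have hinj : Set.InjOn f Y := by
    intro k hk l hl hkl
    obtain ⟨a, ha, hYa⟩ := hY.exists_inter_eq_singleton hk
    obtain ⟨q, -, rfl⟩ := h𝒜 a ha
    have h₁ : k ∈ Y ∩ X.filter fun k => f k ∈ e q := hYa ▸ mem_singleton_self k
    have h₂ : l ∈ Y ∩ X.filter fun k => f k ∈ e q := by
      simp only [mem_inter, mem_filter] at h₁ ⊢
      exact ⟨hl, hYX hl, hkl ▸ h₁.2.2⟩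
    rw [hYa] at h₂
    exact (mem_singleton.1 h₂).symm
  rw [← card_image_of_injOn hinj]
  refine h _ fun t ht => ?_
  obtain ⟨a, ha, hYa⟩ := hY (filter_subset (fun k => f k ∈ t) Y)
  obtain ⟨q, hq, rfl⟩ := h𝒜 a ha
  refine ⟨q, hq, ?_⟩
  ext v
  simp only [mem_inter, mem_image]
  constructor
  · rintro ⟨⟨k, hk, rfl⟩, hv⟩
    have : k ∈ Y.filter fun k => f k ∈ t := hYa ▸ by simp [hk, hYX hk, hv]
    exact (mem_filter.1 this).2
  · intro hv
    obtain ⟨k, hk, rfl⟩ := mem_image.1 (ht hv)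
    have : k ∈ Y ∩ X.filter fun k => f k ∈ e q := hYa ▸ by simp [hk, hv]
    simp only [mem_inter, mem_filter] at this
    exact ⟨⟨k, hk, rfl⟩, this.2.2⟩

/-- This counts trie nodes, which are prefixes of traces. Each of the `g` positive lengths has at
most `(g + 1) ^ d` prefixes; together with the empty set this stays below `(g + 1) ^ (d + 1)`. -/
theorem VCBound.card_prefix_traces_le (h : VCBound e r d) (f : ℕ → ℕ) (g : ℕ)
    {𝒜 : Finset (Finset ℕ)}
    (h𝒜 : ∀ a ∈ 𝒜, a = ∅ ∨ ∃ l ≤ g, ∃ q < r, a = (range l).filter fun k => f k ∈ e q) :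
    #𝒜 ≤ (g + 1) ^ (d + 1) := by
  have hsub : 𝒜 ⊆ {∅} ∪ (Ico 1 (g + 1)).biUnion fun l =>
      (range r).image fun q => (range l).filter fun k => f k ∈ e q := by
    intro a ha
    simp only [mem_union, mem_singleton, mem_biUnion, mem_image, mem_Ico, mem_range]
    obtain h' | ⟨l, hl, q, hq, rfl⟩ := h𝒜 a ha
    · exact .inl h'
    · rcases Nat.eq_zero_or_pos l with rfl | hl'
      · simp
      · exact .inr ⟨l, ⟨hl', by omega⟩, q, hq, rfl⟩
  refine (card_le_card hsub).trans ((card_union_le _ _).trans ?_)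
  have : #((Ico 1 (g + 1)).biUnion fun l =>
      (range r).image fun q => (range l).filter fun k => f k ∈ e q) ≤ g * (g + 1) ^ d := by
    refine card_biUnion_le.trans ((sum_le_card_nsmul _ _ ((g + 1) ^ d) fun l hl => ?_).trans
      (by simp))
    have hl := mem_Ico.1 hl
    refine (h.card_traces_le f (range l) fun a ha => ?_).trans
      (Nat.pow_le_pow_left (by rw [card_range]; omega) d)
    obtain ⟨q, hq, rfl⟩ := mem_image.1 ha
    exact ⟨q, mem_range.1 hq, rfl⟩
  have h1 : 1 ≤ (g + 1) ^ d := Nat.one_le_pow _ _ (Nat.succ_pos _)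
  rw [card_singleton, pow_succ]
  nlinarith

/-- If the vertices shattered `2^(d+1)` hyperedges, these could be labelled by the subsets of a set
of `d + 1` indices, and the `d + 1` vertices encoding the indices would be shattered by the
hyperedges. So the dual VC-dimension is below `2^(d+1)`, and Sauer–Shelah applies to the dual
family. -/
theorem VCBound.card_dual_traces_le (h : VCBound e r d) {S : Finset ℕ} (hS : S ⊆ range r)
    (V : Finset ℕ) :
    #(V.image fun v => S.filter fun q => v ∈ e q) ≤ (#S + 1) ^ 2 ^ (d + 1) := by
  refine card_le_pow_of_shatters (X := S) (fun a ha => ?_) fun Y hY => ?_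
  · obtain ⟨v, -, rfl⟩ := mem_image.1 ha
    exact filter_subset _ _
  by_contra! hlt
  obtain ⟨Z, hZY, hZc⟩ := exists_subset_card_eq hlt.le
  have hZ := hY.mono_right hZY
  have hZS : Z ⊆ S := by
    obtain ⟨a, ha, hZa⟩ := hZ.exists_superset
    obtain ⟨v, -, rfl⟩ := mem_image.1 ha
    exact hZa.trans (filter_subset _ _)
  have heq : Fintype.card Z = Fintype.card (Finset (Fin (d + 1))) := by simp [hZc]
  let φ : Z ≃ Finset (Fin (d + 1)) := Fintype.equivOfCardEq heq
  -- The vertex for `j` lies in exactly those hyperedges of `Z` whose label contains `j`.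
  have hv : ∀ j : Fin (d + 1), ∃ v, ∀ z : Z, v ∈ e z ↔ j ∈ φ z := by
    intro j
    obtain ⟨a, ha, hZa⟩ := hZ (t := Z.attach.filter (fun z => j ∈ φ z) |>.map
      (Function.Embedding.subtype _)) (by
        intro x hx
        simp only [mem_map, Function.Embedding.subtype_apply] at hx
        obtain ⟨z, -, rfl⟩ := hx
        exact z.2)
    obtain ⟨v, -, rfl⟩ := mem_image.1 ha
    refine ⟨v, fun z => ?_⟩
    have := Finset.ext_iff.1 hZa z
    simp only [mem_inter, mem_filter, mem_map, mem_attach, true_and,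
      Function.Embedding.subtype_apply, Subtype.exists, exists_and_right, exists_eq_right, z.2,
      hZS z.2, Subtype.coe_eta, exists_const] at this
    simpa using this
  choose v hv using hv
  have hinj : Function.Injective v := by
    intro i j hij
    have h₁ := hv i (φ.symm {i})
    have h₂ := hv j (φ.symm {i})
    rw [hij, h₂] at h₁
    simpa [eq_comm] using h₁
  have hcard : #(univ.image v) = d + 1 := by
    rw [card_image_of_injective _ hinj, card_univ, Fintype.card_fin]
  have := h (univ.image v) fun t ht => by
    -- The hyperedge labelled by the indices of `t` cuts out `t`.
    let z := φ.symm (univ.filter fun j => v j ∈ t)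
    refine ⟨z, mem_range.1 (hS (hZS z.2)), ?_⟩
    ext x
    simp only [mem_inter, mem_image, mem_univ, true_and]
    constructor
    · rintro ⟨⟨j, rfl⟩, hx⟩
      simpa [z] using (hv j z).1 hx
    · intro hx
      obtain ⟨j, -, rfl⟩ := mem_image.1 (ht hx)
      exact ⟨⟨j, rfl⟩, (hv j z).2 (by simpa [z] using hx)⟩
  omega

/-- Distinct hyperedges have distinct traces on the whole vertex set. That their number is
polynomial in `n` keeps all numbers of the computation at `O(log n)` bits. -/
theorem VCBound.card_le (h : VCBound e r d) {n : ℕ} (he : ∀ q < r, e q ⊆ range n)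
    (hinj : Set.InjOn e (range r)) : r ≤ (n + 1) ^ d := by
  have := h.card_traces_le id (range n) (𝒜 := (range r).image e) (fun a ha => by
    obtain ⟨q, hq, rfl⟩ := mem_image.1 ha
    refine ⟨q, mem_range.1 hq, ?_⟩
    ext k
    have := @he q (mem_range.1 hq) k
    simp only [id, mem_filter]
    tauto)
  rwa [card_image_of_injOn hinj, card_range, card_range] at this

/-! ### Tries

Every item `y` has a current node `max (cur y) root`. The node `x` stands for the set `σ x` of keys,
and the current node of `y` stands for the set `tr y` of the keys inserted for `y` so far, in
increasing order. `ch (c * st + i)` is the child of `c` with the additional key `i`, or `0`. -/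

structure Trie (st root T : ℕ) (cur ch rep lim : ℕ → ℕ) (σ tr : ℕ → Finset ℕ) : Prop where
  root_pos : 0 < root
  root_lt : root < T
  cur_lt : ∀ y, cur y < T
  σ_root : σ root = ∅
  lim_root : lim root = 0
  inj : ∀ x y, root ≤ x → x < T → root ≤ y → y < T → σ x = σ y → x = y
  node : ∀ y, σ (max (cur y) root) = tr y
  parent : ∀ x, root < x → x < T → ∃ c i, root ≤ c ∧ c < T ∧ i < st ∧ (∀ j ∈ σ c, j < i) ∧
    ch (c * st + i) = x ∧ σ x = insert i (σ c)
  child : ∀ c i, root ≤ c → c < T → i < st → ch (c * st + i) ≠ 0 →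
    root < ch (c * st + i) ∧ ch (c * st + i) < T ∧ σ (ch (c * st + i)) = insert i (σ c)
  fresh : ∀ j, T * st ≤ j → ch j = 0
  lim_fresh : ∀ x, T ≤ x → lim x = 0
  rep_lim : ∀ x, root < x → x < T → 0 < lim x ∧ lim x - 1 ∈ tr (rep x) ∧
    σ x = (tr (rep x)).filter (· < lim x)

namespace Trie

variable {st root T : ℕ} {cur ch rep lim : ℕ → ℕ} {σ tr : ℕ → Finset ℕ}

/-- Starting a new trie requires no clearing of memory. Its root is numbered above all nodes in use,
so `max` replaces every stale current node by the root, and the child cells of the root have never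
been written. -/
theorem init (hT : 0 < T) (hcur : ∀ y, cur y < T) (hch : ∀ j, T * st ≤ j → ch j = 0)
    (hlim : ∀ x, T ≤ x → lim x = 0) :
    Trie st T (T + 1) cur ch rep lim (fun _ => ∅) (fun _ => ∅) where
  root_pos := hT
  root_lt := T.lt_succ_self
  cur_lt y := (hcur y).trans T.lt_succ_self
  σ_root := rfl
  lim_root := hlim _ le_rfl
  inj x y h₁ h₂ h₃ h₄ _ := by omega
  node _ := rfl
  parent x h₁ h₂ := by omega
  child c i h₁ h₂ h₃ h₄ := by
    obtain rfl : c = T := by omega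
    exact absurd (hch _ (Nat.le_add_right _ _)) h₄
  fresh j hj := hch j (le_trans (Nat.mul_le_mul_right _ T.le_succ) hj)
  lim_fresh x hx := hlim x (by omega)
  rep_lim x h₁ h₂ := by omega

theorem node_lt (h : Trie st root T cur ch rep lim σ tr) (y : ℕ) : max (cur y) root < T :=
  max_lt (h.cur_lt y) h.root_lt

theorem insert_old (h : Trie st root T cur ch rep lim σ tr) {y κ : ℕ} (hκ : κ < st)
    (hy : ∀ j ∈ tr y, j < κ) (hc : ch (max (cur y) root * st + κ) ≠ 0) :
    Trie st root T (Function.update cur y (ch (max (cur y) root * st + κ))) ch rep lim σ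
      (Function.update tr y (insert κ (tr y))) := by
  obtain ⟨h₁, h₂, h₃⟩ := h.child _ κ (le_max_right _ _) (h.node_lt y) hκ hc
  refine { h with cur_lt := fun z => ?_, node := fun z => ?_, rep_lim := fun x hx hx' => ?_ }
  · rcases eq_or_ne z y with rfl | hz
    · simpa using h₂
    · simpa [hz] using h.cur_lt z
  · rcases eq_or_ne z y with rfl | hz
    · simp only [Function.update_self, max_eq_left h₁.le, h₃, h.node]
    · simpa [hz] using h.node z
  · obtain ⟨h₄, h₅, h₆⟩ := h.rep_lim x hx hx'
    rcases eq_or_ne (rep x) y with hz | hz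
    · have := hy _ (hz ▸ h₅)
      simp only [hz, Function.update_self, mem_insert]
      rw [hz] at h₅ h₆
      refine ⟨h₄, .inr h₅, ?_⟩
      rw [filter_insert, if_neg (by omega), h₆]
    · simpa [hz] using ⟨h₄, h₅, h₆⟩

/-- The essential point is that no existing node has the new set. Keys arrive in increasing order,
so such a node would be the child for the largest key `κ` of a node with the set `tr y`, that is of
the current node, whose child cell for `κ` is empty. -/
theorem insert_new (h : Trie st root T cur ch rep lim σ tr) {y κ : ℕ} (hκ : κ < st)
    (hy : ∀ j ∈ tr y, j < κ) (hc : ch (max (cur y) root * st + κ) = 0) :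
    Trie st root (T + 1) (Function.update cur y T)
      (Function.update ch (max (cur y) root * st + κ) T) (Function.update rep T y)
      (Function.update lim T (κ + 1)) (Function.update σ T (insert κ (tr y)))
      (Function.update tr y (insert κ (tr y))) := by
  set c := max (cur y) root with hcdef
  have hcr : root ≤ c := le_max_right _ _
  have hcT : c < T := h.node_lt y
  have hσc : σ c = tr y := h.node y
  have hrT := h.root_lt
  have hr0 := h.root_pos
  have hidx : ∀ c' i, i < st → c' * st + i = c * st + κ → c' = c ∧ i = κ := by
    intro c' i hi heq
    have h₁ : (c' * st + i) / st = (c * st + κ) / st := by rw [heq]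
    have h₂ : (c' * st + i) % st = (c * st + κ) % st := by rw [heq]
    rw [Nat.mul_comm c', Nat.mul_comm c, Nat.mul_add_div (by omega), Nat.mul_add_div (by omega),
      Nat.div_eq_of_lt hi, Nat.div_eq_of_lt hκ] at h₁
    rw [Nat.mul_comm c', Nat.mul_comm c, Nat.mul_add_mod, Nat.mul_add_mod, Nat.mod_eq_of_lt hi,
      Nat.mod_eq_of_lt hκ] at h₂
    exact ⟨h₁, h₂⟩
  have hnew : ∀ x, root ≤ x → x < T → σ x ≠ insert κ (tr y) := by
    intro x hx hxT heq
    rcases hx.eq_or_lt with rfl | hx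
    · rw [h.σ_root] at heq
      exact (insert_ne_empty _ _ heq.symm).elim
    obtain ⟨c', i, h₁, h₂, h₃, h₄, h₅, h₆⟩ := h.parent x hx hxT
    rw [h₆] at heq
    -- Both are the largest element of the same set.
    have hiκ : i = κ := by
      have h₇ : i ∈ insert κ (tr y) := heq ▸ mem_insert_self _ _
      have h₈ : κ ∈ insert i (σ c') := heq ▸ mem_insert_self _ _
      rcases mem_insert.1 h₇ with h₇ | h₇
      · exact h₇
      rcases mem_insert.1 h₈ with h₈ | h₈
      · exact h₈.symm
      exact absurd (hy _ h₇) (by have := h₄ _ h₈; omega)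
    subst hiκ
    have hcc : σ c' = σ c := by
      rw [hσc, ← erase_insert (fun hi => lt_irrefl _ (h₄ _ hi)), heq,
        erase_insert (fun hi => lt_irrefl _ (hy _ hi))]
    rw [h.inj c' c h₁ h₂ hcr hcT hcc, hc] at h₅
    omega
  refine ⟨hr0, by omega, fun z => ?_, ?_, ?_, fun x z hx hx' hz hz' hxz => ?_, fun z => ?_,
    fun x hx hx' => ?_, fun c' i h₁ h₂ h₃ h₄ => ?_, fun j hj => ?_, fun x hx => ?_,
    fun x hx hx' => ?_⟩
  · rcases eq_or_ne z y with rfl | hz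
    · simp
    · simpa [hz] using (h.cur_lt z).trans T.lt_succ_self
  · rw [Function.update_of_ne (by omega), h.σ_root]
  · rw [Function.update_of_ne (by omega), h.lim_root]
  · rcases eq_or_ne x T with rfl | hxT <;> rcases eq_or_ne z x with rfl | hzT
    · rfl
    · rw [Function.update_self, Function.update_of_ne hzT] at hxz
      exact absurd hxz.symm (hnew z hz (by omega))
    · rfl
    · rw [Function.update_of_ne hxT] at hxz
      rcases eq_or_ne z T with rfl | hzT'
      · rw [Function.update_self] at hxz
        exact absurd hxz (hnew x hx (by omega))
      · rw [Function.update_of_ne hzT'] at hxz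
        exact h.inj x z hx (by omega) hz (by omega) hxz
  · rcases eq_or_ne z y with rfl | hz
    · simp [max_eq_left hrT.le]
    · have := h.node_lt z
      rw [Function.update_of_ne hz, Function.update_of_ne hz, Function.update_of_ne (by omega),
        h.node z]
  · rcases eq_or_ne x T with rfl | hxT
    · refine ⟨c, κ, hcr, by omega, hκ, ?_, by simp, ?_⟩
      · rw [Function.update_of_ne (by omega), hσc]
        exact hy
      · rw [Function.update_self, Function.update_of_ne (by omega), hσc]
    · obtain ⟨c', i, h₁, h₂, h₃, h₄, h₅, h₆⟩ := h.parent x hx (by omega)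
      refine ⟨c', i, h₁, by omega, h₃, ?_, ?_, ?_⟩
      · rwa [Function.update_of_ne (by omega)]
      · rw [Function.update_of_ne, h₅]
        intro heq
        rw [heq, hc] at h₅
        omega
      · rwa [Function.update_of_ne hxT, Function.update_of_ne (by omega)]
  · by_cases heq : c' * st + i = c * st + κ
    · obtain ⟨rfl, rfl⟩ := hidx _ _ h₃ heq
      rw [Function.update_self]
      refine ⟨hrT, by omega, ?_⟩
      rw [Function.update_self, Function.update_of_ne (by omega), hσc]
    · rw [Function.update_of_ne heq] at h₄ ⊢
      -- A parent numbered `T` is impossible: the child cells of the new node are still zero.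
      have hc'T : c' < T := by
        by_contra hlt
        exact h₄ (h.fresh _ ((Nat.mul_le_mul_right st (not_lt.1 hlt)).trans (Nat.le_add_right _ _)))
      obtain ⟨h₅, h₆, h₇⟩ := h.child c' i h₁ hc'T h₃ h₄
      refine ⟨h₅, by omega, ?_⟩
      rw [Function.update_of_ne (by omega), Function.update_of_ne (by omega), h₇]
  · rw [Nat.add_mul] at hj
    have : (c + 1) * st ≤ T * st := Nat.mul_le_mul_right _ hcT
    rw [Nat.add_mul] at this
    rw [Function.update_of_ne (by omega)]
    exact h.fresh j (by omega)
  · rw [Function.update_of_ne (by omega)]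
    exact h.lim_fresh x (by omega)
  · rcases eq_or_ne x T with rfl | hxT
    · simp only [Function.update_self, Nat.succ_pos, Nat.add_sub_cancel, mem_insert_self, true_and]
      refine (filter_true_of_mem fun j hj => ?_).symm
      rcases mem_insert.1 hj with rfl | hj
      · omega
      · have := hy j hj
        omega
    · obtain ⟨h₄, h₅, h₆⟩ := h.rep_lim x hx (by omega)
      simp only [Function.update_of_ne hxT]
      rcases eq_or_ne (rep x) y with hz | hz
      · have := hy _ (hz ▸ h₅)
        simp only [hz, Function.update_self, mem_insert]
        rw [hz] at h₅ h₆
        refine ⟨h₄, .inr h₅, ?_⟩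
        rw [filter_insert, if_neg (by omega), h₆]
      · simpa [hz] using ⟨h₄, h₅, h₆⟩

/-- The sets of the nodes need not be stored: a representative item and a cut-off recover them, even
after the trace of the representative has grown. -/
theorem σ_eq_filter (h : Trie st root T cur ch rep lim σ tr) {x : ℕ} (hx : root ≤ x) (hx' : x < T) :
    σ x = (tr (rep x)).filter (· < lim x) := by
  rcases hx.eq_or_lt with rfl | hx
  · simp [h.σ_root, h.lim_root]
  · exact (h.rep_lim x hx hx').2.2

theorem card_le (h : Trie st root T cur ch rep lim σ tr) {𝒮 : Finset (Finset ℕ)}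
    (h𝒮 : ∀ x, root ≤ x → x < T → σ x ∈ 𝒮) : T - root ≤ #𝒮 := by
  rw [← Nat.card_Ico]
  refine card_le_card_of_injOn σ (fun x hx => ?_) fun x hx y hy hxy => ?_
  · have := mem_Ico.1 hx
    exact h𝒮 x this.1 this.2
  · simp only [coe_Ico, Set.mem_Ico] at hx hy
    exact h.inj x y hx.1 hx.2 hy.1 hy.2 hxy

theorem node_eq_iff (h : Trie st root T cur ch rep lim σ tr) (y z : ℕ) :
    max (cur y) root = max (cur z) root ↔ tr y = tr z := by
  constructor
  · intro heq
    rw [← h.node y, ← h.node z, heq]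
  · intro heq
    exact h.inj _ _ (le_max_right _ _) (h.node_lt y) (le_max_right _ _) (h.node_lt z)
      (by rw [h.node, h.node, heq])

end Trie

/-! ### Paths through classes -/

theorem countP_zip_fst_le {α β : Type*} (p : α → Bool) (l : List α) (l' : List β) :
    (l.zip l').countP (fun e => p e.1) ≤ l.countP p := by
  induction l generalizing l' with
  | nil => simp
  | cons a l ih =>
    cases l' with
    | nil => simp
    | cons b l' =>
      simp only [List.zip_cons_cons, List.countP_cons]
      have := ih l'
      omega

theorem countP_zip_snd_le {α β : Type*} (p : β → Bool) (l : List α) (l' : List β) :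
    (l.zip l').countP (fun e => p e.2) ≤ l'.countP p := by
  induction l generalizing l' with
  | nil => simp
  | cons a l ih =>
    cases l' with
    | nil => simp
    | cons b l' =>
      simp only [List.zip_cons_cons, List.countP_cons]
      have := ih l'
      omega

theorem countP_mem_le_card {α : Type*} [DecidableEq α] {l : List α} (hl : l.Nodup) (D : Finset α) :
    l.countP (fun a => decide (a ∈ D)) ≤ #D := by
  rw [List.countP_eq_length_filter, ← List.toFinset_card_of_nodup (hl.filter _)]
  exact card_le_card fun a ha => by simpa using (List.mem_filter.1 (List.mem_toFinset.1 ha)).2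

/-- In a sorted list a class that has been left never returns, so each change can be charged to the
class being left. -/
theorem countP_class_change_le {α : Type*} (cl : α → ℕ) (l : List α)
    (hl : l.Pairwise fun a b => cl a ≤ cl b) :
    (l.zip l.tail).countP (fun e => decide (¬cl e.1 = cl e.2)) ≤ #(l.map cl).toFinset := by
  induction l with
  | nil => simp
  | cons a l ih =>
    cases l with
    | nil => simp
    | cons b l =>
      obtain ⟨h₁, h₂⟩ := List.pairwise_cons.1 hl
      have ih := ih h₂
      simp only [List.tail_cons] at ih ⊢
      rw [List.zip_cons_cons, List.countP_cons, List.map_cons, List.toFinset_cons]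
      by_cases hab : cl a = cl b
      · simp only [hab, not_true_eq_false, decide_false, Bool.false_eq_true, if_false,
          add_zero]
        exact ih.trans (card_le_card (subset_insert _ _))
      · rw [card_insert_of_notMem]
        · simp only [hab, not_false_eq_true, decide_true, if_true]
          omega
        · simp only [List.mem_toFinset, List.mem_map, not_exists, not_and]
          intro c hc hca
          have h₃ := h₁ b (by simp)
          have h₄ : cl b ≤ cl c := by
            rcases List.mem_cons.1 hc with rfl | hc
            · exact le_rfl
            · exact (List.pairwise_cons.1 h₂).1 c hc
          omega

theorem ne_of_mem_pathEdges {n : ℕ} {P : List (Fin n)} (hP : P.Nodup) {e : Fin n × Fin n}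
    (he : e ∈ pathEdges P) : e.1 ≠ e.2 := by
  obtain ⟨i, hi, rfl⟩ := List.getElem_of_mem he
  simp only [pathEdges, List.getElem_zip, List.getElem_tail]
  intro h
  have := hP.getElem_inj_iff.1 h
  omega

/-- A stabbed edge changes the class, or has its first endpoint in `D`, or its second. A vertex is
the first endpoint of at most one edge and the second endpoint of at most one, whence the factor
`2`. -/
theorem length_stabbedEdges_le {n : ℕ} {P : List (Fin n)} (hP : P.Nodup) (cl : Fin n → ℕ)
    (hcl : P.Pairwise fun a b => cl a ≤ cl b) (q D : Finset (Fin n))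
    (hD : ∀ u v, u ≠ v → cl u = cl v → #(q ∩ {u, v}) = 1 → u ∈ D ∨ v ∈ D) :
    (stabbedEdges P q).length ≤ #(P.map cl).toFinset + 2 * #D := by
  have h₁ := countP_class_change_le cl P hcl
  have h₂ := (countP_zip_fst_le (fun a => decide (a ∈ D)) P P.tail).trans (countP_mem_le_card hP D)
  have h₃ := (countP_zip_snd_le (fun a => decide (a ∈ D)) P P.tail).trans
    (countP_mem_le_card hP.tail D)
  have key : ∀ l : List (Fin n × Fin n), (∀ e ∈ l, e.1 ≠ e.2) →
      l.countP (fun e => decide (#(q ∩ {e.1, e.2}) = 1)) ≤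
      l.countP (fun e => decide (¬cl e.1 = cl e.2)) + l.countP (fun e => decide (e.1 ∈ D)) +
        l.countP (fun e => decide (e.2 ∈ D)) := by
    intro l hl
    induction l with
    | nil => simp
    | cons e l ih =>
      have := hD e.1 e.2 (hl e (by simp))
      have ih := ih fun e he => hl e (by simp [he])
      simp only [List.countP_cons, decide_eq_true_eq]
      by_cases h₄ : #(q ∩ {e.1, e.2}) = 1
      · by_cases h₅ : cl e.1 = cl e.2
        · rcases this h₅ h₄ with h₆ | h₆ <;> simp only [h₄, h₆, if_true] <;> omega
        · simp only [h₄, h₅, if_true, not_false_eq_true]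
          omega
      · simp only [h₄, if_false]
        omega
  rw [stabbedEdges, pathEdges, ← List.countP_eq_length_filter]
  have := key (P.zip P.tail) fun e he => ne_of_mem_pathEdges hP he
  omega

/-! ### Choosing one point of each of `h = K ^ 2` pairs -/

/-- The new weight of a set containing `a` of the chosen and `b` of the rejected point. -/
def reweight (K W a b : ℕ) : ℕ := (W * (K + b - a) + K - 1) / K

theorem mul_reweight_le (K W a b : ℕ) : K * reweight K W a b ≤ W * (K + b - a) + K - 1 := by
  rw [reweight, mul_comm]
  exact Nat.div_mul_le_self _ _

/-- Integer weights are rounded up, so they dominate the real product of the factors `1 + (b - a) /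
K`. The price of rounding appears in `sum_reweight_le`. -/
theorem le_reweight {K a : ℕ} (hK : 0 < K) (ha : a ≤ 1) (W b : ℕ) :
    (W : ℝ) * (1 + ((b : ℝ) - a) / K) ≤ reweight K W a b := by
  have h₁ : W * (K + b - a) ≤ K * reweight K W a b := by
    have := Nat.lt_mul_div_succ (W * (K + b - a) + K - 1) hK
    rw [reweight]
    rw [Nat.mul_add] at this
    omega
  have h₂ : ((K + b - a : ℕ) : ℝ) = K + b - a := by
    rw [Nat.cast_sub (by omega)]
    push_cast
    ring
  have h₃ : (W : ℝ) * (K + b - a) ≤ K * reweight K W a b := by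
    rw [← h₂]
    exact_mod_cast h₁
  have hK' : (0 : ℝ) < K := by exact_mod_cast hK
  rw [← mul_le_mul_iff_right₀ hK']
  refine le_trans (le_of_eq ?_) h₃
  field_simp
  ring

/-- When the chosen point carries at least as much weight as the rejected one, the exact total does
not grow; rounding adds at most `1` for each of the `M` sets. -/
theorem sum_reweight_le {K M : ℕ} (hK : 0 < K) {W a b : ℕ → ℕ} (ha : ∀ z, a z ≤ 1)
    (hab : ∑ z ∈ range M, W z * b z ≤ ∑ z ∈ range M, W z * a z) :
    ∑ z ∈ range M, reweight K (W z) (a z) (b z) ≤ ∑ z ∈ range M, W z + M := by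
  refine Nat.le_of_mul_le_mul_left ?_ hK
  have h₁ : ∀ z, K * reweight K (W z) (a z) (b z) + W z * a z ≤
      W z * K + W z * b z + K := by
    intro z
    have h₁ := mul_reweight_le K (W z) (a z) (b z)
    have h₂ : W z * (K + b z - a z) + W z * a z = W z * K + W z * b z := by
      rw [← Nat.mul_add, ← Nat.mul_add, Nat.sub_add_cancel (by have := ha z; omega)]
    omega
  have h₂ := sum_le_sum fun z (_ : z ∈ range M) => h₁ z
  simp only [sum_add_distrib, ← mul_sum, ← sum_mul, sum_const, card_range, smul_eq_mul] at h₂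
  have h₃ : (∑ z ∈ range M, W z) * K = K * ∑ z ∈ range M, W z := mul_comm _ _
  have h₄ : M * K = K * M := mul_comm _ _
  rw [Nat.mul_add]
  omega

/-- Here `b - a` is `0`, `1` or `-1`, and `log y ≥ 1 - 1/y` suffices. The constant `2` is what this
estimate needs for `b - a = -1` and `K = 2`. -/
theorem log_one_add_div_ge {K : ℕ} (hK : 2 ≤ K) {a b : ℕ} (ha : a ≤ 1) (hb : b ≤ 1) :
    ((b : ℝ) - a) / K - 2 / (K * K) ≤ Real.log (1 + ((b : ℝ) - a) / K) := by
  have hK' : (2 : ℝ) ≤ K := by exact_mod_cast hK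
  have hx : ((b : ℝ) - a) = 0 ∨ ((b : ℝ) - a) = 1 ∨ ((b : ℝ) - a) = -1 := by
    interval_cases a <;> interval_cases b <;> norm_num
  rcases hx with hx | hx | hx <;> rw [hx]
  · have : (0 : ℝ) ≤ 2 / (K * K) := by positivity
    simpa using this
  · have h₁ := Real.one_sub_inv_le_log_of_pos (x := 1 + 1 / (K : ℝ)) (by positivity)
    refine le_trans ?_ h₁
    rw [one_add_div (by positivity), inv_div, ← sub_nonneg]
    have : (1 - (K : ℝ) / (K + 1)) - (1 / K - 2 / (K * K)) = (K + 2) / (K * K * (K + 1)) := by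
      field_simp
      ring
    rw [this]
    positivity
  · have h₁ := Real.one_sub_inv_le_log_of_pos (x := 1 + -1 / (K : ℝ))
      (by rw [one_add_div (by positivity)]; apply div_pos <;> linarith)
    refine le_trans ?_ h₁
    rw [one_add_div (by positivity), inv_div, ← sub_nonneg]
    have hK1 : (K : ℝ) - 1 > 0 := by linarith
    have h2 : (K : ℝ) + -1 ≠ 0 := by linarith
    have : (1 - (K : ℝ) / (K + -1)) - (-1 / K - 2 / (K * K)) =
        (K - 2) / (K * K * (K + -1)) := by
      field_simp
      ring
    rw [this]
    have : (0 : ℝ) < K + -1 := by linarith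
    apply div_nonneg
    · linarith
    · positivity

/-- Taking logarithms, the linear terms give `(∑ b - ∑ a) / K`, the quadratic errors of the `K²`
factors sum to `2`, and the right side is at most `B log 2 ≤ B`. The number `K²` of rounds is chosen
so that the quadratic errors stay bounded. -/
theorem sum_le_of_prod_le {K B W : ℕ} (hK : 0 < K) {a b : ℕ → ℕ} (ha : ∀ i, a i ≤ 1)
    (hb : ∀ i, b i ≤ 1) (hW : W < 2 ^ B)
    (hprod : ∏ i ∈ range (K * K), (1 + ((b i : ℝ) - a i) / K) ≤ W) :
    ∑ i ∈ range (K * K), b i ≤ ∑ i ∈ range (K * K), a i + K * (B + 2) := by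
  -- For `K = 1` a factor may vanish, so logarithms are of no use; but then there is only one term.
  rcases Nat.lt_or_ge K 2 with hK2 | hK2
  · obtain rfl : K = 1 := by omega
    have := hb 0
    simp
    omega
  have hK' : (2 : ℝ) ≤ K := by exact_mod_cast hK2
  have hpos : ∀ i, (0 : ℝ) < 1 + ((b i : ℝ) - a i) / K := by
    intro i
    have h₁ : (a i : ℝ) ≤ 1 := by exact_mod_cast ha i
    have h₂ : (0 : ℝ) ≤ b i := Nat.cast_nonneg _
    rw [one_add_div (by positivity)]
    apply div_pos <;> linarith
  have h₁ : Real.log (∏ i ∈ range (K * K), (1 + ((b i : ℝ) - a i) / K)) ≤ B := by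
    rcases Nat.eq_zero_or_pos W with rfl | hW0
    · exact absurd (prod_pos fun i (_ : i ∈ range (K * K)) => hpos i) (by
        simpa using hprod)
    calc _ ≤ Real.log W := Real.log_le_log (prod_pos fun i _ => hpos i) hprod
      _ ≤ Real.log (2 ^ B) := Real.log_le_log (by exact_mod_cast hW0) (by exact_mod_cast hW.le)
      _ = B * Real.log 2 := Real.log_pow _ _
      _ ≤ B * 1 := by
        gcongr
        have := Real.log_two_lt_d9
        linarith
      _ = B := mul_one _
  rw [Real.log_prod (fun i _ => (hpos i).ne')] at h₁
  have h₂ := (sum_le_sum fun i (_ : i ∈ range (K * K)) =>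
    log_one_add_div_ge hK2 (ha i) (hb i)).trans h₁
  rw [sum_sub_distrib, ← sum_div, sum_sub_distrib, sum_const, card_range, nsmul_eq_mul] at h₂
  have h₃ : ((K * K : ℕ) : ℝ) * (2 / (K * K)) = 2 := by
    push_cast
    field_simp
  rw [h₃, sub_le_iff_le_add, div_le_iff₀ (by linarith)] at h₂
  have h₄ : (∑ i ∈ range (K * K), (b i : ℝ)) ≤ ∑ i ∈ range (K * K), (a i : ℝ) + K * (B + 2) := by
    linarith
  exact_mod_cast h₄

/-! ### Registers and arrays -/

notation "rd" => (0 : ℕ)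
notation "rn" => (1 : ℕ)
notation "rr" => (2 : ℕ)
notation "rN" => (3 : ℕ)
notation "rK" => (4 : ℕ)
notation "rh" => (5 : ℕ)
notation "rg" => (6 : ℕ)
notation "rStride" => (7 : ℕ)
notation "rGroups" => (8 : ℕ)
notation "rLevels" => (9 : ℕ)
notation "rRoot" => (10 : ℕ)
notation "rT" => (11 : ℕ)
notation "rBase" => (12 : ℕ)
notation "rItem" => (13 : ℕ)
notation "rKey" => (14 : ℕ)
notation "rNode" => (15 : ℕ)
notation "rVertex" => (16 : ℕ)
notation "ri" => (17 : ℕ)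
notation "rj" => (18 : ℕ)

notation "aInput" => (0 : ℕ)
notation "aOutput" => (1 : ℕ)
notation "aDeg" => (2 : ℕ)
notation "aAdj" => (3 : ℕ)
notation "aInc" => (4 : ℕ)
notation "aStart" => (5 : ℕ)
notation "aSample" => (6 : ℕ)
notation "aCur" => (7 : ℕ)
notation "aCh" => (8 : ℕ)
notation "aRep" => (9 : ℕ)
notation "aLim" => (10 : ℕ)

/-! ### Inserting a key into a trie -/

/-- Insert the key `rKey` for the item `rItem`. -/
def insertKey : Program := block [
  .assign rNode (.get aCur (.reg rItem)),
  .ite (.reg rRoot - .reg rNode) (.assign rNode (.reg rRoot)) .skip,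
  .ite (.get aCh (.reg rNode * .reg rStride + .reg rKey)) .skip (block [
    .store aCh (.reg rNode * .reg rStride + .reg rKey) (.reg rT),
    .store aRep (.reg rT) (.reg rItem),
    .store aLim (.reg rT) (.reg rKey + 1),
    .assign rT (.reg rT + 1)]),
  .store aCur (.reg rItem) (.get aCh (.reg rNode * .reg rStride + .reg rKey))]

/-- The memory holds a trie. -/
def IsTrie (s : State) (σ tr : ℕ → Finset ℕ) : Prop :=
  Trie (s.reg rStride) (s.reg rRoot) (s.reg rT) (s.arr aCur) (s.arr aCh) (s.arr aRep) (s.arr aLim)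
    σ tr

variable {B : ℕ} {s : State}

/-- The last instruction reads the child cell after it has been filled if necessary, so both cases
end with the same store. They are `insert_new` and `insert_old`. -/
theorem runs_insertKey {σ tr : ℕ → Finset ℕ} (h : IsTrie s σ tr)
    (hκ : s.reg rKey < s.reg rStride) (hy : ∀ j ∈ tr (s.reg rItem), j < s.reg rKey)
    (hB : s.reg rT + 1 < 2 ^ B) :
    Runs B insertKey s 12 fun s' => s'.reg rT ≤ s.reg rT + 1 ∧
      (∀ y, y ≠ s.reg rItem → s'.arr aCur y = s.arr aCur y) ∧ ∃ σ', IsTrie s' σ'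
        (Function.update tr (s.reg rItem) (insert (s.reg rKey) (tr (s.reg rItem)))) := by
  refine Runs.mono (T₁ := 11) ?_ (by norm_num)
  refine Runs.cons_assign (fun hb => hb.arr _ _) ?_
  refine Runs.mono (T₁ := (1 + 1) + ((5 + 1) + (1 + 1))) ?_ (by norm_num)
  set c := max (s.arr aCur (s.reg rItem)) (s.reg rRoot) with hc
  refine Runs.cons (Q₁ := fun s' => s' = s.setReg rNode c) (Runs.ite (fun h₁ => ?_) fun h₁ => ?_)
    fun s₁ hf hb hs₁ => ?_
  · refine Runs.assign (fun hb => hb.reg _) ?_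
    simp only [Expr.eval_sub, Expr.eval_reg, Expr.eval_get, State.reg_setReg] at h₁ ⊢
    have : c = s.reg rRoot := max_eq_right (by simp at h₁; omega)
    rw [this]
    simp [State.setReg]
  · refine Runs.skip ?_
    simp only [Expr.eval_sub, Expr.eval_reg, Expr.eval_get, State.reg_setReg] at h₁ ⊢
    have : c = s.arr aCur (s.reg rItem) := max_eq_left (by simp at h₁; omega)
    rw [this]
  subst hs₁
  by_cases hch : s.arr aCh (c * s.reg rStride + s.reg rKey) = 0
  · refine Runs.cons (Q₁ := fun s' => s' = ((((s.setReg rNode c).setArr aCh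
      (c * s.reg rStride + s.reg rKey) (s.reg rT)).setArr aRep (s.reg rT) (s.reg rItem)).setArr aLim
      (s.reg rT) (s.reg rKey + 1)).setReg rT (s.reg rT + 1))
      (Runs.ite (fun h₁ => ?_) fun h₁ => ?_) fun s₂ _ _ hs₂ => ?_
    · simp [hch] at h₁
    · refine Runs.cons_store (T := 4) (fun hb => hb.reg _) ?_
      refine Runs.cons_store (T := 3) (fun hb => hb.reg _) ?_
      refine Runs.cons_store (T := 2) (fun hb => ?_) ?_
      · have := hb.reg rStride
        simp at this ⊢
        omega
      refine Runs.cons_assign (T := 1) (fun hb => ?_) (Runs.nil ?_)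
      · simpa using hB
      · simp
    · subst hs₂
      refine Runs.cons_store (fun hb => hb.arr _ _) (Runs.nil ?_)
      refine ⟨by simp, fun y hy => by simp [hy],
        Function.update σ (s.reg rT) (insert (s.reg rKey) (tr (s.reg rItem))), ?_⟩
      have := h.insert_new hκ hy hch
      rw [← hc] at this
      simpa [IsTrie] using this
  · refine Runs.cons (T₁ := 5 + 1) (Q₁ := fun s' => s' = s.setReg rNode c)
      (Runs.ite (fun h₁ => Runs.mono (T₁ := 1) (Runs.skip rfl) (by norm_num)) fun h₁ => ?_)
      fun s₂ _ _ hs₂ => ?_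
    · simp [hch] at h₁
    · subst hs₂
      refine Runs.cons_store (fun hb => hb.arr _ _) (Runs.nil ?_)
      refine ⟨by simp, fun y hy => by simp [hy], σ, ?_⟩
      have := h.insert_old hκ hy hch
      rw [← hc] at this
      simpa [IsTrie] using this

/-! ### The trie of the traces on a group of positions -/

/-- The hyperedges containing `v`, in increasing order. -/
def incidentEdges (e : ℕ → Finset ℕ) (r v : ℕ) : List ℕ := (List.range r).filter fun q => v ∈ e q

theorem mem_incidentEdges {e : ℕ → Finset ℕ} {r v q : ℕ} :
    q ∈ incidentEdges e r v ↔ q < r ∧ v ∈ e q := by simp [incidentEdges]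

theorem nodup_incidentEdges (e : ℕ → Finset ℕ) (r v : ℕ) : (incidentEdges e r v).Nodup :=
  List.nodup_range.filter _

/-- The memory holds, for every vertex, the list of the hyperedges that contain it. -/
structure HasAdj (s : State) (e : ℕ → Finset ℕ) (r : ℕ) : Prop where
  reg_r : s.reg rr = r
  deg : ∀ v, s.arr aDeg v = (incidentEdges e r v).length
  adj : ∀ v j, (hj : j < (incidentEdges e r v).length) →
    s.arr aAdj (v * r + j) = (incidentEdges e r v)[j]

/-- The trace of the hyperedge `y` on the first `l` positions of a group. -/
def groupTrace (e : ℕ → Finset ℕ) (r : ℕ) (f : ℕ → ℕ) (l y : ℕ) : Finset ℕ :=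
  if y < r then (range l).filter fun k => f k ∈ e y else ∅

/-- Build the trie of the traces of all hyperedges on the group starting at position `rBase`. -/
def buildTrie : Program := block [
  .assign rRoot (.reg rT),
  .assign rT (.reg rT + 1),
  forLoop ri (.reg rg) (block [
    .assign rVertex (.get aSample (.reg rBase + .reg ri)),
    .assign rKey (.reg ri),
    forLoop rj (.get aDeg (.reg rVertex)) (block [
      .assign rItem (.get aAdj (.reg rVertex * .reg rr + .reg rj)),
      insertKey])])]

/-- No node numbered `rT` or higher is in use. -/
structure FreshTrie (s : State) : Prop where
  pos : 0 < s.reg rT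
  cur : ∀ y, s.arr aCur y < s.reg rT
  ch : ∀ j, s.reg rT * s.reg rStride ≤ j → s.arr aCh j = 0
  lim : ∀ x, s.reg rT ≤ x → s.arr aLim x = 0

theorem IsTrie.freshTrie {σ tr : ℕ → Finset ℕ} (h : IsTrie s σ tr) : FreshTrie s :=
  ⟨h.root_pos.trans h.root_lt, h.cur_lt, h.fresh, h.lim_fresh⟩

variable {e : ℕ → Finset ℕ} {r d : ℕ}

/-- A node is the trace of its representative cut off at its limit, hence again a prefix of a trace.
The prefix lengths may differ between items, so the bound also holds in the middle of a
construction. -/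
theorem Trie.sub_le {st root T : ℕ} {cur ch rep lim : ℕ → ℕ} {σ tr : ℕ → Finset ℕ}
    (h : Trie st root T cur ch rep lim σ tr) (hvc : VCBound e r d) (f : ℕ → ℕ) (g : ℕ)
    (htr : ∀ y, ∃ l ≤ g, ∃ q, tr y = groupTrace e r f l q) : T - root ≤ (g + 1) ^ (d + 1) := by
  refine (h.card_le (𝒮 := (Ico root T).image σ) fun x hx hx' =>
    mem_image_of_mem _ (mem_Ico.2 ⟨hx, hx'⟩)).trans (hvc.card_prefix_traces_le f g fun a ha => ?_)
  obtain ⟨x, hx, rfl⟩ := mem_image.1 ha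
  rw [mem_Ico] at hx
  obtain ⟨l, hl, q, hq⟩ := htr (rep x)
  rw [h.σ_eq_filter hx.1 hx.2, hq, groupTrace]
  split
  · refine .inr ⟨min l (lim x), (min_le_left _ _).trans hl, q, ‹_›, ?_⟩
    ext k
    simp only [mem_filter, mem_range, lt_min_iff]
    tauto
  · exact .inl (by simp)

/-- The traces after `j` of the hyperedges containing the vertex at position `k` are processed. -/
def partialTrace (e : ℕ → Finset ℕ) (r : ℕ) (f : ℕ → ℕ) (k j y : ℕ) : Finset ℕ :=
  if y ∈ (incidentEdges e r (f k)).take j then groupTrace e r f (k + 1) y else groupTrace e r f k y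

theorem partialTrace_zero (f : ℕ → ℕ) (k : ℕ) :
    partialTrace e r f k 0 = groupTrace e r f k := by
  ext1 y
  simp [partialTrace]

theorem groupTrace_succ (f : ℕ → ℕ) (k y : ℕ) : groupTrace e r f (k + 1) y =
    if y < r ∧ f k ∈ e y then insert k (groupTrace e r f k y) else groupTrace e r f k y := by
  unfold groupTrace
  by_cases hy : y < r
  · simp only [hy, if_true, true_and, range_add_one, filter_insert]
  · simp [hy]

theorem partialTrace_length (f : ℕ → ℕ) (k : ℕ) :
    partialTrace e r f k (incidentEdges e r (f k)).length = groupTrace e r f (k + 1) := by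
  ext1 y
  rw [partialTrace, List.take_length, groupTrace_succ]
  split_ifs with h₁ h₂ h₂
  · rfl
  · exact absurd (mem_incidentEdges.1 h₁) h₂
  · exact absurd (mem_incidentEdges.2 h₂) h₁
  · rfl

theorem partialTrace_getElem (f : ℕ → ℕ) (k j : ℕ) (hj : j < (incidentEdges e r (f k)).length) :
    partialTrace e r f k j (incidentEdges e r (f k))[j] =
      groupTrace e r f k (incidentEdges e r (f k))[j] := by
  rw [partialTrace, if_neg]
  intro h
  obtain ⟨i, hi, heq⟩ := List.mem_iff_getElem.1 h
  rw [List.length_take] at hi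
  rw [List.getElem_take] at heq
  have := (nodup_incidentEdges e r (f k)).getElem_inj_iff.1 heq
  omega

theorem partialTrace_succ (f : ℕ → ℕ) (k j : ℕ) (hj : j < (incidentEdges e r (f k)).length) :
    Function.update (partialTrace e r f k j) (incidentEdges e r (f k))[j]
      (insert k (partialTrace e r f k j (incidentEdges e r (f k))[j])) =
      partialTrace e r f k (j + 1) := by
  rw [partialTrace_getElem f k j hj]
  ext1 y
  have htake : y ∈ (incidentEdges e r (f k)).take (j + 1) ↔
      y ∈ (incidentEdges e r (f k)).take j ∨ y = (incidentEdges e r (f k))[j] := by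
    rw [List.take_add_one, List.mem_append, List.getElem?_eq_getElem hj, Option.toList_some,
      List.mem_singleton]
  by_cases hy : y = (incidentEdges e r (f k))[j]
  · rw [hy, Function.update_self, partialTrace, if_pos (by rw [← hy]; exact htake.2 (.inr hy)),
      groupTrace_succ, if_pos (mem_incidentEdges.1 (List.getElem_mem hj))]
  · rw [Function.update_of_ne hy, partialTrace, partialTrace]
    simp only [htake, hy, or_false]

theorem lt_of_mem_groupTrace {f : ℕ → ℕ} {k y i : ℕ}
    (hi : i ∈ groupTrace e r f k y) : i < k := by
  unfold groupTrace at hi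
  split at hi
  · exact mem_range.1 (mem_filter.1 hi).1
  · simp at hi

theorem exists_partialTrace_eq (f : ℕ → ℕ) (k j y : ℕ) :
    ∃ l ≤ k + 1, ∃ q, partialTrace e r f k j y = groupTrace e r f l q := by
  unfold partialTrace
  split
  exacts [⟨k + 1, le_rfl, y, rfl⟩, ⟨k, k.le_succ, y, rfl⟩]

/-- The positions are treated in increasing order, which is the order of keys the trie demands. Only
hyperedges incident to the vertex at hand are touched, so the cost is the sum of the degrees rather
than `g` times the number of hyperedges. -/
theorem runs_buildTrie (hvc : VCBound e r d) (hadj : HasAdj s e r) (hfresh : FreshTrie s)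
    (hg : s.reg rg ≤ s.reg rStride)
    (hB : s.reg rT + (s.reg rg + 1) ^ (d + 1) + 1 < 2 ^ B) :
    Runs B buildTrie s
      (∑ k ∈ range (s.reg rg), (16 * s.arr aDeg (s.arr aSample (s.reg rBase + k)) + 10) + 10)
      fun s' => s'.reg rRoot = s.reg rT ∧ s'.reg rT ≤ s.reg rT + (s.reg rg + 1) ^ (d + 1) ∧
        ∃ σ, IsTrie s' σ
          (groupTrace e r (fun k => s.arr aSample (s.reg rBase + k)) (s.reg rg)) := by
  set f : ℕ → ℕ := fun k => s.arr aSample (s.reg rBase + k) with hf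
  set g := s.reg rg with hgdef
  set τ := (g + 1) ^ (d + 1) with hτ
  refine Runs.of_bdd fun hb => ?_
  refine Runs.mono (T₁ := ∑ k ∈ range g, ((∑ j ∈ range (s.arr aDeg (f k)), (14 + 2) + 2) + 1 + 1 + 1
    + 2) + 2 + 1 + 1 + 1) ?_ ?_
  swap
  · have : ∑ k ∈ range g, ((∑ j ∈ range (s.arr aDeg (f k)), (14 + 2) + 2) + 1 + 1 + 1 + 2) ≤
        ∑ k ∈ range g, (16 * s.arr aDeg (f k) + 10) := sum_le_sum fun k _ => by
      simp only [sum_const, card_range, smul_eq_mul]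
      omega
    change _ ≤ ∑ k ∈ range g, (16 * s.arr aDeg (f k) + 10) + 10
    omega
  refine Runs.cons_assign (fun hb => hb.reg _) ?_
  refine Runs.cons_assign (fun hb => ?_) ?_
  · simp
    omega
  set s₀ := (s.setReg rRoot ((Expr.reg rT).eval s)).setReg rT
    ((Expr.reg rT + 1).eval (s.setReg rRoot ((Expr.reg rT).eval s))) with hs₀
  have hadj₀ : s₀.reg rr = r := by simpa [hs₀] using hadj.reg_r
  refine Runs.cons (T₂ := 1) (Q₁ := fun s' => ∃ σ, IsTrie s' σ (groupTrace e r f g))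
    (Runs.forLoop g (fun k s' => ∃ σ, IsTrie s' σ (groupTrace e r f k)) _ (hb.reg _)
    (fun s' hs' => ?_) ?_ (fun k hk s₁ hs₁ hi hI => ?_) fun s' hs' _ hI => hI)
    fun s' hs' _ hI => ?_
  · exact (hs'.reg rg rfl).trans (by simp [hs₀, hgdef])
  · refine ⟨fun _ => ∅, ?_⟩
    have : groupTrace e r f 0 = fun _ => ∅ := by
      ext1 y
      simp [groupTrace]
    rw [this]
    have := Trie.init hfresh.pos hfresh.cur hfresh.ch hfresh.lim (rep := s.arr aRep)
    simpa [IsTrie, hs₀] using this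
  · have hbase₁ : s₁.reg rBase = s.reg rBase := (hs₁.reg rBase rfl).trans (by simp [hs₀])
    have hsam₁ : s₁.arr aSample = s.arr aSample := (hs₁.arr aSample rfl).trans (by simp [hs₀])
    have hdeg₁ : s₁.arr aDeg = s.arr aDeg := (hs₁.arr aDeg rfl).trans (by simp [hs₀])
    have hadj₁ : s₁.arr aAdj = s.arr aAdj := (hs₁.arr aAdj rfl).trans (by simp [hs₀])
    have hr₁ : s₁.reg rr = r := (hs₁.reg rr rfl).trans hadj₀
    have hst₁ : s₁.reg rStride = s.reg rStride := (hs₁.reg rStride rfl).trans (by simp [hs₀])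
    have hroot₁ : s₁.reg rRoot = s.reg rT := (hs₁.reg rRoot rfl).trans (by simp [hs₀])
    refine Runs.cons_assign (fun hb => hb.arr _ _) ?_
    refine Runs.cons_assign (fun hb => hb.reg _) ?_
    set s₂ := (s₁.setReg rVertex ((Expr.get aSample (.reg rBase + .reg ri)).eval s₁)).setReg rKey
      ((Expr.reg ri).eval (s₁.setReg rVertex ((Expr.get aSample (.reg rBase + .reg ri)).eval s₁)))
      with hs₂
    have hv₂ : s₂.reg rVertex = f k := by simp [hs₂, hbase₁, hsam₁, hi, hf]
    have hk₂ : s₂.reg rKey = k := by simp [hs₂, hi]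
    obtain ⟨σ, hσ⟩ := hI
    refine Runs.cons (T₂ := 1)
      (Q₁ := fun s' => ∃ σ, IsTrie s' σ (groupTrace e r f (k + 1)))
      (Runs.forLoop (s.arr aDeg (f k)) (fun j s' => ∃ σ, IsTrie s' σ (partialTrace e r f k j)) _
      (hb.arr _ _) (fun s' hs' => ?_) ⟨σ, ?_⟩ (fun j hj s₃ hs₃ hj₃ hI₃ => ?_)
      fun s' hs' _ hI' => ?_) fun s' hs' _ hI' => ?_
    · rw [Expr.eval_get, Expr.eval_reg, hs'.reg rVertex rfl, hv₂, hs'.arr aDeg rfl]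
      simp [hs₂, hdeg₁]
    · rw [partialTrace_zero]
      simpa [IsTrie, hs₂] using hσ
    · obtain ⟨σ₃, hσ₃⟩ := hI₃
      have hr₃ : s₃.reg rr = r := (hs₃.reg rr rfl).trans (by simp [hs₂, hr₁])
      have hv₃ : s₃.reg rVertex = f k := (hs₃.reg rVertex rfl).trans hv₂
      have hk₃ : s₃.reg rKey = k := (hs₃.reg rKey rfl).trans hk₂
      have hadj₃ : s₃.arr aAdj = s.arr aAdj := (hs₃.arr aAdj rfl).trans (by simp [hs₂, hadj₁])
      have hst₃ : s₃.reg rStride = s.reg rStride :=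
        (hs₃.reg rStride rfl).trans (by simp [hs₂, hst₁])
      have hroot₃ : s₃.reg rRoot = s.reg rT := (hs₃.reg rRoot rfl).trans (by simp [hs₂, hroot₁])
      rw [hadj.deg] at hj
      -- The count is needed before each insertion, to know that the number of a new node fits into
      -- `B` bits.
      have hT₃ : s₃.reg rT ≤ s.reg rT + τ := by
        have := Trie.sub_le hσ₃ hvc f g fun y => by
          obtain ⟨l, hl, q, hq⟩ := exists_partialTrace_eq (e := e) (r := r) f k j y
          exact ⟨l, by omega, q, hq⟩
        rw [hroot₃] at this
        omega
      refine Runs.mono (T₁ := 12 + 1 + 1) ?_ (by norm_num)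
      refine Runs.cons_assign (fun hb => hb.arr _ _) ?_
      have hitem : (Expr.get aAdj (.reg rVertex * .reg rr + .reg rj)).eval s₃ =
          (incidentEdges e r (f k))[j] := by
        simp [hv₃, hr₃, hj₃, hadj₃, hadj.adj _ _ hj]
      rw [hitem]
      set s₄ := s₃.setReg rItem (incidentEdges e r (f k))[j] with hs₄
      have hσ₄ : IsTrie s₄ σ₃ (partialTrace e r f k j) := by simpa [IsTrie, hs₄] using hσ₃
      have hit₄ : s₄.reg rItem = (incidentEdges e r (f k))[j] := by simp [hs₄]
      have hk₄ : s₄.reg rKey = k := by simp [hs₄, hk₃]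
      refine Runs.cons (T₂ := 1) (runs_insertKey hσ₄ ?_ ?_ ?_) fun s₅ _ _ hs₅ => Runs.nil ?_
      · simp [hs₄, hk₃, hst₃]
        omega
      · rw [hit₄, hk₄, partialTrace_getElem f k j hj]
        exact fun i hi => lt_of_mem_groupTrace hi
      · simp [hs₄]
        omega
      · obtain ⟨-, -, σ₅, hσ₅⟩ := hs₅
        rw [hit₄, hk₄, partialTrace_succ f k j hj] at hσ₅
        exact ⟨σ₅, by simpa [IsTrie] using hσ₅⟩
    · obtain ⟨σ', hσ'⟩ := hI'
      rw [hadj.deg, partialTrace_length] at hσ'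
      exact ⟨σ', hσ'⟩
    · obtain ⟨σ', hσ'⟩ := hI'
      exact Runs.nil ⟨σ', by simpa [IsTrie] using hσ'⟩
  · obtain ⟨σ, hσ⟩ := hI
    have hroot : s'.reg rRoot = s.reg rT := (hs'.reg rRoot rfl).trans (by simp [hs₀])
    refine Runs.nil ⟨hroot, ?_, σ, hσ⟩
    have := Trie.sub_le hσ hvc f g fun y => ⟨g, le_rfl, y, rfl⟩
    rw [hroot] at this
    omega

notation "rCount" => (19 : ℕ)
notation "rPairs" => (20 : ℕ)
notation "ru" => (21 : ℕ)
notation "rw'" => (22 : ℕ)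
notation "rKeep" => (23 : ℕ)
notation "rDrop" => (24 : ℕ)
notation "ra" => (25 : ℕ)
notation "rb" => (26 : ℕ)
notation "rSumKeep" => (27 : ℕ)
notation "rSumDrop" => (28 : ℕ)
notation "rBlock" => (29 : ℕ)

notation "aWeight" => (11 : ℕ)
notation "aNext" => (12 : ℕ)

/-! ### Halving a group -/

/-- Whether the position `k` of the group belongs to the set of the node `x`. -/
def memExpr (x k : Expr) : Expr :=
  .get aInc (.get aRep x * .reg rN + .get aSample (.reg rBase + k)) * (1 - (1 - (.get aLim x - k)))

/-- Whether the position `k` of the group separates the sets of the nodes `ru` and `rw'`. -/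
def diffExpr (k : Expr) : Expr :=
  (memExpr (.reg ru) k - memExpr (.reg rw') k) + (memExpr (.reg rw') k - memExpr (.reg ru) k)

/-- Decode the pair of nodes number `rj`. -/
def loadPair : Program := block [
  .assign ru (.reg rRoot + .reg rj / .reg rCount),
  .assign rw' (.reg rRoot + (.reg rj - .reg rj / .reg rCount * .reg rCount)),
  .assign ra (diffExpr (.reg rKeep)),
  .assign rb (diffExpr (.reg rDrop))]

/-- The total weights of the sets containing `rKeep` and `rDrop`. -/
def sumWeights : Program :=
  forLoop rj (.reg rPairs) (block [
    loadPair,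
    .assign rSumKeep (.reg rSumKeep + .get aWeight (.reg rj) * .reg ra),
    .assign rSumDrop (.reg rSumDrop + .get aWeight (.reg rj) * .reg rb)])

/-- Reweight all sets. -/
def updateWeights : Program :=
  forLoop rj (.reg rPairs) (block [
    loadPair,
    .store aWeight (.reg rj)
      ((.get aWeight (.reg rj) * (.reg rK + .reg rb - .reg ra) + .reg rK - 1) / .reg rK)])

/-- Select one position of each of the pairs `2 i, 2 i + 1` of the group. -/
def halveGroup : Program := block [
  .assign rCount (.reg rT - .reg rRoot),
  .assign rPairs (.reg rCount * .reg rCount),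
  forLoop rj (.reg rPairs) (.store aWeight (.reg rj) 1),
  forLoop ri (.reg rh) (block [
    .assign rKeep (.reg ri + .reg ri),
    .assign rDrop (.reg rKeep + 1),
    .assign rSumKeep 0,
    .assign rSumDrop 0,
    sumWeights,
    .ite (.reg rSumDrop - .reg rSumKeep)
      (block [.assign rKeep (.reg rKeep + 1), .assign rDrop (.reg rDrop - 1)]) .skip,
    updateWeights,
    .store aNext (.reg rBlock * .reg rh + .reg ri) (.get aSample (.reg rBase + .reg rKeep))])]

/-! ### Separation of positions by pairs of trie nodes -/

variable {B : ℕ} {s s' : State} {e : ℕ → Finset ℕ} {r d : ℕ}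

/-- The value of `memExpr` is the indicator function of the sets of the nodes. -/
def HasMem (s : State) (σ : ℕ → Finset ℕ) (g : ℕ) : Prop :=
  ∀ x, s.reg rRoot ≤ x → x < s.reg rT → ∀ k < g,
    s.arr aInc (s.arr aRep x * s.reg rN + s.arr aSample (s.reg rBase + k)) *
      (1 - (1 - (s.arr aLim x - k))) = if k ∈ σ x then 1 else 0

/-- The memory holds the incidence matrix. -/
def HasInc (s : State) (e : ℕ → Finset ℕ) (r : ℕ) : Prop :=
  ∀ q < r, ∀ v < s.reg rN, s.arr aInc (q * s.reg rN + v) = if v ∈ e q then 1 else 0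

/-- With truncated subtraction, `1 - (1 - (lim x - k))` is the indicator of `k < lim x`. It cuts the
row of the representative in the incidence matrix down to the set of the node. -/
theorem IsTrie.hasMem {σ : ℕ → Finset ℕ} {g : ℕ}
    (h : IsTrie s σ (groupTrace e r (fun k => s.arr aSample (s.reg rBase + k)) g))
    (hinc : HasInc s e r) (hsample : ∀ i, s.arr aSample i < s.reg rN) : HasMem s σ g := by
  intro x hx hx' k hk
  rw [Trie.σ_eq_filter h hx hx']
  by_cases hlim : k < s.arr aLim x
  · have hroot : s.reg rRoot < x := by
      refine lt_of_le_of_ne hx fun hxr => ?_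
      have := h.lim_root
      rw [hxr] at this
      omega
    obtain ⟨h₁, h₂, -⟩ := h.rep_lim x hroot hx'
    -- Items from `r` on have an empty trace, whereas the trace of the representative contains `lim
    -- x - 1`.
    have hrep : s.arr aRep x < r := by
      by_contra hr
      simp [groupTrace, hr] at h₂
    rw [hinc _ hrep _ (hsample _), groupTrace, if_pos hrep,
      Nat.sub_eq_zero_of_le (show 1 ≤ s.arr aLim x - k by omega)]
    simp [hk, hlim]
  · rw [Nat.sub_eq_zero_of_le (not_lt.1 hlim)]
    simp [hlim]

theorem HasMem.of_eq {σ : ℕ → Finset ℕ} {g : ℕ} (h : HasMem s σ g)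
    (h₁ : s'.reg rRoot = s.reg rRoot) (h₂ : s'.reg rT = s.reg rT) (h₃ : s'.reg rN = s.reg rN)
    (h₄ : s'.reg rBase = s.reg rBase) (h₅ : s'.arr aInc = s.arr aInc)
    (h₆ : s'.arr aRep = s.arr aRep) (h₇ : s'.arr aSample = s.arr aSample)
    (h₈ : s'.arr aLim = s.arr aLim) : HasMem s' σ g := by
  unfold HasMem
  rw [h₁, h₂, h₃, h₄, h₅, h₆, h₇, h₈]
  exact h

/-- The pair number `z` of a trie with `c` nodes separates the position `k`. -/
def pairInd (σ : ℕ → Finset ℕ) (root c z k : ℕ) : ℕ :=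
  if k ∈ symmDiff (σ (root + z / c)) (σ (root + z % c)) then 1 else 0

theorem pairInd_le (σ : ℕ → Finset ℕ) (root c z k : ℕ) : pairInd σ root c z k ≤ 1 := by
  unfold pairInd
  split <;> omega

/-- What the loops over all pairs of nodes rely on. -/
structure PairEnv (s : State) (σ : ℕ → Finset ℕ) (root c g : ℕ) : Prop where
  mem : HasMem s σ g
  reg_root : s.reg rRoot = root
  count : s.reg rCount = c
  top : s.reg rT = root + c
  pairs : s.reg rPairs = c * c
  keep : s.reg rKeep < g
  drop : s.reg rDrop < g

variable {σ : ℕ → Finset ℕ} {root c g : ℕ}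

theorem PairEnv.of_eq (h : PairEnv s σ root c g)
    (h₁ : s'.reg rRoot = s.reg rRoot) (h₂ : s'.reg rT = s.reg rT) (h₃ : s'.reg rN = s.reg rN)
    (h₄ : s'.reg rBase = s.reg rBase) (h₅ : s'.arr aInc = s.arr aInc)
    (h₆ : s'.arr aRep = s.arr aRep) (h₇ : s'.arr aSample = s.arr aSample)
    (h₈ : s'.arr aLim = s.arr aLim) (h₉ : s'.reg rCount = s.reg rCount)
    (h₁₀ : s'.reg rPairs = s.reg rPairs) (h₁₁ : s'.reg rKeep = s.reg rKeep)
    (h₁₂ : s'.reg rDrop = s.reg rDrop) : PairEnv s' σ root c g :=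
  ⟨h.mem.of_eq h₁ h₂ h₃ h₄ h₅ h₆ h₇ h₈, h₁.trans h.reg_root, h₉.trans h.count, h₂.trans h.top,
    h₁₀.trans h.pairs, h₁₁ ▸ h.keep, h₁₂ ▸ h.drop⟩

/-- For `0`-`1` values, the sum of the two truncated differences is the exclusive or. -/
theorem eval_diffExpr (h : HasMem s σ g) {k : Expr} {u w : ℕ} (hu : s.reg ru = u)
    (hw : s.reg rw' = w) (hu₁ : s.reg rRoot ≤ u) (hu₂ : u < s.reg rT) (hw₁ : s.reg rRoot ≤ w)
    (hw₂ : w < s.reg rT) (hk : k.eval s < g) :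
    (diffExpr k).eval s = if k.eval s ∈ symmDiff (σ u) (σ w) then 1 else 0 := by
  have h₁ := h u hu₁ hu₂ _ hk
  have h₂ := h w hw₁ hw₂ _ hk
  simp only [diffExpr, memExpr, Expr.eval_add, Expr.eval_sub, Expr.eval_mul, Expr.eval_get,
    Expr.eval_reg, Expr.eval_one, hu, hw, h₁, h₂, mem_symmDiff]
  by_cases h₃ : k.eval s ∈ σ u <;> by_cases h₄ : k.eval s ∈ σ w <;> simp [h₃, h₄]

theorem runs_loadPair (h : PairEnv s σ root c g) (hz : s.reg rj < c * c) :
    Runs B loadPair s 5 fun s' => s'.reg ra = pairInd σ root c (s.reg rj) (s.reg rKeep) ∧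
      s'.reg rb = pairInd σ root c (s.reg rj) (s.reg rDrop) := by
  have hc : 0 < c := Nat.pos_of_ne_zero fun h => by simp [h] at hz
  have hdiv : s.reg rj / c < c := (Nat.div_lt_iff_lt_mul hc).2 hz
  have hmod : s.reg rj % c < c := Nat.mod_lt _ hc
  have hmod' : s.reg rj - s.reg rj / c * c = s.reg rj % c := by
    rw [Nat.mul_comm, Nat.mod_eq_sub_mul_div]
  refine Runs.of_bdd fun hb => ?_
  have hTb := hb.reg rT
  rw [h.top] at hTb
  have h2 : 2 ≤ 2 ^ B := le_trans (by norm_num) (Nat.pow_le_pow_right two_pos hb.pos)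
  refine Runs.cons_assign (T := 4) (fun _ => ?_) ?_
  · simp [h.reg_root, h.count]; omega
  refine Runs.cons_assign (T := 3) (fun _ => ?_) ?_
  · simp [h.reg_root, h.count, hmod']; omega
  set s₁ := (s.setReg ru ((Expr.reg rRoot + .reg rj / .reg rCount).eval s)) with hs₁
  set s₂ := s₁.setReg rw' ((Expr.reg rRoot + (.reg rj - .reg rj / .reg rCount * .reg rCount)).eval
    s₁) with hs₂
  have hm₂ : HasMem s₂ σ g := by
    refine h.mem.of_eq ?_ ?_ ?_ ?_ rfl rfl rfl rfl <;> simp [hs₂, hs₁]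
  have hu₂ : s₂.reg ru = root + s.reg rj / c := by simp [hs₂, hs₁, h.reg_root, h.count]
  have hw₂ : s₂.reg rw' = root + s.reg rj % c := by simp [hs₂, hs₁, h.reg_root, h.count, hmod']
  have hT₂ : s₂.reg rT = root + c := by simp [hs₂, hs₁, h.top]
  have hr₂ : s₂.reg rRoot = root := by simp [hs₂, hs₁, h.reg_root]
  have hk₂ : s₂.reg rKeep = s.reg rKeep := by simp [hs₂, hs₁]
  have hd₂ : s₂.reg rDrop = s.reg rDrop := by simp [hs₂, hs₁]
  have hKeep : (diffExpr (.reg rKeep)).eval s₂ =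
      pairInd σ root c (s.reg rj) (s.reg rKeep) := by
    rw [eval_diffExpr hm₂ hu₂ hw₂ (by rw [hr₂]; exact Nat.le_add_right _ _)
      (by rw [hT₂]; exact Nat.add_lt_add_left hdiv _) (by rw [hr₂]; exact Nat.le_add_right _ _)
      (by rw [hT₂]; exact Nat.add_lt_add_left hmod _)
      (by rw [Expr.eval_reg, hk₂]; exact h.keep), Expr.eval_reg, hk₂]
    rfl
  have hm₃ : HasMem (s₂.setReg ra ((diffExpr (.reg rKeep)).eval s₂)) σ g := by
    refine hm₂.of_eq ?_ ?_ ?_ ?_ rfl rfl rfl rfl <;> simp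
  have hDrop : (diffExpr (.reg rDrop)).eval (s₂.setReg ra ((diffExpr (.reg rKeep)).eval s₂)) =
      pairInd σ root c (s.reg rj) (s.reg rDrop) := by
    rw [eval_diffExpr hm₃ (u := root + s.reg rj / c) (w := root + s.reg rj % c) (by simpa using hu₂)
      (by simpa using hw₂) (by simp [hr₂]) (by simpa [hT₂] using hdiv) (by simp [hr₂])
      (by simpa [hT₂] using hmod) (by simp [hd₂]; exact h.drop), Expr.eval_reg]
    simp [hd₂, pairInd]
  have h₃ := pairInd_le σ root c (s.reg rj) (s.reg rKeep)
  have h₄ := pairInd_le σ root c (s.reg rj) (s.reg rDrop)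
  refine Runs.cons_assign (T := 2) (fun _ => by rw [hKeep]; omega) ?_
  refine Runs.cons_assign (T := 1) (fun _ => by rw [hDrop]; omega) (Runs.nil ?_)
  exact ⟨by simp [hKeep], by simp [hDrop]⟩

theorem runs_sumWeights (h : PairEnv s σ root c g) {S : ℕ}
    (hS : ∑ z ∈ range (c * c), s.arr aWeight z ≤ S) (hSB : S < 2 ^ B)
    (hk : s.reg rSumKeep = 0) (hd : s.reg rSumDrop = 0) :
    Runs B sumWeights s (∑ _z ∈ range (c * c), 10 + 2) fun s' =>
      s'.reg rSumKeep =
        ∑ z ∈ range (c * c), s.arr aWeight z * pairInd σ root c z (s.reg rKeep) ∧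
      s'.reg rSumDrop =
        ∑ z ∈ range (c * c), s.arr aWeight z * pairInd σ root c z (s.reg rDrop) := by
  have hle : ∀ (k j : ℕ), j ≤ c * c →
      ∑ z ∈ range j, s.arr aWeight z * pairInd σ root c z k < 2 ^ B := by
    intro k j hj
    refine lt_of_le_of_lt (le_trans ?_ hS) hSB
    refine (sum_le_sum fun z _ => (Nat.mul_le_mul_left _
      (pairInd_le σ root c z k)).trans (mul_one _).le).trans
      (sum_le_sum_of_subset (by simpa using hj))
  refine Runs.of_bdd fun hb => ?_
  refine Runs.forLoop (c * c) (fun j s' => s'.reg rSumKeep =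
      ∑ z ∈ range j, s.arr aWeight z * pairInd σ root c z (s.reg rKeep) ∧
      s'.reg rSumDrop =
        ∑ z ∈ range j, s.arr aWeight z * pairInd σ root c z (s.reg rDrop)) (fun _ => 8)
    (h.pairs ▸ hb.reg _) (fun s' hs' => ?_) (by simp [hk, hd]) (fun j hj s₁ hs₁ hi hI => ?_)
    fun s' _ _ hI => hI
  · exact (hs'.reg rPairs rfl).trans h.pairs
  · have henv₁ : PairEnv s₁ σ root c g := by
      refine h.of_eq ?_ ?_ ?_ ?_ ?_ ?_ ?_ ?_ ?_ ?_ ?_ ?_ <;>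
        first | exact hs₁.reg _ rfl | exact hs₁.arr _ rfl
    have hk₁ : s₁.reg rKeep = s.reg rKeep := hs₁.reg _ rfl
    have hd₁ : s₁.reg rDrop = s.reg rDrop := hs₁.reg _ rfl
    have hW₁ : s₁.arr aWeight = s.arr aWeight := hs₁.arr _ rfl
    refine Runs.cons (T₁ := 5) (T₂ := 3) (runs_loadPair henv₁ (by omega)) fun s₂ hs₂ _ hI₂ => ?_
    rw [hi, hk₁, hd₁] at hI₂
    have hW₂ : s₂.arr aWeight = s.arr aWeight := (hs₂.arr _ rfl).trans hW₁
    have hj₂ : s₂.reg rj = j := (hs₂.reg _ rfl).trans hi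
    have hP₂ : s₂.reg rSumKeep = s₁.reg rSumKeep := hs₂.reg _ rfl
    have hQ₂ : s₂.reg rSumDrop = s₁.reg rSumDrop := hs₂.reg _ rfl
    have hP : (Expr.reg rSumKeep + .get aWeight (.reg rj) * .reg ra).eval s₂ =
        ∑ z ∈ range (j + 1), s.arr aWeight z * pairInd σ root c z (s.reg rKeep) := by
      simp [hP₂, hI.1, hW₂, hj₂, hI₂.1, sum_range_succ]
    refine Runs.cons_assign (T := 2) (fun _ => ?_) ?_
    · rw [hP]
      exact hle _ _ hj
    have hQ : (Expr.reg rSumDrop + .get aWeight (.reg rj) * .reg rb).eval (s₂.setReg rSumKeep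
        ((Expr.reg rSumKeep + .get aWeight (.reg rj) * .reg ra).eval s₂)) =
        ∑ z ∈ range (j + 1), s.arr aWeight z * pairInd σ root c z (s.reg rDrop) := by
      simp [hQ₂, hI.2, hW₂, hj₂, hI₂.2, sum_range_succ]
    refine Runs.cons_assign (T := 1) (fun _ => ?_) (Runs.nil ?_)
    · rw [hQ]
      exact hle _ _ hj
    · rw [hQ, hP]
      simp

theorem runs_updateWeights (h : PairEnv s σ root c g) {S : ℕ}
    (hS : ∑ z ∈ range (c * c), reweight (s.reg rK) (s.arr aWeight z)
      (pairInd σ root c z (s.reg rKeep)) (pairInd σ root c z (s.reg rDrop)) ≤ S) (hSB : S < 2 ^ B) :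
    Runs B updateWeights s (∑ _z ∈ range (c * c), 9 + 2) fun s' =>
      ∀ z < c * c, s'.arr aWeight z = reweight (s.reg rK) (s.arr aWeight z)
        (pairInd σ root c z (s.reg rKeep)) (pairInd σ root c z (s.reg rDrop)) := by
  set W' : ℕ → ℕ := fun z => reweight (s.reg rK) (s.arr aWeight z)
        (pairInd σ root c z (s.reg rKeep)) (pairInd σ root c z (s.reg rDrop)) with hW'
  refine Runs.of_bdd fun hb => ?_
  refine Runs.forLoop (c * c) (fun j s' => (∀ z < j, s'.arr aWeight z = W' z) ∧
      ∀ z, j ≤ z → s'.arr aWeight z = s.arr aWeight z) (fun _ => 7)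
    (h.pairs ▸ hb.reg _) (fun s' hs' => ?_) (by simp) (fun j hj s₁ hs₁ hi hI => ?_)
    fun s' _ _ hI => hI.1
  · exact (hs'.reg rPairs rfl).trans h.pairs
  · have henv₁ : PairEnv s₁ σ root c g := by
      refine h.of_eq ?_ ?_ ?_ ?_ ?_ ?_ ?_ ?_ ?_ ?_ ?_ ?_ <;>
        first | exact hs₁.reg _ rfl | exact hs₁.arr _ rfl
    have hk₁ : s₁.reg rKeep = s.reg rKeep := hs₁.reg _ rfl
    have hd₁ : s₁.reg rDrop = s.reg rDrop := hs₁.reg _ rfl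
    refine Runs.cons (T₁ := 5) (T₂ := 2) (runs_loadPair henv₁ (by omega)) fun s₂ hs₂ _ hI₂ => ?_
    rw [hi, hk₁, hd₁] at hI₂
    have hW₂ : s₂.arr aWeight = s₁.arr aWeight := hs₂.arr _ rfl
    have hj₂ : s₂.reg rj = j := (hs₂.reg _ rfl).trans hi
    have hK₂ : s₂.reg rK = s.reg rK := (hs₂.reg _ rfl).trans (hs₁.reg _ rfl)
    have hval : ((Expr.get aWeight (.reg rj) * (.reg rK + .reg rb - .reg ra) + .reg rK - 1) /
        .reg rK).eval s₂ = W' j := by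
      simp [hW₂, hj₂, hK₂, hI.2 j le_rfl, hI₂.1, hI₂.2, hW', reweight]
    refine Runs.cons_store (T := 1) (fun _ => ?_) (Runs.nil ?_)
    · rw [hval]
      refine lt_of_le_of_lt (le_trans ?_ hS) hSB
      exact single_le_sum (f := W') (fun _ _ => Nat.zero_le _) (mem_range.2 hj)
    · rw [hval, Expr.eval_reg, hj₂]
      refine ⟨fun z hz => ?_, fun z hz => ?_⟩
      · rcases eq_or_ne z j with rfl | hzj
        · simp
        · simpa [hzj, hW₂] using hI.1 z (by omega)
      · have : z ≠ j := by omega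
        simpa [this, hW₂] using hI.2 z (by omega)

/-- `keep i` and `drop i` are the positions `2 i` and `2 i + 1` in some order. -/
def IsSplit (keep drop : ℕ → ℕ) : Prop :=
  ∀ i, keep i = 2 * i ∧ drop i = 2 * i + 1 ∨ keep i = 2 * i + 1 ∧ drop i = 2 * i

/-- The invariant of the selection. -/
structure HalveInv (s₀ s : State) (σ : ℕ → Finset ℕ) (root c i : ℕ) (keep drop : ℕ → ℕ) :
    Prop where
  split : IsSplit keep drop
  next : ∀ i' < i, s.arr aNext (s₀.reg rBlock * s₀.reg rh + i') =
    s₀.arr aSample (s₀.reg rBase + keep i')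
  next_of_lt : ∀ j < s₀.reg rBlock * s₀.reg rh, s.arr aNext j = s₀.arr aNext j
  sum_le : ∑ z ∈ range (c * c), s.arr aWeight z ≤ c * c * (1 + i)
  prod_le : ∀ z < c * c, ∏ i' ∈ range i, (1 + ((pairInd σ root c z (drop i') : ℝ) -
    pairInd σ root c z (keep i')) / s₀.reg rK) ≤ s.arr aWeight z

/-- Quotient and remainder modulo `c` decode a pair of nodes, so the single loop over `c * c`
numbers compares every two nodes. -/
theorem pair_cover {σ : ℕ → Finset ℕ} {root c x y : ℕ} (hx : root ≤ x) (hx' : x < root + c)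
    (hy : root ≤ y) (hy' : y < root + c) (k : ℕ) :
    (x - root) * c + (y - root) < c * c ∧
    pairInd σ root c ((x - root) * c + (y - root)) k =
      if k ∈ symmDiff (σ x) (σ y) then 1 else 0 := by
  have h₁ : x - root + 1 ≤ c := by omega
  have h₂ : y - root < c := by omega
  have h₃ := Nat.mul_le_mul_right c h₁
  refine ⟨by rw [Nat.add_mul] at h₃; omega, ?_⟩
  rw [pairInd, Nat.mul_comm, Nat.mul_add_div (by omega), Nat.mul_add_mod, Nat.div_eq_of_lt h₂,
    Nat.mod_eq_of_lt h₂, add_zero, Nat.add_sub_cancel' hx, Nat.add_sub_cancel' hy]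

/-- Every pair of nodes starts with weight `1`, and the position of larger weight is kept. So the
total weight grows by at most `c * c` per round, while each single weight dominates the product of
its factors. A weight that fits into `B` bits after `K²` rounds gives the claim by
`sum_le_of_prod_le`. -/
theorem runs_halveGroup {tr : ℕ → Finset ℕ} (htrie : IsTrie s σ tr)
    (hmem : HasMem s σ (s.reg rg)) (hg : s.reg rg = 2 * s.reg rh)
    (hh : s.reg rh = s.reg rK * s.reg rK) (hK : 0 < s.reg rK)
    (hc : s.reg rT = s.reg rRoot + c) (hB : c * c * (1 + s.reg rh) < 2 ^ B) :
    Runs B halveGroup s (40 * (s.reg rh + 1) * (c * c + 1)) fun s' =>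
      (∀ j < s.reg rBlock * s.reg rh, s'.arr aNext j = s.arr aNext j) ∧
      ∃ keep drop, IsSplit keep drop ∧
        (∀ i < s.reg rh, s'.arr aNext (s.reg rBlock * s.reg rh + i) =
          s.arr aSample (s.reg rBase + keep i)) ∧
        ∀ y y', ∑ i ∈ range (s.reg rh), (if drop i ∈ symmDiff (tr y) (tr y') then 1 else 0) ≤
          ∑ i ∈ range (s.reg rh), (if keep i ∈ symmDiff (tr y) (tr y') then 1 else 0) +
            s.reg rK * (B + 2) := by
  have hccB : c * c < 2 ^ B := lt_of_le_of_lt (Nat.le_mul_of_pos_right _ (by omega)) hB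
  refine Runs.of_bdd fun hb => ?_
  have h2 : 2 ≤ 2 ^ B := le_trans (by norm_num) (Nat.pow_le_pow_right two_pos hb.pos)
  refine Runs.mono (T₁ := (∑ _z ∈ range (c * c), (1 + 2) + 2 + (∑ _i ∈ range (s.reg rh),
    ((∑ _z ∈ range (c * c), 10 + 2) + (4 + ((∑ _z ∈ range (c * c), 9 + 2) + 2)) + 1 + 1 + 1 + 1 +
    2) + 2 + 1)) + 1 + 1)
    ?_ ?_
  swap
  · simp only [sum_const, card_range, smul_eq_mul]
    nlinarith [Nat.zero_le (s.reg rh * (c * c)), Nat.zero_le (s.reg rh), Nat.zero_le (c * c)]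
  refine Runs.cons_assign (fun _ => ?_) (Runs.cons_assign (fun _ => ?_) ?_)
  · exact lt_of_le_of_lt (Nat.sub_le _ _) (hb.reg rT)
  · simpa [hc] using hccB
  set s₁ := (s.setReg rCount ((Expr.reg rT - .reg rRoot).eval s)).setReg rPairs
    ((Expr.reg rCount * .reg rCount).eval (s.setReg rCount ((Expr.reg rT - .reg rRoot).eval s)))
    with hs₁
  have hcount₁ : s₁.reg rCount = c := by simp [hs₁, hc]
  have hpairs₁ : s₁.reg rPairs = c * c := by simp [hs₁, hc]
  refine Runs.cons (Q₁ := fun s' => ∀ z < c * c, s'.arr aWeight z = 1)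
    (Runs.forLoop (c * c) (fun j s' => ∀ z < j, s'.arr aWeight z = 1) (fun _ => 1) hccB
    (fun s' hs' => (hs'.reg _ rfl).trans hpairs₁) (by simp) (fun j hj s' hs' hi hI =>
      Runs.store (fun _ => show 1 < 2 ^ B by omega) fun z hz => ?_) fun s' _ _ hI => hI)
    fun s₂ hs₂ _ hW₂ => ?_
  · rw [State.arr_setReg, State.arr_setArr, if_pos rfl, Expr.eval_reg, hi, Expr.eval_one]
    rcases eq_or_ne z j with rfl | hzj
    · simp
    · simpa [hzj] using hI z (by omega)
  have hr₂ : ∀ x, x ≠ rCount → x ≠ rPairs → x ≠ rj → s₂.reg x = s.reg x := by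
    intro x h₁ h₂ h₃
    rw [hs₂.reg x (by simp [forLoop, Program.writesReg, h₃])]
    simp [hs₁, h₁, h₂]
  have ha₂ : ∀ a, a ≠ aWeight → s₂.arr a = s.arr a := by
    intro a h₁
    rw [hs₂.arr a (by simp [forLoop, Program.writesArr, h₁])]
    simp [hs₁]
  refine Runs.cons (T₂ := 1) (Q₁ := fun s' =>
      ∃ keep drop, HalveInv s s' σ (s.reg rRoot) c (s.reg rh) keep drop)
    (Runs.forLoop (s.reg rh) (fun i s' => ∃ keep drop, HalveInv s s' σ (s.reg rRoot) c i keep drop)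
    (fun _ => (∑ _z ∈ range (c * c), 10 + 2) +
      (4 + ((∑ _z ∈ range (c * c), 9 + 2) + 2)) + 1 + 1 + 1 + 1)
    (hb.reg _) (fun s' hs' => (hs'.reg rh rfl).trans (hr₂ _ (by decide) (by decide) (by decide)))
    ?_ (fun i hi s₃ hs₃ hi₃ hI => ?_) fun s' _ _ hI => hI) fun s₃ hs₃ hb₃ hI => Runs.nil ?_
  -- Any split serves for the rounds still to come; round `i` overwrites the values at `i`.
  · refine ⟨fun i => 2 * i, fun i => 2 * i + 1, fun i => .inl ⟨rfl, rfl⟩, by simp,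
      fun j _ => by simp [ha₂ aNext], ?_, fun z hz => ?_⟩
    · rw [State.arr_setReg, sum_congr rfl fun z hz => hW₂ z (mem_range.1 hz)]
      simp
    · simp [hW₂ z hz]
  · obtain ⟨keep, drop, hI⟩ := hI
    have hrg₃ : ∀ x, (x = rRoot ∨ x = rT ∨ x = rN ∨ x = rBase ∨ x = rBlock ∨ x = rh ∨ x = rK) →
        s₃.reg x = s.reg x := by
      rintro x (rfl | rfl | rfl | rfl | rfl | rfl | rfl) <;>
        exact (hs₃.reg _ rfl).trans (hr₂ _ (by decide) (by decide) (by decide))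
    have har₃ : ∀ a, (a = aInc ∨ a = aRep ∨ a = aSample ∨ a = aLim) → s₃.arr a = s.arr a := by
      rintro a (rfl | rfl | rfl | rfl) <;> exact (hs₃.arr _ rfl).trans (ha₂ _ (by decide))
    have hcount₃ : s₃.reg rCount = c := (hs₃.reg _ rfl).trans ((hs₂.reg _ rfl).trans hcount₁)
    have hpairs₃ : s₃.reg rPairs = c * c := (hs₃.reg _ rfl).trans ((hs₂.reg _ rfl).trans hpairs₁)
    have hgB := hb.reg rg
    refine Runs.cons_assign (fun _ => by simp [hi₃]; omega) ?_
    refine Runs.cons_assign (fun _ => by simp [hi₃]; omega) ?_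
    refine Runs.cons_assign (fun _ => by simp) ?_
    refine Runs.cons_assign (fun _ => by simp) ?_
    simp only [Expr.eval_add, Expr.eval_reg, Expr.eval_one, Expr.eval_zero, State.reg_setReg, hi₃,
      if_true]
    set s₄ := (((s₃.setReg rKeep (i + i)).setReg rDrop (i + i + 1)).setReg rSumKeep 0).setReg
      rSumDrop 0 with hs₄
    have henv₄ : PairEnv s₄ σ (s.reg rRoot) c (s.reg rg) := by
      refine ⟨hmem.of_eq ?_ ?_ ?_ ?_ ?_ ?_ ?_ ?_, ?_, ?_, ?_, ?_, ?_, ?_⟩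
      any_goals simp [hs₄, hrg₃, har₃, hcount₃, hpairs₃, hc]
      all_goals omega
    have hsum₄ : ∑ z ∈ range (c * c), s₄.arr aWeight z ≤ c * c * (1 + i) := hI.sum_le
    have hSB : c * c * (1 + i) < 2 ^ B :=
      lt_of_le_of_lt (Nat.mul_le_mul_left _ (by omega)) hB
    refine Runs.cons (runs_sumWeights henv₄ hsum₄ hSB (by simp [hs₄]) (by simp [hs₄]))
      fun s₅ hs₅ _ hI₅ => ?_
    have hkeep₄ : s₄.reg rKeep = 2 * i := by simp [hs₄]; omega
    have hdrop₄ : s₄.reg rDrop = 2 * i + 1 := by simp [hs₄]; omega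
    have hW₅ : s₅.arr aWeight = s₃.arr aWeight := hs₅.arr _ rfl
    rw [hkeep₄, hdrop₄] at hI₅
    have henv₅ : PairEnv s₅ σ (s.reg rRoot) c (s.reg rg) := by
      refine henv₄.of_eq ?_ ?_ ?_ ?_ ?_ ?_ ?_ ?_ ?_ ?_ ?_ ?_ <;>
        first | exact hs₅.reg _ rfl | exact hs₅.arr _ rfl
    have hkeep₅ : s₅.reg rKeep = 2 * i := (hs₅.reg _ rfl).trans hkeep₄
    have hdrop₅ : s₅.reg rDrop = 2 * i + 1 := (hs₅.reg _ rfl).trans hdrop₄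
    -- Both branches are summarized by one fact: the kept position has at least the weight of the
    -- dropped one.
    refine Runs.cons (T₁ := 4) (Q₁ := fun s' => ∃ k l, s'.reg rKeep = k ∧ s'.reg rDrop = l ∧
      (k = 2 * i ∧ l = 2 * i + 1 ∨ k = 2 * i + 1 ∧ l = 2 * i) ∧
      ∑ z ∈ range (c * c), s₃.arr aWeight z * pairInd σ (s.reg rRoot) c z l ≤
        ∑ z ∈ range (c * c), s₃.arr aWeight z * pairInd σ (s.reg rRoot) c z k)
      (Runs.ite (T := 3) (fun hlt => ?_) (fun hle => ?_)) fun s₆ hs₆ _ hI₆ => ?_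
    · simp only [Expr.eval_sub, Expr.eval_reg, ne_eq] at hlt
      refine Runs.cons_assign (T := 2) (fun _ => by simp [hkeep₅]; omega) ?_
      refine Runs.cons_assign (T := 1) (fun _ => by simp [hdrop₅]; omega) (Runs.nil ?_)
      refine ⟨2 * i + 1, 2 * i, by simp [hkeep₅], by simp [hdrop₅], .inr ⟨rfl, rfl⟩, ?_⟩
      rw [hI₅.1, hI₅.2] at hlt
      exact le_of_lt (by simpa [hs₄] using Nat.lt_of_sub_ne_zero hlt)
    · simp only [Expr.eval_sub, Expr.eval_reg] at hle
      refine (Runs.skip ⟨2 * i, 2 * i + 1, hkeep₅, hdrop₅, .inl ⟨rfl, rfl⟩, ?_⟩).mono (by norm_num)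
      rw [hI₅.1, hI₅.2] at hle
      simpa [hs₄] using Nat.le_of_sub_eq_zero hle
    obtain ⟨k, l, hk₆, hl₆, hkl, hle⟩ := hI₆
    have hW₆ : s₆.arr aWeight = s₃.arr aWeight := (hs₆.arr _ rfl).trans hW₅
    have hK₆ : s₆.reg rK = s.reg rK :=
      (hs₆.reg _ rfl).trans ((hs₅.reg _ rfl).trans (by simp [hs₄, hrg₃]))
    have henv₆ : PairEnv s₆ σ (s.reg rRoot) c (s.reg rg) := by
      refine ⟨henv₅.mem.of_eq ?_ ?_ ?_ ?_ ?_ ?_ ?_ ?_, ?_, ?_, ?_, ?_, ?_, ?_⟩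
      any_goals first | exact hs₆.reg _ rfl | exact hs₆.arr _ rfl
      · exact (hs₆.reg _ rfl).trans henv₅.reg_root
      · exact (hs₆.reg _ rfl).trans henv₅.count
      · exact (hs₆.reg _ rfl).trans henv₅.top
      · exact (hs₆.reg _ rfl).trans henv₅.pairs
      all_goals omega
    have hsum₆ : ∑ z ∈ range (c * c), reweight (s₆.reg rK) (s₆.arr aWeight z)
        (pairInd σ (s.reg rRoot) c z (s₆.reg rKeep)) (pairInd σ (s.reg rRoot) c z (s₆.reg rDrop)) ≤
        c * c * (1 + (i + 1)) := by
      rw [hK₆, hk₆, hl₆, hW₆]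
      refine (sum_reweight_le hK (fun z => pairInd_le _ _ _ _ _) hle).trans ?_
      have := hI.sum_le
      rw [← Nat.add_assoc, Nat.mul_add (c * c) (1 + i) 1]
      omega
    have hSB' : c * c * (1 + (i + 1)) < 2 ^ B :=
      lt_of_le_of_lt (Nat.mul_le_mul_left _ (by omega)) hB
    refine Runs.cons (runs_updateWeights henv₆ hsum₆ hSB') fun s₇ hs₇ _ hI₇ => ?_
    rw [hK₆, hk₆, hl₆, hW₆] at hI₇ hsum₆
    have hr₇ : ∀ x, (x = rBase ∨ x = rBlock ∨ x = rh) → s₇.reg x = s.reg x := by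
      rintro x (rfl | rfl | rfl) <;>
        exact (hs₇.reg _ rfl).trans ((hs₆.reg _ rfl).trans ((hs₅.reg _ rfl).trans
          (by simp [hs₄, hrg₃])))
    have hi₇ : s₇.reg ri = i :=
      (hs₇.reg _ rfl).trans ((hs₆.reg _ rfl).trans ((hs₅.reg _ rfl).trans (by simp [hs₄, hi₃])))
    have hk₇ : s₇.reg rKeep = k := (hs₇.reg _ rfl).trans hk₆
    have hsam₇ : s₇.arr aSample = s.arr aSample :=
      (hs₇.arr _ rfl).trans ((hs₆.arr _ rfl).trans ((hs₅.arr _ rfl).trans (by simp [hs₄, har₃])))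
    have hnext₇ : s₇.arr aNext = s₃.arr aNext :=
      (hs₇.arr _ rfl).trans ((hs₆.arr _ rfl).trans ((hs₅.arr _ rfl).trans (by simp [hs₄])))
    refine Runs.cons_store (T := 1) (fun hb => hb.arr _ _) (Runs.nil ?_)
    simp only [Expr.eval_add, Expr.eval_mul, Expr.eval_reg, Expr.eval_get, hi₇, hk₇, hsam₇,
      hr₇ rBlock (by simp), hr₇ rh (by simp), hr₇ rBase (by simp)]
    refine ⟨Function.update keep i k, Function.update drop i l, fun i' => ?_, fun i' hi' => ?_,
      fun j hj => ?_, ?_, fun z hz => ?_⟩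
    · rcases eq_or_ne i' i with rfl | hne
      · simpa using hkl
      · simpa [hne] using hI.split i'
    · rcases eq_or_ne i' i with rfl | hne
      · simp
      · have : s.reg rBlock * s.reg rh + i' ≠ s.reg rBlock * s.reg rh + i := by omega
        simpa [hne, hnext₇] using hI.next i' (by omega)
    · have : j ≠ s.reg rBlock * s.reg rh + i := by omega
      simpa [this, hnext₇] using hI.next_of_lt j hj
    · rw [State.arr_setReg, State.arr_setArr, if_neg (by decide),
        sum_congr rfl fun z hz => hI₇ z (mem_range.1 hz)]
      exact hsum₆
    · rw [State.arr_setReg, State.arr_setArr, if_neg (by decide), hI₇ z hz, prod_range_succ,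
        Function.update_self, Function.update_self]
      refine le_trans ?_ (le_reweight hK (pairInd_le _ _ _ _ _) _ _)
      refine mul_le_mul_of_nonneg_right ?_ ?_
      · refine le_trans (le_of_eq (prod_congr rfl fun i' hi' => ?_)) (hI.prod_le z hz)
        have : i' ≠ i := (mem_range.1 hi').ne
        rw [Function.update_of_ne this, Function.update_of_ne this]
      · have h₁ : (pairInd σ (s.reg rRoot) c z k : ℝ) ≤ 1 := by
          exact_mod_cast pairInd_le _ _ _ _ _
        have h₂ : (1 : ℝ) ≤ s.reg rK := by exact_mod_cast hK
        rw [one_add_div (by positivity)]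
        have h₃ : (0 : ℝ) ≤ pairInd σ (s.reg rRoot) c z l := Nat.cast_nonneg _
        apply div_nonneg <;> linarith
  · obtain ⟨keep, drop, hI⟩ := hI
    refine ⟨hI.next_of_lt, keep, drop, hI.split, hI.next, fun y y' => ?_⟩
    have hn := htrie.node_lt y
    have hn' := htrie.node_lt y'
    rw [hc] at hn hn'
    have hcov := fun k => pair_cover (σ := σ) (le_max_right (s.arr aCur y) (s.reg rRoot)) hn
      (le_max_right (s.arr aCur y') (s.reg rRoot)) hn' k
    simp only [htrie.node] at hcov
    -- Applied to the pair of the current nodes of `y` and `y'`. Its weight is below `2 ^ B` because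
    -- the final memory is bounded.
    have := sum_le_of_prod_le hK (a := fun i => pairInd σ (s.reg rRoot) c
      ((max (s.arr aCur y) (s.reg rRoot) - s.reg rRoot) * c +
        (max (s.arr aCur y') (s.reg rRoot) - s.reg rRoot)) (keep i))
      (b := fun i => pairInd σ (s.reg rRoot) c
      ((max (s.arr aCur y) (s.reg rRoot) - s.reg rRoot) * c +
        (max (s.arr aCur y') (s.reg rRoot) - s.reg rRoot)) (drop i))
      (fun i => pairInd_le _ _ _ _ _) (fun i => pairInd_le _ _ _ _ _) (hb₃.arr aWeight _)
      (hh ▸ hI.prod_le _ (hcov 0).1)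
    rw [← hh] at this
    simpa only [(hcov _).2] using this

notation "rLevel" => (30 : ℕ)

/-! ### Repeated halving -/

/-- Halve the group number `rBlock`. -/
def processGroup : Program := block [
  .assign rBase (.reg rBlock * .reg rg),
  buildTrie,
  halveGroup]

/-- Replace the sample by a sample of half its size. -/
def halveSample : Program := block [
  forLoop rBlock (.reg rGroups) processGroup,
  forLoop ri (.reg rGroups * .reg rh) (.store aSample (.reg ri) (.get aNext (.reg ri))),
  .assign rGroups (.reg rGroups / 2)]

/-- Reduce the sample to a single group, and build the trie of the traces on it. -/
def reduceSample : Program := block [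
  forLoop rLevel (.reg rLevels) halveSample,
  .assign rBase 0,
  buildTrie]

/-! ### Fair halvings and the accumulation of their errors -/

theorem sum_range_mul_add (f : ℕ → ℕ) (G g : ℕ) :
    ∑ j ∈ range (G * g), f j = ∑ b ∈ range G, ∑ k ∈ range g, f (b * g + k) := by
  induction G with
  | zero => simp
  | succ G ih => rw [Nat.add_mul, one_mul, sum_range_add, ih, sum_range_succ]

theorem IsSplit.sum_eq {keep drop : ℕ → ℕ} (h : IsSplit keep drop) (f : ℕ → ℕ) (n : ℕ) :
    ∑ k ∈ range (2 * n), f k = ∑ i ∈ range n, f (keep i) + ∑ i ∈ range n, f (drop i) := by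
  induction n with
  | zero => simp
  | succ n ih =>
    rw [Nat.mul_succ, sum_range_succ, sum_range_succ, sum_range_succ, sum_range_succ, ih]
    rcases h n with ⟨h₁, h₂⟩ | ⟨h₁, h₂⟩ <;> rw [h₁, h₂] <;> omega

/-- The number of positions `k` in `I` such that `q` and `q'` differ in the vertex `f k`. -/
def diffCount (e : ℕ → Finset ℕ) (q q' : ℕ) (f : ℕ → ℕ) (I : Finset ℕ) : ℕ :=
  ∑ k ∈ I, if f k ∈ symmDiff (e q) (e q') then 1 else 0

/-- `f'` is a fair selection of half of the values of `f`, with an additive error `δ`. -/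
structure Halves (e : ℕ → Finset ℕ) (r δ : ℕ) (f f' : ℕ → ℕ) (n : ℕ) : Prop where
  mem : ∀ i < n, ∃ k, f' i = f k
  sum_le : ∀ w : ℕ → ℕ, ∑ i ∈ range n, w (f' i) ≤ ∑ k ∈ range (2 * n), w (f k)
  diff_le : ∀ q < r, ∀ q' < r,
    diffCount e q q' f (range (2 * n)) ≤ 2 * diffCount e q q' f' (range n) + δ

variable {B : ℕ} {s s' : State} {e : ℕ → Finset ℕ} {r d : ℕ}

theorem Halves.congr {δ n : ℕ} {f f₁ f₂ : ℕ → ℕ} (h : Halves e r δ f f₁ n)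
    (h' : ∀ i < n, f₂ i = f₁ i) : Halves e r δ f f₂ n where
  mem i hi := by
    rw [h' i hi]
    exact h.mem i hi
  sum_le w := by
    rw [sum_congr rfl fun i hi => by rw [h' i (mem_range.1 hi)]]
    exact h.sum_le w
  diff_le q hq q' hq' := by
    have : diffCount e q q' f₂ (range n) = diffCount e q q' f₁ (range n) :=
      sum_congr rfl fun i hi => by rw [h' i (mem_range.1 hi)]
    rw [this]
    exact h.diff_le q hq q' hq'

/-- All conditions are sums over positions, so they add up over blocks, and so do the errors. -/
theorem Halves.blocks {δ h G : ℕ} {f f' : ℕ → ℕ}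
    (H : ∀ b < G, Halves e r δ (fun k => f (b * (2 * h) + k)) (fun i => f' (b * h + i)) h) :
    Halves e r (G * δ) f f' (G * h) where
  mem j hj := by
    have hh : 0 < h := Nat.pos_of_ne_zero fun h0 => by simp [h0] at hj
    obtain ⟨k, hk⟩ := (H (j / h) ((Nat.div_lt_iff_lt_mul hh).2 hj)).mem (j % h) (Nat.mod_lt _ hh)
    refine ⟨_, Eq.trans ?_ hk⟩
    rw [Nat.div_add_mod']
  sum_le w := by
    rw [sum_range_mul_add, Nat.mul_left_comm, sum_range_mul_add]
    exact sum_le_sum fun b hb => (H b (mem_range.1 hb)).sum_le w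
  diff_le q hq q' hq' := by
    unfold diffCount
    rw [Nat.mul_left_comm, sum_range_mul_add, sum_range_mul_add]
    have := sum_le_sum fun b hb => (H b (mem_range.1 hb)).diff_le q hq q' hq'
    rw [sum_add_distrib, ← mul_sum, sum_const, card_range, smul_eq_mul] at this
    exact this

/-- The data that stay fixed while the sample is reduced. -/
structure SampleEnv (s : State) (e : ℕ → Finset ℕ) (r d B : ℕ) : Prop where
  vc : VCBound e r d
  adj : HasAdj s e r
  inc : HasInc s e r
  g_eq : s.reg rg = 2 * s.reg rh
  h_eq : s.reg rh = s.reg rK * s.reg rK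
  K_pos : 0 < s.reg rK
  g_le : s.reg rg ≤ s.reg rStride
  pairs_lt : (s.reg rg + 1) ^ (d + 1) * (s.reg rg + 1) ^ (d + 1) * (1 + s.reg rh) < 2 ^ B

theorem SampleEnv.of_eq (h : SampleEnv s e r d B) (h₁ : s'.reg rr = s.reg rr)
    (h₂ : s'.reg rN = s.reg rN) (h₃ : s'.reg rg = s.reg rg) (h₄ : s'.reg rh = s.reg rh)
    (h₅ : s'.reg rK = s.reg rK) (h₆ : s'.reg rStride = s.reg rStride)
    (h₇ : s'.arr aDeg = s.arr aDeg) (h₈ : s'.arr aAdj = s.arr aAdj)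
    (h₉ : s'.arr aInc = s.arr aInc) : SampleEnv s' e r d B := by
  refine ⟨h.vc, ⟨h₁.trans h.adj.reg_r, ?_, ?_⟩, ?_, ?_, ?_, ?_, ?_, ?_⟩
  · rw [h₇]; exact h.adj.deg
  · rw [h₈]; exact h.adj.adj
  · unfold HasInc
    rw [h₂, h₉]; exact h.inc
  · rw [h₃, h₄]; exact h.g_eq
  · rw [h₄, h₅]; exact h.h_eq
  · rw [h₅]; exact h.K_pos
  · rw [h₃, h₆]; exact h.g_le
  · rw [h₃, h₄]; exact h.pairs_lt

/-- The positions where two hyperedges differ are kept or dropped, and the dropped ones exceed the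
kept ones by at most `K(B + 2)`. Hence their number is at most twice the kept ones plus that error.
-/
theorem runs_processGroup (henv : SampleEnv s e r d B) (hfresh : FreshTrie s)
    (hsample : ∀ i, s.arr aSample i < s.reg rN)
    (hT : s.reg rT + (s.reg rg + 1) ^ (d + 1) + 1 < 2 ^ B)
    (hbase : s.reg rBlock * s.reg rg < 2 ^ B) :
    Runs B processGroup s
      (16 * ∑ k ∈ range (s.reg rg), s.arr aDeg (s.arr aSample (s.reg rBlock * s.reg rg + k)) +
        80 * (s.reg rh + 1) * ((s.reg rg + 1) ^ (d + 1) * (s.reg rg + 1) ^ (d + 1) + 1))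
      fun s' => FreshTrie s' ∧ s'.reg rT ≤ s.reg rT + (s.reg rg + 1) ^ (d + 1) ∧
        (∀ j < s.reg rBlock * s.reg rh, s'.arr aNext j = s.arr aNext j) ∧
        Halves e r (s.reg rK * (B + 2))
          (fun k => s.arr aSample (s.reg rBlock * (2 * s.reg rh) + k))
          (fun i => s'.arr aNext (s.reg rBlock * s.reg rh + i)) (s.reg rh) := by
  set τ := (s.reg rg + 1) ^ (d + 1) with hτ
  refine Runs.mono (T₁ := (∑ k ∈ range (s.reg rg),
    (16 * s.arr aDeg (s.arr aSample (s.reg rBlock * s.reg rg + k)) + 10) + 10 +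
    (40 * (s.reg rh + 1) * (τ * τ + 1) + 1)) + 1) ?_ ?_
  swap
  · rw [sum_add_distrib, ← mul_sum, sum_const, card_range, smul_eq_mul, henv.g_eq]
    nlinarith [Nat.zero_le (s.reg rh * (τ * τ)), Nat.zero_le (τ * τ), Nat.zero_le (s.reg rh)]
  refine Runs.cons_assign (fun _ => by simpa using hbase) ?_
  simp only [Expr.eval_mul, Expr.eval_reg]
  set s₁ := s.setReg rBase (s.reg rBlock * s.reg rg) with hs₁
  have henv₁ : SampleEnv s₁ e r d B := by
    refine henv.of_eq ?_ ?_ ?_ ?_ ?_ ?_ ?_ ?_ ?_ <;> simp [hs₁]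
  have hfresh₁ : FreshTrie s₁ := ⟨hfresh.pos, hfresh.cur, hfresh.ch, hfresh.lim⟩
  have hbuild := runs_buildTrie henv.vc henv₁.adj hfresh₁ henv₁.g_le
    (by simpa [hs₁] using hT)
  have hbase₁ : s₁.reg rBase = s.reg rBlock * s.reg rg := by simp [hs₁]
  refine Runs.cons (by simpa [hs₁] using hbuild) fun s₂ hs₂ _ hI₂ => ?_
  obtain ⟨hroot₂, hT₂, σ, hσ⟩ := hI₂
  have hr₂ : ∀ x, (x = rBlock ∨ x = rg ∨ x = rh ∨ x = rK ∨ x = rN ∨ x = rr ∨ x = rStride) →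
      s₂.reg x = s.reg x := by
    rintro x (rfl | rfl | rfl | rfl | rfl | rfl | rfl) <;>
      exact (hs₂.reg _ rfl).trans (by simp [hs₁])
  have hbase₂ : s₂.reg rBase = s.reg rBlock * s.reg rg := (hs₂.reg _ rfl).trans hbase₁
  have ha₂ : ∀ a, (a = aSample ∨ a = aInc ∨ a = aNext) → s₂.arr a = s.arr a := by
    rintro a (rfl | rfl | rfl) <;> exact (hs₂.arr _ rfl).trans (by simp [hs₁])
  have hσ' : IsTrie s₂ σ (groupTrace e r (fun k => s₂.arr aSample (s₂.reg rBase + k))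
      (s.reg rg)) := by
    rw [ha₂ aSample (by simp), hbase₂]
    exact hσ
  have hmem : HasMem s₂ σ (s.reg rg) := by
    refine hσ'.hasMem (fun q hq v hv => ?_) fun i => ?_
    · rw [ha₂ aInc (by simp), hr₂ rN (by simp)] at *
      exact henv.inc q hq v hv
    · rw [ha₂ aSample (by simp), hr₂ rN (by simp)]
      exact hsample i
  obtain ⟨c, hc⟩ : ∃ c, s₂.reg rT = s₂.reg rRoot + c :=
    ⟨s₂.reg rT - s₂.reg rRoot, by have : s₂.reg rRoot < s₂.reg rT := hσ.root_lt; omega⟩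
  have hcτ : c ≤ τ := by omega
  have hccτ : c * c ≤ τ * τ := Nat.mul_le_mul hcτ hcτ
  have hhalve := runs_halveGroup (B := B) hσ' (by rw [hr₂ rg (by simp)]; exact hmem)
    (by rw [hr₂ rg (by simp), hr₂ rh (by simp)]; exact henv.g_eq)
    (by rw [hr₂ rK (by simp), hr₂ rh (by simp)]; exact henv.h_eq)
    (by rw [hr₂ rK (by simp)]; exact henv.K_pos) hc
    (by rw [hr₂ rh (by simp)]
        exact lt_of_le_of_lt (Nat.mul_le_mul_right _ hccτ) henv.pairs_lt)
  rw [hr₂ rh (by simp), hr₂ rBlock (by simp), hr₂ rK (by simp), ha₂ aSample (by simp),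
    ha₂ aNext (by simp), hbase₂] at hhalve
  refine Runs.cons (hhalve.mono (Nat.mul_le_mul_left _ (Nat.add_le_add_right hccτ 1)))
    fun s₃ hs₃ _ hI₃ => Runs.nil ?_
  obtain ⟨hn₁, keep, drop, hsplit, hn₂, hdiff⟩ := hI₃
  have hT₃ : s₃.reg rT = s₂.reg rT := hs₃.reg _ rfl
  have hfresh₂ := hσ.freshTrie
  refine ⟨⟨hT₃ ▸ hfresh₂.pos, ?_, ?_, ?_⟩, hT₃ ▸ hT₂, hn₁, ⟨fun i hi => ?_, fun w => ?_,
    fun q hq q' hq' => ?_⟩⟩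
  · rw [hs₃.arr aCur rfl, hT₃]
    exact hfresh₂.cur
  · rw [hs₃.arr aCh rfl, hT₃, hs₃.reg rStride rfl]
    exact hfresh₂.ch
  · rw [hs₃.arr aLim rfl, hT₃]
    exact hfresh₂.lim
  · exact ⟨keep i, by rw [hn₂ i hi, henv.g_eq]⟩
  · rw [hsplit.sum_eq (fun k => w (s.arr aSample (s.reg rBlock * (2 * s.reg rh) + k))),
      sum_congr rfl fun i hi => by rw [hn₂ i (mem_range.1 hi), henv.g_eq]]
    exact Nat.le_add_right _ _
  · have hlt : ∀ i < s.reg rh, keep i < s.reg rg ∧ drop i < s.reg rg := by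
      intro i hi
      rw [henv.g_eq]
      rcases hsplit i with ⟨h₁, h₂⟩ | ⟨h₁, h₂⟩ <;> omega
    -- Traces consist of positions, hyperedges of vertices; below `g` the two notions of difference
    -- agree.
    have htr : ∀ k < s.reg rg, k ∈ symmDiff
        (groupTrace e r (fun k => s.arr aSample (s.reg rBlock * s.reg rg + k)) (s.reg rg) q)
        (groupTrace e r (fun k => s.arr aSample (s.reg rBlock * s.reg rg + k)) (s.reg rg) q') ↔
        s.arr aSample (s.reg rBlock * (2 * s.reg rh) + k) ∈ symmDiff (e q) (e q') := by
      intro k hk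
      rw [henv.g_eq] at hk ⊢
      simp only [mem_symmDiff, groupTrace, hq, hq', if_true, mem_filter, mem_range, hk, true_and]
    have h₂ : ∀ {f : ℕ → ℕ}, (∀ i < s.reg rh, f i < s.reg rg) →
        (∑ i ∈ range (s.reg rh), if f i ∈ symmDiff
        (groupTrace e r (fun k => s.arr aSample (s.reg rBlock * s.reg rg + k)) (s.reg rg) q)
        (groupTrace e r (fun k => s.arr aSample (s.reg rBlock * s.reg rg + k)) (s.reg rg) q')
        then 1 else 0) = ∑ i ∈ range (s.reg rh), if s.arr aSample (s.reg rBlock * (2 * s.reg rh) +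
          f i) ∈ symmDiff (e q) (e q') then 1 else 0 := by
      intro f hf
      refine sum_congr rfl fun i hi => ?_
      simp only [htr _ (hf i (mem_range.1 hi))]
    have h₁ := hdiff q q'
    rw [h₂ fun i hi => (hlt i hi).1, h₂ fun i hi => (hlt i hi).2] at h₁
    unfold diffCount
    rw [hsplit.sum_eq (fun k => if s.arr aSample (s.reg rBlock * (2 * s.reg rh) + k) ∈
      symmDiff (e q) (e q') then 1 else 0)]
    have h₃ : (∑ i ∈ range (s.reg rh), if s₃.arr aNext (s.reg rBlock * s.reg rh + i) ∈
        symmDiff (e q) (e q') then 1 else 0) = ∑ i ∈ range (s.reg rh),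
        if s.arr aSample (s.reg rBlock * (2 * s.reg rh) + keep i) ∈ symmDiff (e q) (e q')
        then 1 else 0 :=
      sum_congr rfl fun i hi => by rw [hn₂ i (mem_range.1 hi), henv.g_eq]
    simp only at h₁ ⊢
    rw [h₃]
    omega

theorem FreshTrie.of_eq (h : FreshTrie s) (h₁ : s'.reg rT = s.reg rT)
    (h₂ : s'.reg rStride = s.reg rStride) (h₃ : s'.arr aCur = s.arr aCur)
    (h₄ : s'.arr aCh = s.arr aCh) (h₅ : s'.arr aLim = s.arr aLim) : FreshTrie s' := by
  refine ⟨?_, ?_, ?_, ?_⟩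
  · rw [h₁]; exact h.pos
  · rw [h₁, h₃]; exact h.cur
  · rw [h₁, h₂, h₄]; exact h.ch
  · rw [h₁, h₅]; exact h.lim

theorem runs_halveSample (henv : SampleEnv s e r d B) (hfresh : FreshTrie s)
    (hsample : ∀ i, s.arr aSample i < s.reg rN)
    (hT : s.reg rT + s.reg rGroups * (s.reg rg + 1) ^ (d + 1) + 1 < 2 ^ B)
    (hbase : s.reg rGroups * s.reg rg < 2 ^ B) :
    Runs B halveSample s
      (16 * ∑ j ∈ range (s.reg rGroups * s.reg rg), s.arr aDeg (s.arr aSample j) +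
        s.reg rGroups * (90 * (s.reg rh + 1) *
          ((s.reg rg + 1) ^ (d + 1) * (s.reg rg + 1) ^ (d + 1) + 1)) + 10)
      fun s' => FreshTrie s' ∧
        s'.reg rT ≤ s.reg rT + s.reg rGroups * (s.reg rg + 1) ^ (d + 1) ∧
        s'.reg rGroups = s.reg rGroups / 2 ∧ (∀ i, s'.arr aSample i < s.reg rN) ∧
        Halves e r (s.reg rGroups * (s.reg rK * (B + 2))) (s.arr aSample) (s'.arr aSample)
          (s.reg rGroups * s.reg rh) := by
  set τ := (s.reg rg + 1) ^ (d + 1) with hτ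
  set G := s.reg rGroups with hG
  set δ := s.reg rK * (B + 2) with hδ
  set P := 80 * (s.reg rh + 1) * (τ * τ + 1) with hP
  have hgh := henv.g_eq
  refine Runs.of_bdd fun hb => ?_
  refine Runs.mono (T₁ := (∑ b ∈ range G,
    (16 * ∑ k ∈ range (s.reg rg), s.arr aDeg (s.arr aSample (b * s.reg rg + k)) + P + 2) + 2) +
    ((∑ _j ∈ range (G * s.reg rh), (1 + 2) + 2) + (1 + 1))) ?_ ?_
  swap
  · rw [sum_range_mul_add (fun j => s.arr aDeg (s.arr aSample j)), sum_add_distrib,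
      sum_add_distrib, ← mul_sum]
    simp only [sum_const, card_range, smul_eq_mul]
    have h₁ : G * (90 * (s.reg rh + 1) * (τ * τ + 1)) =
        G * P + G * (10 * (s.reg rh + 1) * (τ * τ + 1)) := by rw [hP]; ring
    have h₂ : G * (3 * s.reg rh + 2) ≤ G * (10 * (s.reg rh + 1) * (τ * τ + 1)) :=
      Nat.mul_le_mul_left _ (by nlinarith [Nat.zero_le (s.reg rh * (τ * τ)), Nat.zero_le (τ * τ)])
    have h₃ : G * (3 * s.reg rh + 2) = G * s.reg rh * 3 + G * 2 := by ring
    omega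
  refine Runs.cons (Q₁ := fun s' => FreshTrie s' ∧ s'.reg rT ≤ s.reg rT + G * τ ∧
      Halves e r (G * δ) (s.arr aSample) (s'.arr aNext) (G * s.reg rh))
    (Runs.forLoop G (fun b s' => FreshTrie s' ∧ s'.reg rT ≤ s.reg rT + b * τ ∧
      ∀ b' < b, Halves e r δ (fun k => s.arr aSample (b' * (2 * s.reg rh) + k))
        (fun i => s'.arr aNext (b' * s.reg rh + i)) (s.reg rh)) _ (hb.reg _)
      (fun s' hs' => hs'.reg _ rfl) ⟨hfresh.of_eq rfl rfl rfl rfl rfl, by simp, by simp⟩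
      (fun b hbG s₁ hs₁ hb₁ hI => ?_) fun s' _ _ hI => ⟨hI.1, hI.2.1, Halves.blocks hI.2.2⟩)
    fun s₂ hs₂ _ hI₂ => ?_
  · obtain ⟨hf₁, hT₁, hH₁⟩ := hI
    have hr₁ : ∀ x, (x = rN ∨ x = rg ∨ x = rh ∨ x = rK) → s₁.reg x = s.reg x := by
      rintro x (rfl | rfl | rfl | rfl) <;> exact hs₁.reg _ rfl
    have ha₁ : ∀ a, (a = aSample ∨ a = aDeg) → s₁.arr a = s.arr a := by
      rintro a (rfl | rfl) <;> exact hs₁.arr _ rfl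
    have hbG' : (b + 1) * τ ≤ G * τ := Nat.mul_le_mul_right _ hbG
    have hrun := runs_processGroup (s := s₁) (B := B) (henv.of_eq (hs₁.reg _ rfl) (hs₁.reg _ rfl)
      (hs₁.reg _ rfl) (hs₁.reg _ rfl) (hs₁.reg _ rfl) (hs₁.reg _ rfl) (hs₁.arr _ rfl)
      (hs₁.arr _ rfl) (hs₁.arr _ rfl)) hf₁
      (by rw [ha₁ aSample (by simp), hr₁ rN (by simp)]; exact hsample)
      (by rw [hr₁ rg (by simp)]; rw [Nat.add_mul] at hbG'; omega)
      (by rw [hr₁ rg (by simp), hb₁]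
          exact lt_of_le_of_lt (Nat.mul_le_mul_right _ hbG.le) hbase)
    rw [hr₁ rg (by simp), hr₁ rh (by simp), hr₁ rK (by simp), ha₁ aSample (by simp),
      ha₁ aDeg (by simp), hb₁] at hrun
    refine hrun.imp fun s₂ hs₂ _ hI₂ => ?_
    obtain ⟨hf₂, hT₂, hn₂, hH₂⟩ := hI₂
    refine ⟨hf₂.of_eq rfl rfl rfl rfl rfl, ?_, fun b' hb' => ?_⟩
    · rw [Nat.add_mul]
      have : (s₂.setReg rBlock (b + 1)).reg rT = s₂.reg rT := by simp
      omega
    · rcases eq_or_ne b' b with rfl | hne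
      · exact hH₂
      -- Group `b` leaves the cells below `b * h` of the new sample alone, so the earlier halvings
      -- persist.
      · refine (hH₁ b' (by omega)).congr fun i hi => hn₂ _ ?_
        have : (b' + 1) * s.reg rh ≤ b * s.reg rh := Nat.mul_le_mul_right _ (by omega)
        rw [Nat.add_mul] at this
        omega
  · obtain ⟨hf₂, hT₂, hH₂⟩ := hI₂
    have hG₂ : s₂.reg rGroups = G := hs₂.reg _ rfl
    have hh₂ : s₂.reg rh = s.reg rh := hs₂.reg _ rfl
    have hsam₂ : s₂.arr aSample = s.arr aSample := hs₂.arr _ rfl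
    refine Runs.cons (Q₁ := fun s' => (∀ j < G * s.reg rh, s'.arr aSample j = s₂.arr aNext j) ∧
        ∀ j, G * s.reg rh ≤ j → s'.arr aSample j = s.arr aSample j)
      (Runs.forLoop (G * s.reg rh) (fun i s' =>
        (∀ j < i, s'.arr aSample j = s₂.arr aNext j) ∧
        ∀ j, i ≤ j → s'.arr aSample j = s.arr aSample j) (fun _ => 1) ?_ (fun s' hs' => ?_)
        ⟨by simp, by simp [hsam₂]⟩ (fun i hi s₃ hs₃ hi₃ hI => ?_) fun s' _ _ hI => hI)
      fun s₄ hs₄ hb₄ hI₄ => ?_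
    · exact lt_of_le_of_lt (Nat.mul_le_mul_left _ (by omega)) hbase
    · rw [Expr.eval_mul, Expr.eval_reg, Expr.eval_reg, hs'.reg _ rfl, hs'.reg _ rfl, hG₂, hh₂]
    · refine Runs.store (fun hb => hb.arr _ _) ?_
      have hn₃ : s₃.arr aNext = s₂.arr aNext := hs₃.arr _ rfl
      simp only [Expr.eval_reg, Expr.eval_get, State.arr_setReg, State.arr_setArr, if_true, hi₃,
        hn₃]
      refine ⟨fun j hj => ?_, fun j hj => ?_⟩
      · rcases eq_or_ne j i with rfl | hne
        · simp
        · simpa [hne] using hI.1 j (by omega)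
      · have : j ≠ i := by omega
        simpa [this] using hI.2 j (by omega)
    · have hG₄ : s₄.reg rGroups = G := (hs₄.reg _ rfl).trans hG₂
      refine Runs.cons_assign (T := 1) (fun _ => ?_) (Runs.nil ?_)
      · rw [Expr.eval_div, Expr.eval_reg]
        exact lt_of_le_of_lt (Nat.div_le_self _ _) (hb₄.reg _)
      · have hH₄ : Halves e r (G * δ) (s.arr aSample) (s₄.arr aSample) (G * s.reg rh) :=
          hH₂.congr hI₄.1
        refine ⟨hf₂.of_eq ?_ ?_ ?_ ?_ ?_, ?_, ?_, fun i => ?_, hH₄⟩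
        · simpa using hs₄.reg rT rfl
        · simpa using hs₄.reg rStride rfl
        · exact hs₄.arr _ rfl
        · exact hs₄.arr _ rfl
        · exact hs₄.arr _ rfl
        · have : s₄.reg rT = s₂.reg rT := hs₄.reg _ rfl
          simpa [this] using hT₂
        · simp [hG₄]
        · rw [State.arr_setReg]
          rcases Nat.lt_or_ge i (G * s.reg rh) with hi | hi
          · obtain ⟨k, hk⟩ := hH₄.mem i hi
            rw [hk]
            exact hsample k
          · rw [hI₄.2 i hi]
            exact hsample i

/-- Level `l` has `2^(L-l)` groups and its error counts `2^l` times in the original sample, so every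
level contributes `2^L K(B + 2)`. On the last group, equal traces mean that no position separates
the hyperedges. The sum of the degrees over the sample never exceeds `m`, which bounds the cost of
the tries on each level. -/
theorem runs_reduceSample {L m : ℕ} (henv : SampleEnv s e r d B) (hfresh : FreshTrie s)
    (hsample : ∀ i, s.arr aSample i < s.reg rN) (hL : s.reg rLevels = L)
    (hG : s.reg rGroups = 2 ^ L)
    (hT : s.reg rT + (L * 2 ^ L + 1) * (s.reg rg + 1) ^ (d + 1) + 1 < 2 ^ B)
    (hbase : 2 ^ L * s.reg rg < 2 ^ B)
    (hm : ∑ j ∈ range (2 ^ L * s.reg rg), s.arr aDeg (s.arr aSample j) ≤ m) :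
    Runs B reduceSample s
      ((L + 1) * (16 * m + 2 ^ L * (90 * (s.reg rh + 1) *
          ((s.reg rg + 1) ^ (d + 1) * (s.reg rg + 1) ^ (d + 1) + 1)) + 20))
      fun s' => s'.reg rT ≤ s.reg rT + (L * 2 ^ L + 1) * (s.reg rg + 1) ^ (d + 1) ∧
        s'.reg rT ≤ s'.reg rRoot + (s.reg rg + 1) ^ (d + 1) ∧
        ∃ σ tr, IsTrie s' σ tr ∧ ∀ q < r, ∀ q' < r, tr q = tr q' →
          diffCount e q q' (s.arr aSample) (range (2 ^ L * s.reg rg)) ≤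
            L * (2 ^ L * (s.reg rK * (B + 2))) := by
  set τ := (s.reg rg + 1) ^ (d + 1) with hτ
  set δ := s.reg rK * (B + 2) with hδ
  set P := 90 * (s.reg rh + 1) * (τ * τ + 1) with hP
  set g := s.reg rg with hg
  have hgh : g = 2 * s.reg rh := henv.g_eq
  have hpow : ∀ l, 2 ^ (L - l) ≤ 2 ^ L := fun l => Nat.pow_le_pow_right two_pos (Nat.sub_le _ _)
  have hLB : L < 2 ^ L := Nat.lt_two_pow_self
  refine Runs.of_bdd fun hb => ?_
  refine Runs.mono (T₁ := (∑ _l ∈ range L, (16 * m + 2 ^ L * P + 10 + 2) + 2) +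
    (16 * m + 10 * g + 10 + 1 + 1)) ?_ ?_
  swap
  · simp only [sum_const, card_range, smul_eq_mul]
    have h₁ : 10 * g ≤ P := by
      rw [hP, hgh]
      nlinarith [Nat.zero_le (s.reg rh * (τ * τ)), Nat.zero_le (τ * τ)]
    have h₂ : P ≤ 2 ^ L * P := Nat.le_mul_of_pos_left _ (by positivity)
    have h₃ : (L + 1) * (16 * m + 2 ^ L * P + 20) =
      L * (16 * m + 2 ^ L * P + 10 + 2) + L * 8 + (16 * m + 2 ^ L * P + 20) := by ring
    omega
  have hGB : 2 ^ L < 2 ^ B := hG ▸ hb.reg _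
  refine Runs.cons (Q₁ := fun s' => FreshTrie s' ∧ s'.reg rT ≤ s.reg rT + L * 2 ^ L * τ ∧
      ∑ j ∈ range g, s.arr aDeg (s'.arr aSample j) ≤ m ∧
      ∀ q < r, ∀ q' < r, diffCount e q q' (s.arr aSample) (range (2 ^ L * g)) ≤
        2 ^ L * diffCount e q q' (s'.arr aSample) (range g) + L * (2 ^ L * δ))
    (Runs.forLoop L (fun l s' => FreshTrie s' ∧ s'.reg rT ≤ s.reg rT + l * 2 ^ L * τ ∧
      s'.reg rGroups = 2 ^ (L - l) ∧ (∀ i, s'.arr aSample i < s.reg rN) ∧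
      ∑ j ∈ range (2 ^ (L - l) * g), s.arr aDeg (s'.arr aSample j) ≤ m ∧
      ∀ q < r, ∀ q' < r, diffCount e q q' (s.arr aSample) (range (2 ^ L * g)) ≤
        2 ^ l * diffCount e q q' (s'.arr aSample) (range (2 ^ (L - l) * g)) + l * (2 ^ L * δ)) _
      (by omega) (fun s' hs' => (hs'.reg _ rfl).trans hL) ?_
      (fun l hl s₁ hs₁ hl₁ hI => ?_) fun s' _ _ hI => ?_)
    fun s₂ hs₂ hb₂ hI₂ => ?_
  · refine ⟨hfresh.of_eq rfl rfl rfl rfl rfl, by simp, ?_, hsample, by simpa using hm, ?_⟩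
    · simpa using hG
    · simp
  · obtain ⟨hf₁, hT₁, hG₁, hsam₁, hm₁, hD₁⟩ := hI
    have hr₁ : ∀ x, (x = rN ∨ x = rg ∨ x = rh ∨ x = rK) → s₁.reg x = s.reg x := by
      rintro x (rfl | rfl | rfl | rfl) <;> exact hs₁.reg _ rfl
    have hdeg₁ : s₁.arr aDeg = s.arr aDeg := hs₁.arr _ rfl
    have hl' : (l + 1) * 2 ^ L * τ ≤ L * 2 ^ L * τ :=
      Nat.mul_le_mul_right _ (Nat.mul_le_mul_right _ hl)
    have hl'' : (l + 1) * 2 ^ L * τ = l * 2 ^ L * τ + 2 ^ L * τ := by ring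
    have hl₃ : (L * 2 ^ L + 1) * τ = L * 2 ^ L * τ + τ := by ring
    have hpl : 2 ^ (L - l) * τ ≤ 2 ^ L * τ := Nat.mul_le_mul_right _ (hpow l)
    have hrun := runs_halveSample (s := s₁) (B := B) (henv.of_eq (hs₁.reg _ rfl) (hs₁.reg _ rfl)
      (hs₁.reg _ rfl) (hs₁.reg _ rfl) (hs₁.reg _ rfl) (hs₁.reg _ rfl) (hs₁.arr _ rfl)
      (hs₁.arr _ rfl) (hs₁.arr _ rfl)) hf₁ (by rw [hr₁ rN (by simp)]; exact hsam₁)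
      (by rw [hr₁ rg (by simp), hG₁]
          change s₁.reg rT + 2 ^ (L - l) * τ + 1 < 2 ^ B
          omega)
      (by rw [hr₁ rg (by simp), hG₁]
          exact lt_of_le_of_lt (Nat.mul_le_mul_right _ (hpow l)) hbase)
    rw [hr₁ rg (by simp), hr₁ rh (by simp), hr₁ rK (by simp), hr₁ rN (by simp), hdeg₁, hG₁] at hrun
    have hcost : 2 ^ (L - l) * P ≤ 2 ^ L * P := Nat.mul_le_mul_right _ (hpow l)
    refine (hrun.mono ?_).imp fun s₂ hs₂ _ hI₂ => ?_
    · exact Nat.add_le_add_right (Nat.add_le_add (Nat.mul_le_mul_left _ hm₁) hcost) _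
    obtain ⟨hf₂, hT₂, hG₂, hsam₂, hH₂⟩ := hI₂
    change s₂.reg rT ≤ s₁.reg rT + 2 ^ (L - l) * τ at hT₂
    have hG' : 2 ^ (L - l) = 2 * 2 ^ (L - (l + 1)) := by
      rw [← pow_succ', show L - (l + 1) + 1 = L - l by omega]
    have hn : 2 ^ (L - l) * s.reg rh = 2 ^ (L - (l + 1)) * g := by rw [hG', hgh]; ring
    have hn' : 2 * (2 ^ (L - (l + 1)) * g) = 2 ^ (L - l) * g := by rw [hG']; ring
    rw [hn] at hH₂
    refine ⟨hf₂.of_eq rfl rfl rfl rfl rfl, ?_, ?_, hsam₂, ?_, fun q hq q' hq' => ?_⟩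
    · have : (s₂.setReg rLevel (l + 1)).reg rT = s₂.reg rT := by simp
      omega
    · have : (s₂.setReg rLevel (l + 1)).reg rGroups = s₂.reg rGroups := by simp
      rw [this, hG₂, hG', Nat.mul_div_cancel_left _ two_pos]
    · have := hH₂.sum_le (s.arr aDeg)
      rw [hn'] at this
      exact this.trans hm₁
    · have h₁ := hH₂.diff_le q hq q' hq'
      rw [hn'] at h₁
      have h₂ := hD₁ q hq q' hq'
      have h₃ := Nat.mul_le_mul_left (2 ^ l) h₁
      have h₄ : 2 ^ l * (2 ^ (L - l) * δ) = 2 ^ L * δ := by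
        rw [← Nat.mul_assoc, ← pow_add, Nat.add_sub_cancel' hl.le]
      have h₅ : (s₂.setReg rLevel (l + 1)).arr aSample = s₂.arr aSample := rfl
      rw [h₅]
      rw [Nat.mul_add, h₄, ← Nat.mul_assoc, ← pow_succ] at h₃
      rw [Nat.add_mul, one_mul]
      omega
  · obtain ⟨hf, hT', -, -, hm', hD⟩ := hI
    simp only [Nat.sub_self, pow_zero, one_mul] at hm' hD
    exact ⟨hf, hT', hm', hD⟩
  · obtain ⟨hf₂, hT₂, hm₂, hD₂⟩ := hI₂
    refine Runs.cons_assign (T := 16 * m + 10 * g + 10 + 1) (fun _ => by simp) ?_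
    rw [Expr.eval_zero]
    set s₃ := s₂.setReg rBase 0 with hs₃
    have hr₃ : ∀ x, (x = rg ∨ x = rr ∨ x = rN ∨ x = rh ∨ x = rK ∨ x = rStride) →
        s₃.reg x = s.reg x := by
      rintro x (rfl | rfl | rfl | rfl | rfl | rfl) <;>
        simpa [hs₃] using hs₂.reg _ rfl
    have hdeg₃ : s₃.arr aDeg = s.arr aDeg := hs₂.arr _ rfl
    have henv₃ : SampleEnv s₃ e r d B := by
      refine henv.of_eq ?_ ?_ ?_ ?_ ?_ ?_ hdeg₃ (hs₂.arr _ rfl) (hs₂.arr _ rfl) <;>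
        exact hr₃ _ (by simp)
    have hT₃ : s₃.reg rT = s₂.reg rT := by simp [hs₃]
    have hbase₃ : s₃.reg rBase = 0 := by simp [hs₃]
    have hsum : (L * 2 ^ L + 1) * τ = L * 2 ^ L * τ + τ := by ring
    have hbuild := runs_buildTrie (B := B) henv.vc henv₃.adj (hf₂.of_eq rfl rfl rfl rfl rfl)
      henv₃.g_le
      (by rw [hr₃ rg (by simp), hT₃]
          change s₂.reg rT + τ + 1 < 2 ^ B
          omega)
    rw [hr₃ rg (by simp), hT₃, hdeg₃, hbase₃] at hbuild
    refine Runs.cons (hbuild.mono ?_) fun s₄ hs₄ _ hI₄ => Runs.nil ?_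
    · rw [sum_add_distrib, ← mul_sum, sum_const, card_range, smul_eq_mul, ← hg]
      simp only [zero_add]
      have : ∑ j ∈ range g, s.arr aDeg (s₃.arr aSample j) ≤ m := hm₂
      omega
    · obtain ⟨hroot, hT₄, σ, hσ⟩ := hI₄
      refine ⟨by omega, by omega, σ, _, hσ, fun q hq q' hq' heq => ?_⟩
      refine (hD₂ q hq q' hq').trans ?_
      have : diffCount e q q' (s₂.arr aSample) (range g) = 0 := by
        refine sum_eq_zero fun k hk => if_neg ?_
        have := Finset.ext_iff.1 heq k
        simp only [groupTrace, hq, hq', if_true, mem_filter, zero_add] at this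
        rw [mem_symmDiff]
        have h₂ : s₃.arr aSample k = s₂.arr aSample k := rfl
        rw [h₂] at this
        tauto
      rw [this, mul_zero, zero_add]

notation "rEdge" => (31 : ℕ)
notation "rPos" => (32 : ℕ)
notation "rLen" => (33 : ℕ)
notation "rJ" => (34 : ℕ)
notation "rPow" => (35 : ℕ)
notation "rE" => (36 : ℕ)
notation "rQuot" => (37 : ℕ)

/-! ### Parameters of the algorithm -/

/-- The exponent of the size `2 ^ J` of the padded vertex set. -/
def sampleExp (n : ℕ) : ℕ := max 1 (Nat.clog 2 n)

/-- The reciprocal of `stabbingEps 5 d`. -/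
def epsInv (d : ℕ) : ℕ := 2 ^ (d + 1) * (5 * d + 4) + 1

/-- The exponent of the parameter `K`. -/
def accuracyExp (d n : ℕ) : ℕ := sampleExp n / epsInv d

theorem le_two_pow_sampleExp (n : ℕ) : n ≤ 2 ^ sampleExp n :=
  (Nat.le_pow_clog one_lt_two n).trans (Nat.pow_le_pow_right two_pos (le_max_right _ _))

theorem two_pow_sampleExp_le (n : ℕ) : 2 ^ sampleExp n ≤ 2 * n + 2 := by
  rcases Nat.lt_or_ge n 2 with h | h
  · have : Nat.clog 2 n = 0 := Nat.clog_of_right_le_one (by omega) _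
    simp [sampleExp, this]
  · have h₁ : 0 < Nat.clog 2 n := Nat.clog_pos one_lt_two h
    have h₂ := Nat.pow_pred_clog_lt_self one_lt_two h
    rw [sampleExp, max_eq_right h₁, ← Nat.succ_pred_eq_of_pos h₁, pow_succ]
    omega

/-- A group has `2K² = 2^(2j+1)` positions for `K = 2^j`, and this must divide `2^J`. It does, as `E
≥ 3` and `J ≥ 1`. -/
theorem two_mul_accuracyExp_lt (d n : ℕ) : 2 * accuracyExp d n + 1 ≤ sampleExp n := by
  have h₁ : 1 ≤ sampleExp n := le_max_left _ _
  have h₂ : 3 ≤ epsInv d := by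
    have : 2 ≤ 2 ^ (d + 1) := by rw [pow_succ]; have := Nat.one_le_two_pow (n := d); omega
    unfold epsInv
    nlinarith
  have h₃ : accuracyExp d n ≤ sampleExp n / 3 := Nat.div_le_div_left h₂ (by norm_num)
  omega

/-- Read the parameters of the input and compute those of the algorithm. -/
def setParams : Program := block [
  .assign rd (.get aInput 0),
  .assign rn (.get aInput 1),
  .assign rr (.get aInput 2),
  .assign rN 2,
  .assign rJ 1,
  forLoop ri (.reg rn) (.ite (.reg rn - .reg rN)
    (block [.assign rN (.reg rN + .reg rN), .assign rJ (.reg rJ + 1)]) .skip),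
  .assign rPow 2,
  forLoop ri (.reg rd) (.assign rPow (.reg rPow + .reg rPow)),
  .assign rE (.reg rPow * (5 * .reg rd + 4) + 1),
  .assign rQuot (.reg rJ / .reg rE),
  .assign rK 1,
  forLoop ri (.reg rQuot) (.assign rK (.reg rK + .reg rK)),
  .assign rh (.reg rK * .reg rK),
  .assign rg (.reg rh + .reg rh),
  .assign rStride (.reg rg + .reg rr),
  .assign rGroups (.reg rN / .reg rg),
  .assign rLevels (.reg rJ - (.reg rQuot + .reg rQuot + 1)),
  .assign rT 1]

/-- The registers hold the parameters. -/
structure HasParams (s : State) (d n r : ℕ) : Prop where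
  reg_n : s.reg rn = n
  reg_r : s.reg rr = r
  reg_N : s.reg rN = 2 ^ sampleExp n
  reg_K : s.reg rK = 2 ^ accuracyExp d n
  reg_h : s.reg rh = s.reg rK * s.reg rK
  reg_g : s.reg rg = 2 * s.reg rh
  reg_stride : s.reg rStride = s.reg rg + r
  reg_groups : s.reg rGroups = 2 ^ s.reg rLevels
  reg_levels : s.reg rLevels + (2 * accuracyExp d n + 1) = sampleExp n
  reg_T : s.reg rT = 1

variable {B : ℕ} {s s' : State} {d n r : ℕ}

theorem runs_setParams (hd : s.arr aInput 0 = d) (hn : s.arr aInput 1 = n)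
    (hr : s.arr aInput 2 = r) (hN : 2 ^ sampleExp n + r < 2 ^ B) (hE : epsInv d < 2 ^ B) :
    Runs B setParams s (6 * n + 3 * d + 3 * sampleExp n + 30) fun s' => HasParams s' d n r := by
  set J := sampleExp n with hJ
  have hJ₁ : 1 ≤ J := le_max_left _ _
  have hJN : J < 2 ^ J := Nat.lt_two_pow_self
  have hquot : J / epsInv d = accuracyExp d n := rfl
  have hjJ := two_mul_accuracyExp_lt d n
  have h2J : 2 ≤ 2 ^ J := by
    calc 2 = 2 ^ 1 := rfl
      _ ≤ 2 ^ J := Nat.pow_le_pow_right two_pos hJ₁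
  refine Runs.of_bdd fun hb => ?_
  refine Runs.mono (T₁ := (∑ _i ∈ range n, ((3 + 1) + 2) + 2 + (∑ _i ∈ range d, (1 + 2) + 2 +
    (∑ _i ∈ range (accuracyExp d n), (1 + 2) + 2 + (1 + 1 + 1 + 1 + 1 + 1 + 1) + 1 + 1 + 1) + 1)
    + 1 + 1 + 1 + 1 + 1)) ?_ ?_
  swap
  · simp only [sum_const, card_range, smul_eq_mul]
    omega
  refine Runs.cons_assign (fun _ => hb.arr _ _) (Runs.cons_assign (fun _ => hb.arr _ _)
    (Runs.cons_assign (fun _ => hb.arr _ _) (Runs.cons_assign (fun _ => ?_)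
    (Runs.cons_assign (fun _ => ?_) ?_))))
  · change 2 < 2 ^ B
    omega
  · change 1 < 2 ^ B
    omega
  simp only [Expr.eval_get, Expr.eval_zero, Expr.eval_one, Expr.eval_ofNat, State.arr_setReg,
    hd, hn, hr]
  refine Runs.cons (Q₁ := fun s' => s'.reg rN = 2 ^ J ∧ s'.reg rJ = J)
    -- After `i` rounds either the power has reached `n` or it is at least `i + 2`; so `n` rounds
    -- certainly suffice, and linear time is affordable.
    (Runs.forLoop n (fun i s' => ∃ j, 1 ≤ j ∧ j ≤ J ∧ s'.reg rN = 2 ^ j ∧ s'.reg rJ = j ∧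
      (n ≤ 2 ^ j ∨ i + 2 ≤ 2 ^ j)) _ (hn ▸ hb.arr _ _) (fun s' hs' => ?_) ?_
      (fun i hi s₁ hs₁ _ hI => ?_) fun s' _ _ hI => ?_) fun s₂ hs₂ _ hI₂ => ?_
  · exact (hs'.reg rn rfl).trans (by simp)
  · exact ⟨1, le_rfl, hJ₁, by simp, by simp, by simp⟩
  · obtain ⟨j, hj₁, hj₂, hN₁, hJ₁', hor⟩ := hI
    have hn₁ : s₁.reg rn = n := (hs₁.reg _ rfl).trans (by simp)
    refine Runs.ite (T := 3) (fun hlt => ?_) fun hle => ?_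
    · simp only [Expr.eval_sub, Expr.eval_reg, hn₁, hN₁] at hlt
      have hlt' : 2 ^ j < n := by omega
      -- Doubling happens only while `2 ^ j < n`, and then `j` is below the rounded-up logarithm.
      have hjJ' : j + 1 ≤ J := by
        by_contra hge
        have := (le_two_pow_sampleExp n).trans (Nat.pow_le_pow_right two_pos
          (show sampleExp n ≤ j by omega))
        omega
      have hp : 2 ^ (j + 1) ≤ 2 ^ J := Nat.pow_le_pow_right two_pos hjJ'
      have hp' : 2 ^ (j + 1) = 2 ^ j + 2 ^ j := by ring
      refine Runs.cons_assign (T := 2) (fun _ => ?_) (Runs.cons_assign (T := 1) (fun _ => ?_)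
        (Runs.nil ?_))
      · simp [hN₁]
        omega
      · simp [hJ₁']
        omega
      · refine ⟨j + 1, by omega, hjJ', by simp [hN₁, hp'], by simp [hJ₁'], ?_⟩
        have : 1 ≤ 2 ^ j := Nat.one_le_two_pow
        omega
    · simp only [Expr.eval_sub, Expr.eval_reg, hn₁, hN₁] at hle
      exact (Runs.skip ⟨j, hj₁, hj₂, by simpa using hN₁, by simpa using hJ₁', by omega⟩).mono
        (by norm_num)
  · obtain ⟨j, hj₁, hj₂, hN₁, hJ₁', hor⟩ := hI
    have : J ≤ j := max_le hj₁ ((Nat.clog_le_iff_le_pow one_lt_two).2 (by omega))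
    obtain rfl : j = J := by omega
    exact ⟨hN₁, hJ₁'⟩
  have hd₂ : s₂.reg rd = d := (hs₂.reg _ rfl).trans (by simp)
  have hn₂ : s₂.reg rn = n := (hs₂.reg _ rfl).trans (by simp)
  have hr₂ : s₂.reg rr = r := (hs₂.reg _ rfl).trans (by simp)
  have hE₀ : 2 ^ (d + 1) ≤ epsInv d := by
    unfold epsInv
    nlinarith [Nat.one_le_two_pow (n := d + 1)]
  refine Runs.cons_assign (fun _ => by change 2 < 2 ^ B; omega) ?_
  refine Runs.cons (Q₁ := fun s' => s'.reg rPow = 2 ^ (d + 1))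
    (Runs.forLoop d (fun i s' => s'.reg rPow = 2 ^ (i + 1)) (fun _ => 1) (hd ▸ hb.arr _ _)
      (fun s' hs' => ?_) (by simp) (fun i hi s₁ hs₁ _ hI => Runs.assign (fun _ => ?_) ?_)
      fun s' _ _ hI => hI) fun s₃ hs₃ _ hI₃ => ?_
  · exact (hs'.reg rd rfl).trans (by simp [hd₂])
  · have : 2 ^ (i + 1 + 1) ≤ 2 ^ (d + 1) := Nat.pow_le_pow_right two_pos (by omega)
    rw [pow_succ] at this
    simp [hI]
    omega
  · simp [hI]
    ring
  have hd₃ : s₃.reg rd = d := (hs₃.reg _ rfl).trans (by simp [hd₂])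
  have hJ₃ : s₃.reg rJ = J := (hs₃.reg _ rfl).trans (by simp [hI₂.2])
  have hEval : (Expr.reg rPow * (5 * .reg rd + 4) + 1).eval s₃ = epsInv d := by
    simp [hI₃, hd₃, epsInv]
  refine Runs.cons_assign (fun _ => by rw [hEval]; exact hE) ?_
  refine Runs.cons_assign (fun hb => lt_of_le_of_lt (Nat.div_le_self _ _) (hb.reg _)) ?_
  refine Runs.cons_assign (fun _ => by change 1 < 2 ^ B; omega) ?_
  rw [hEval]
  rw [Expr.eval_one]
  set s₄ := ((s₃.setReg rE (epsInv d)).setReg rQuot ((Expr.reg rJ / .reg rE).eval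
    (s₃.setReg rE (epsInv d)))).setReg rK 1 with hs₄
  have hq₄ : s₄.reg rQuot = accuracyExp d n := by
    simp [hs₄, hJ₃]
    rfl
  have hK₄ : s₄.reg rK = 1 := by simp [hs₄]
  have hpow : ∀ i ≤ 2 * accuracyExp d n + 1, 2 ^ i ≤ 2 ^ J := fun i hi =>
    Nat.pow_le_pow_right two_pos (hi.trans hjJ)
  refine Runs.mono (T₁ := (∑ _i ∈ range (accuracyExp d n), (1 + 2) + 2) +
    (1 + 1 + 1 + 1 + 1 + 1 + 1)) ?_ le_rfl
  refine Runs.cons (Q₁ := fun s' => s'.reg rK = 2 ^ accuracyExp d n)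
    (Runs.forLoop (accuracyExp d n) (fun i s' => s'.reg rK = 2 ^ i) (fun _ => 1) (by omega)
      (fun s' hs' => ?_) ?_ (fun i hi s₁ hs₁ _ hI => Runs.assign (fun _ => ?_) ?_)
      fun s' _ _ hI => hI) fun s₅ hs₅ _ hI₅ => ?_
  · exact (hs'.reg rQuot rfl).trans hq₄
  · simp [hK₄]
  · have := hpow (i + 1) (by omega)
    rw [pow_succ] at this
    simp [hI]
    omega
  · simp [hI]
    ring
  have hr₅ : s₅.reg rr = r := (hs₅.reg _ rfl).trans ((hs₃.reg _ rfl).trans (by simp [hr₂]))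
  have hn₅ : s₅.reg rn = n := (hs₅.reg _ rfl).trans ((hs₃.reg _ rfl).trans (by simp [hn₂]))
  have hN₅ : s₅.reg rN = 2 ^ J := (hs₅.reg _ rfl).trans ((hs₃.reg _ rfl).trans (by simp [hI₂.1]))
  have hJ₅ : s₅.reg rJ = J := (hs₅.reg _ rfl).trans hJ₃
  have hq₅ : s₅.reg rQuot = accuracyExp d n := (hs₅.reg _ rfl).trans hq₄
  set j := accuracyExp d n with hj
  have hgpow : 2 ^ j * 2 ^ j + 2 ^ j * 2 ^ j = 2 ^ (2 * j + 1) := by ring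
  have hgN := hpow (2 * j + 1) le_rfl
  have hdiv : 2 ^ J / 2 ^ (2 * j + 1) = 2 ^ (J - (2 * j + 1)) := Nat.pow_div hjJ two_pos
  have hdivle : 2 ^ (J - (2 * j + 1)) ≤ 2 ^ J := Nat.pow_le_pow_right two_pos (Nat.sub_le _ _)
  refine Runs.cons_assign (fun _ => ?_) (Runs.cons_assign (fun _ => ?_) (Runs.cons_assign
    (fun _ => ?_) (Runs.cons_assign (fun _ => ?_) (Runs.cons_assign (fun _ => ?_)
    (Runs.cons_assign (fun _ => ?_) (Runs.nil ?_))))))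
  · simp [hI₅]; omega
  · simp [hI₅]; omega
  · simp [hI₅, hr₅]; omega
  · simp [hI₅, hN₅, hgpow, hdiv]; omega
  · simp [hJ₅]; omega
  · change 1 < 2 ^ B; omega
  · refine ⟨?_, ?_, ?_, ?_, ?_, ?_, ?_, ?_, ?_, ?_⟩ <;> simp [hI₅, hr₅, hn₅, hN₅, hJ₅, hq₅]
    · ring
    · exact hj
    · ring
    · rw [hgpow, hdiv, two_mul]
    · rw [← hj]
      omega

/-! ### Reading the hyperedges -/

/-- The position of the hyperedge number `q` in the input. -/
def edgePos (el : ℕ → List ℕ) (q : ℕ) : ℕ := 3 + ∑ q' ∈ range q, ((el q').length + 1)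

/-- The input lists the vertices of the hyperedges `el 0, …, el (r - 1)`. -/
structure IsInput (w : ℕ → ℕ) (d n r : ℕ) (el : ℕ → List ℕ) : Prop where
  word_zero : w 0 = d
  word_one : w 1 = n
  word_two : w 2 = r
  word_pos : ∀ q < r, w (edgePos el q) = (el q).length
  word_vertex : ∀ q < r, ∀ i, (hi : i < (el q).length) → w (edgePos el q + 1 + i) = (el q)[i]
  nodup : ∀ q < r, (el q).Nodup
  lt : ∀ q < r, ∀ v ∈ el q, v < n

/-- Build the incidence lists and the incidence matrix. -/
def readEdges : Program := block [
  .assign rPos 3,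
  forLoop rEdge (.reg rr) (block [
    .store aStart (.reg rEdge) (.reg rPos),
    .assign rLen (.get aInput (.reg rPos)),
    .assign rPos (.reg rPos + 1),
    forLoop ri (.reg rLen) (block [
      .assign rVertex (.get aInput (.reg rPos + .reg ri)),
      .store aAdj (.reg rVertex * .reg rr + .get aDeg (.reg rVertex)) (.reg rEdge),
      .store aDeg (.reg rVertex) (.get aDeg (.reg rVertex) + 1),
      .store aInc (.reg rEdge * .reg rN + .reg rVertex) 1]),
    .assign rPos (.reg rPos + .reg rLen)])]

/-- The incidence lists and the incidence matrix after reading the hyperedges before `q` and `i`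
vertices of the hyperedge `q`. -/
structure ReadInv (s : State) (el : ℕ → List ℕ) (r N q i : ℕ) : Prop where
  deg : ∀ v, s.arr aDeg v = (incidentEdges (fun q => (el q).toFinset) q v ++
    if v ∈ (el q).take i then [q] else []).length
  adj : ∀ v j, (hj : j < (incidentEdges (fun q => (el q).toFinset) q v ++
    if v ∈ (el q).take i then [q] else []).length) →
    s.arr aAdj (v * r + j) = (incidentEdges (fun q => (el q).toFinset) q v ++
    if v ∈ (el q).take i then [q] else [])[j]
  inc : ∀ q', ∀ v < N, s.arr aInc (q' * N + v) =
    if q' < q ∧ v ∈ el q' ∨ q' = q ∧ v ∈ (el q).take i then 1 else 0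

theorem length_incidentEdges_le (e : ℕ → Finset ℕ) (r v : ℕ) :
    (incidentEdges e r v).length ≤ r := by
  exact (List.length_filter_le _ _).trans_eq List.length_range

theorem incidentEdges_succ (e : ℕ → Finset ℕ) (r v : ℕ) :
    incidentEdges e (r + 1) v = incidentEdges e r v ++ if v ∈ e r then [r] else [] := by
  rw [incidentEdges, List.range_succ, List.filter_append, incidentEdges]
  congr 1
  by_cases h : v ∈ e r <;> simp [h]

theorem mul_add_inj {N a b x y : ℕ} (hx : x < N) (hy : y < N) (h : a * N + x = b * N + y) :
    a = b ∧ x = y := by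
  have h₁ : (a * N + x) / N = (b * N + y) / N := by rw [h]
  have h₂ : (a * N + x) % N = (b * N + y) % N := by rw [h]
  rw [Nat.mul_comm a, Nat.mul_comm b, Nat.mul_add_div (by omega), Nat.mul_add_div (by omega),
    Nat.div_eq_of_lt hx, Nat.div_eq_of_lt hy] at h₁
  rw [Nat.mul_comm a, Nat.mul_comm b, Nat.mul_add_mod, Nat.mul_add_mod, Nat.mod_eq_of_lt hx,
    Nat.mod_eq_of_lt hy] at h₂
  exact ⟨h₁, h₂⟩

theorem ReadInv.next {el : ℕ → List ℕ} {N q : ℕ} (h : ReadInv s el r N q (el q).length) :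
    ReadInv s el r N (q + 1) 0 := by
  have hl : ∀ v, (incidentEdges (fun q => (el q).toFinset) q v ++
      if v ∈ (el q).take (el q).length then [q] else []) =
      (incidentEdges (fun q => (el q).toFinset) (q + 1) v ++
      if v ∈ (el (q + 1)).take 0 then [q + 1] else []) := by
    intro v
    rw [incidentEdges_succ]
    simp
  refine ⟨fun v => ?_, fun v j hj => ?_, fun q' v hv => ?_⟩
  · rw [← hl]
    exact h.deg v
  · simp only [← hl] at hj ⊢
    exact h.adj v j hj
  · rw [h.inc q' v hv]
    refine if_congr ?_ rfl rfl
    simp only [List.take_length, List.take_zero, List.not_mem_nil, and_false, or_false,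
      Nat.lt_succ_iff_lt_or_eq, or_and_right]
    constructor
    · rintro (h₁ | ⟨h₁, h₂⟩)
      exacts [.inl h₁, .inr ⟨h₁, h₁ ▸ h₂⟩]
    · rintro (h₁ | ⟨h₁, h₂⟩)
      exacts [.inl h₁, .inr ⟨h₁, h₁ ▸ h₂⟩]

/-- The hyperedges are read in order, so appending `q` to the list of a vertex keeps it increasing.
The list of `v` occupies a row of `r` cells. -/
theorem ReadInv.step {el : ℕ → List ℕ} {N q i : ℕ} (h : ReadInv s el r N q i)
    (hi : i < (el q).length) (hq : q < r) (hnd : (el q).Nodup) (hlt : (el q)[i] < N)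
    (hdeg : s'.arr aDeg = Function.update (s.arr aDeg) (el q)[i] (s.arr aDeg (el q)[i] + 1))
    (hadj : s'.arr aAdj = Function.update (s.arr aAdj) ((el q)[i] * r + s.arr aDeg (el q)[i]) q)
    (hinc : s'.arr aInc = Function.update (s.arr aInc) (q * N + (el q)[i]) 1) :
    ReadInv s' el r N q (i + 1) := by
  set v₀ := (el q)[i] with hv₀
  have hnot : v₀ ∉ (el q).take i := by
    intro hmem
    obtain ⟨j, hj, heq⟩ := List.mem_iff_getElem.1 hmem
    rw [List.length_take] at hj
    rw [List.getElem_take] at heq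
    have := hnd.getElem_inj_iff.1 heq
    omega
  have hmem : ∀ v, v ∈ (el q).take (i + 1) ↔ v ∈ (el q).take i ∨ v = v₀ := by
    intro v
    rw [List.take_add_one, List.mem_append, List.getElem?_eq_getElem hi, Option.toList_some,
      List.mem_singleton]
  have hl₀ : (incidentEdges (fun q => (el q).toFinset) q v₀ ++
      if v₀ ∈ (el q).take (i + 1) then [q] else []) =
      incidentEdges (fun q => (el q).toFinset) q v₀ ++ [q] := by
    rw [if_pos ((hmem _).2 (.inr rfl))]
  have hl₀' : (incidentEdges (fun q => (el q).toFinset) q v₀ ++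
      if v₀ ∈ (el q).take i then [q] else []) =
      incidentEdges (fun q => (el q).toFinset) q v₀ := by
    rw [if_neg hnot, List.append_nil]
  have hl₁ : ∀ v, v ≠ v₀ → (incidentEdges (fun q => (el q).toFinset) q v ++
      if v ∈ (el q).take (i + 1) then [q] else []) =
      (incidentEdges (fun q => (el q).toFinset) q v ++
      if v ∈ (el q).take i then [q] else []) := by
    intro v hv
    simp only [hmem, hv, or_false]
  have hlen : ∀ v, (incidentEdges (fun q => (el q).toFinset) q v ++
      if v ∈ (el q).take i then [q] else []).length ≤ r := by
    intro v
    have := length_incidentEdges_le (fun q => (el q).toFinset) q v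
    rw [List.length_append]
    split <;> simp <;> omega
  have hd₀ : s.arr aDeg v₀ = (incidentEdges (fun q => (el q).toFinset) q v₀).length := by
    rw [h.deg, hl₀']
  -- As `v₀` has not yet occurred in hyperedge `q`, the cell written is still inside the row of
  -- `v₀`.
  have hd₁ : s.arr aDeg v₀ ≤ q := hd₀ ▸ length_incidentEdges_le _ _ _
  refine ⟨fun v => ?_, fun v j hj => ?_, fun q' v hv => ?_⟩
  · rw [hdeg]
    rcases eq_or_ne v v₀ with rfl | hv
    · rw [Function.update_self, hl₀, List.length_append, hd₀, List.length_singleton]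
    · rw [Function.update_of_ne hv, hl₁ v hv, h.deg]
  · rw [hadj]
    rcases eq_or_ne v v₀ with rfl | hv
    · simp only [hl₀] at hj ⊢
      rw [List.length_append, List.length_singleton] at hj
      rcases Nat.lt_or_ge j (s.arr aDeg v₀) with hlt' | hge
      · rw [Function.update_of_ne (by omega), List.getElem_append_left (by omega)]
        have := h.adj v₀ j (by rw [hl₀']; omega)
        simp only [hl₀'] at this
        exact this
      · obtain rfl : j = s.arr aDeg v₀ := by omega
        rw [Function.update_self, List.getElem_append_right (by omega)]
        simp
    · simp only [hl₁ v hv] at hj ⊢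
      rw [Function.update_of_ne]
      · exact h.adj v j hj
      · intro heq
        exact hv (mul_add_inj (hj.trans_le (hlen v)) (by omega) heq).1
  · rw [hinc]
    by_cases heq : q' * N + v = q * N + v₀
    · obtain ⟨rfl, rfl⟩ := mul_add_inj hv hlt heq
      rw [Function.update_self, if_pos (.inr ⟨rfl, (hmem _).2 (.inr rfl)⟩)]
    · rw [Function.update_of_ne heq, h.inc q' v hv]
      refine if_congr ?_ rfl rfl
      rw [hmem]
      constructor
      · rintro (h | ⟨h₁, h₂⟩)
        exacts [.inl h, .inr ⟨h₁, .inl h₂⟩]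
      · rintro (h | ⟨h₁, h₂ | h₂⟩)
        · exact .inl h
        · exact .inr ⟨h₁, h₂⟩
        · exact absurd (by rw [h₁, h₂]) heq

theorem edgePos_succ (el : ℕ → List ℕ) (q : ℕ) :
    edgePos el (q + 1) = edgePos el q + 1 + (el q).length := by
  rw [edgePos, sum_range_succ, edgePos]
  omega

theorem edgePos_mono (el : ℕ → List ℕ) {q q' : ℕ} (h : q ≤ q') : edgePos el q ≤ edgePos el q' :=
  Nat.add_le_add_left (sum_le_sum_of_subset (by simpa using h)) _

theorem runs_readEdges {w : ℕ → ℕ} {el : ℕ → List ℕ} (hw : IsInput w d n r el)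
    (hs : s.arr aInput = w) (hr : s.reg rr = r) (hN : n ≤ s.reg rN)
    (hdeg : ∀ v, s.arr aDeg v = 0) (hinc : ∀ i, s.arr aInc i = 0)
    (hpos : edgePos el r < 2 ^ B) :
    Runs B readEdges s (∑ q ∈ range r, (7 * (el q).length + 12) + 10) fun s' =>
      (∀ q < r, s'.arr aStart q = edgePos el q) ∧
      HasAdj s' (fun q => (el q).toFinset) r ∧ HasInc s' (fun q => (el q).toFinset) r := by
  set N := s.reg rN with hNdef
  refine Runs.of_bdd fun hb => ?_
  have h3 : 3 ≤ edgePos el r := Nat.le_add_right _ _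
  have hrB : r < 2 ^ B := hr ▸ hb.reg _
  refine Runs.mono (T₁ := (∑ q ∈ range r,
    ((∑ _i ∈ range (el q).length, ((1 + 1 + 1 + 1 + 1) + 2) + 2 + (1 + 1)) + 1 + 1 + 1 + 2) + 2 + 1) + 1) ?_ ?_
  swap
  · have : ∑ q ∈ range r, ((∑ _i ∈ range (el q).length, ((1 + 1 + 1 + 1 + 1) + 2) + 2 + (1 + 1)) +
        1 + 1 + 1 + 2) ≤ ∑ q ∈ range r, (7 * (el q).length + 12) := sum_le_sum fun q _ => by
      simp only [sum_const, card_range, smul_eq_mul]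
      omega
    omega
  refine Runs.cons_assign (fun _ => lt_of_le_of_lt h3 hpos) ?_
  rw [Expr.eval_ofNat]
  refine Runs.cons (T₂ := 1) (Q₁ := fun s' => (∀ q < r, s'.arr aStart q = edgePos el q) ∧
      ReadInv s' el r N r 0)
    (Runs.forLoop r (fun q s' => s'.reg rPos = edgePos el q ∧
      (∀ q' < q, s'.arr aStart q' = edgePos el q') ∧ ReadInv s' el r N q 0) _ hrB
      (fun s' hs' => (hs'.reg _ rfl).trans (by simp [hr])) ?_
      (fun q hq s₁ hs₁ hq₁ hI => ?_) fun s' _ _ hI => hI.2) fun s₂ hs₂ _ hI₂ => Runs.nil ?_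
  · refine ⟨by simp [edgePos], by simp, fun v => ?_, fun v j hj => ?_, fun q' v hv => ?_⟩
    · simp [hdeg, incidentEdges]
    · simp [incidentEdges] at hj
    · simp [hinc]
  · obtain ⟨hpos₁, hst₁, hR₁⟩ := hI
    have hr₁ : s₁.reg rr = r := (hs₁.reg _ rfl).trans (by simp [hr])
    have hN₁ : s₁.reg rN = N := (hs₁.reg _ rfl).trans (by simp [hNdef])
    have hw₁ : s₁.arr aInput = w := (hs₁.arr _ rfl).trans (by simp [hs])
    have hposq : edgePos el q + 1 + (el q).length < 2 ^ B := by
      rw [← edgePos_succ]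
      exact lt_of_le_of_lt (edgePos_mono el hq) hpos
    refine Runs.cons_store (fun hb => hb.reg _) (Runs.cons_assign (fun hb => hb.arr _ _)
      (Runs.cons_assign (fun _ => ?_) ?_))
    · simp [hpos₁]
      omega
    have hlen : s₁.arr aInput (edgePos el q) = (el q).length := by rw [hw₁, hw.word_pos q hq]
    simp only [Expr.eval_add, Expr.eval_reg, Expr.eval_get, Expr.eval_one, State.reg_setArr,
      State.reg_setReg, State.arr_setReg, State.arr_setArr,
      if_neg (show ¬aInput = aStart by decide),
      if_neg (show ¬rPos = rLen by decide), hlen, hpos₁, hq₁]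
    set s₂ := ((s₁.setArr aStart q (edgePos el q)).setReg rLen (el q).length).setReg rPos
      (edgePos el q + 1) with hs₂
    refine Runs.cons (T₂ := 1 + 1) (Q₁ := fun s' => ReadInv s' el r N q (el q).length)
      (Runs.forLoop (el q).length (fun i s' => ReadInv s' el r N q i) _ (by omega)
      (fun s' hs' => (hs'.reg _ rfl).trans (by simp [hs₂])) ⟨hR₁.deg, hR₁.adj, hR₁.inc⟩
      (fun i hi s₃ hs₃ hi₃ hI₃ => ?_) fun s' _ _ hI' => hI') fun s₄ hs₄ _ hI₄ => ?_
    · have hpos₃ : s₃.reg rPos = edgePos el q + 1 := (hs₃.reg _ rfl).trans (by simp [hs₂])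
      have hr₃ : s₃.reg rr = r := (hs₃.reg _ rfl).trans (by simp [hs₂, hr₁])
      have hN₃ : s₃.reg rN = N := (hs₃.reg _ rfl).trans (by simp [hs₂, hN₁])
      have hq₃ : s₃.reg rEdge = q := (hs₃.reg _ rfl).trans (by simp [hs₂, hq₁])
      have hw₃ : s₃.arr aInput = w := (hs₃.arr _ rfl).trans (by simp [hs₂, hw₁])
      have hv : (Expr.get aInput (.reg rPos + .reg ri)).eval s₃ = (el q)[i] := by
        simp [hw₃, hpos₃, hi₃, hw.word_vertex q hq i hi]
      have hdeg₃ : s₃.arr aDeg (el q)[i] ≤ r := by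
        rw [hI₃.deg]
        have := length_incidentEdges_le (fun q => (el q).toFinset) q (el q)[i]
        rw [List.length_append]
        split <;> simp <;> omega
      -- Every hyperedge occupies at least the cell with its length, so the input positions already
      -- exceed `r`.
      have hdeg₃' : r + 1 < 2 ^ B := by
        have h₁ : r ≤ ∑ q' ∈ range r, ((el q').length + 1) := by
          simp [sum_add_distrib]
        unfold edgePos at hpos
        omega
      refine Runs.cons_assign (fun hb => hb.arr _ _) (Runs.cons_store (fun hb => hb.reg _)
        (Runs.cons_store (fun _ => ?_) (Runs.cons_store (fun _ => ?_) (Runs.nil ?_))))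
      · rw [hv]
        simp
        omega
      · change 1 < 2 ^ B
        omega
      · rw [hv]
        refine hI₃.step hi hq (hw.nodup q hq)
          (lt_of_lt_of_le (hw.lt q hq _ (List.getElem_mem hi)) hN) ?_ ?_ ?_ <;>
          simp [hr₃, hN₃, hq₃]
    · have hpos₄ : s₄.reg rPos = edgePos el q + 1 := (hs₄.reg _ rfl).trans (by simp [hs₂])
      have hlen₄ : s₄.reg rLen = (el q).length := (hs₄.reg _ rfl).trans (by simp [hs₂])
      refine Runs.cons_assign (T := 1) (fun _ => ?_) (Runs.nil ?_)
      · simp [hpos₄, hlen₄]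
        omega
      · have hN' := hI₄.next
        refine ⟨?_, fun q' hq' => ?_, hN'.deg, hN'.adj, hN'.inc⟩
        · simp [hpos₄, hlen₄, edgePos_succ]
        · simp only [State.arr_setReg]
          rw [hs₄.arr aStart rfl]
          rcases eq_or_ne q' q with rfl | hne
          · simp [hs₂]
          · simpa [hs₂, hne] using hst₁ q' (by omega)
  · obtain ⟨hst₂, hR₂⟩ := hI₂
    have hr₂ : s₂.reg rr = r := (hs₂.reg _ rfl).trans (by simp [hr])
    have hN₂ : s₂.reg rN = N := (hs₂.reg _ rfl).trans (by simp [hNdef])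
    refine ⟨hst₂, ⟨hr₂, fun v => ?_, fun v j hj => ?_⟩, fun q hq v hv => ?_⟩
    · simpa using hR₂.deg v
    · simpa [hj] using hR₂.adj v j (by simpa using hj)
    · rw [hN₂] at hv ⊢
      simpa [hq] using hR₂.inc q v hv

/-! ### The initial sample, padded to a power of two -/

/-- Put all vertices into the sample. -/
def initSample : Program := forLoop ri (.reg rN) (.store aSample (.reg ri) (.reg ri))

/-- In the application `s.reg rN` is the padded size. The numbers from `n` on are vertices of no
hyperedge, so they affect neither degrees nor differences. -/
theorem runs_initSample (hs : ∀ i, s.arr aSample i = 0) :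
    Runs B initSample s (3 * s.reg rN + 2) fun s' =>
      (∀ i < s.reg rN, s'.arr aSample i = i) ∧ ∀ i, s.reg rN ≤ i → s'.arr aSample i = 0 := by
  refine Runs.of_bdd fun hb => ?_
  refine Runs.mono (T₁ := ∑ _i ∈ range (s.reg rN), (1 + 2) + 2) ?_ (by simp; omega)
  refine Runs.forLoop (s.reg rN) (fun k s' => (∀ i < k, s'.arr aSample i = i) ∧
    ∀ i, k ≤ i → s'.arr aSample i = 0) _ (hb.reg _) (fun s' hs' => hs'.reg _ rfl)
    ⟨by simp, fun i _ => hs i⟩ (fun k hk s₁ hs₁ hk₁ hI => Runs.store (fun hb => hb.reg _) ?_)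
    fun s' _ _ hI => hI
  simp only [Expr.eval_reg, hk₁, State.arr_setReg, State.arr_setArr, if_true]
  refine ⟨fun i hi => ?_, fun i hi => ?_⟩
  · rcases eq_or_ne i k with rfl | hne
    · simp
    · simpa [hne] using hI.1 i (by omega)
  · have : i ≠ k := by omega
    simpa [this] using hI.2 i (by omega)

notation "rOld" => (38 : ℕ)
notation "rClass" => (39 : ℕ)

notation "aSeen" => (13 : ℕ)
notation "aCount" => (14 : ℕ)
notation "aBucket" => (15 : ℕ)

/-! ### Classes of vertices -/

/-- Choose one hyperedge for every node of the trie, and build the trie of the sets of the chosen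
hyperedges containing a vertex. The vertex `v` is the item `r + v`. -/
def buildClasses : Program := block [
  .assign rOld (.reg rRoot),
  .assign rRoot (.reg rT),
  .assign rT (.reg rT + 1),
  forLoop rEdge (.reg rr) (block [
    .assign rClass (.get aCur (.reg rEdge)),
    .ite (.reg rOld - .reg rClass) (.assign rClass (.reg rOld)) .skip,
    .ite (.get aSeen (.reg rClass)) .skip (block [
      .store aSeen (.reg rClass) 1,
      .assign rKey (.reg rEdge),
      .assign rPos (.get aStart (.reg rEdge)),
      forLoop ri (.get aInput (.reg rPos)) (block [
        .assign rItem (.reg rr + .get aInput (.reg rPos + 1 + .reg ri)),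
        insertKey])])])]

/-- The set of the hyperedges in `S` that contain the vertex `y - r`. -/
def classTrace (e : ℕ → Finset ℕ) (r : ℕ) (S : Finset ℕ) (y : ℕ) : Finset ℕ :=
  if r ≤ y then S.filter fun q => y - r ∈ e q else ∅

/-- The traces after inserting the hyperedge `q` for the vertices in `l`. -/
def partialClassTrace (e : ℕ → Finset ℕ) (r : ℕ) (S : Finset ℕ) (q : ℕ) (l : List ℕ) (y : ℕ) :
    Finset ℕ :=
  classTrace e r S y ∪ if r ≤ y ∧ y - r ∈ l then {q} else ∅

variable {B : ℕ} {s s' : State} {d n r : ℕ} {el : ℕ → List ℕ} {S : Finset ℕ} {q : ℕ}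

theorem partialClassTrace_nil (e : ℕ → Finset ℕ) :
    partialClassTrace e r S q [] = classTrace e r S := by
  funext y
  simp [partialClassTrace]

theorem partialClassTrace_append (e : ℕ → Finset ℕ) (l : List ℕ) (v : ℕ) :
    partialClassTrace e r S q (l ++ [v]) =
      Function.update (partialClassTrace e r S q l) (r + v)
        (insert q (partialClassTrace e r S q l (r + v))) := by
  funext y
  rcases eq_or_ne y (r + v) with rfl | hy
  · ext k
    simp only [Function.update_self, partialClassTrace, mem_union, mem_insert]
    have : r ≤ r + v ∧ r + v - r ∈ l ++ [v] := by simp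
    rw [if_pos this]
    split <;> simp <;> tauto
  · rw [Function.update_of_ne hy, partialClassTrace, partialClassTrace]
    congr 1
    refine if_congr ?_ rfl rfl
    rw [List.mem_append, List.mem_singleton]
    constructor
    · rintro ⟨h₁, h₂ | h₂⟩
      · exact ⟨h₁, h₂⟩
      · omega
    · rintro ⟨h₁, h₂⟩
      exact ⟨h₁, .inl h₂⟩

theorem partialClassTrace_toFinset :
    partialClassTrace (fun q => (el q).toFinset) r S q (el q) =
      classTrace (fun q => (el q).toFinset) r (insert q S) := by
  funext y
  unfold partialClassTrace classTrace
  by_cases hy : r ≤ y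
  · simp only [hy, if_true, true_and, List.mem_toFinset]
    rw [filter_insert]
    split
    · rw [insert_eq, union_comm]
    · simp
  · simp [hy]

/-- The hyperedges selected among those before `q`, one for every value of `X`. -/
structure Selects (X seen : ℕ → ℕ) (S : Finset ℕ) (q : ℕ) : Prop where
  subset : S ⊆ range q
  inj : Set.InjOn X S
  cover : ∀ q' < q, ∃ p ∈ S, X p = X q'
  seen_eq : ∀ x, seen x = 0 ↔ ∀ p ∈ S, X p ≠ x

theorem Selects.old {X seen : ℕ → ℕ} (h : Selects X seen S q) (hqs : seen (X q) ≠ 0) :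
    Selects X seen S (q + 1) := by
  refine ⟨h.subset.trans (range_mono q.le_succ), h.inj, fun q' hq' => ?_, h.seen_eq⟩
  rcases Nat.lt_succ_iff_lt_or_eq.1 hq' with h₁ | rfl
  · exact h.cover q' h₁
  · rw [Ne, h.seen_eq] at hqs
    push Not at hqs
    exact hqs

theorem Selects.new {X seen : ℕ → ℕ} (h : Selects X seen S q) (hq : seen (X q) = 0) :
    Selects X (Function.update seen (X q) 1) (insert q S) (q + 1) := by
  rw [h.seen_eq] at hq
  refine ⟨?_, ?_, fun q' hq' => ?_, fun x => ?_⟩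
  · exact insert_subset (by simp) (h.subset.trans (range_mono q.le_succ))
  · rw [coe_insert, Set.injOn_insert fun hmem => hq q hmem rfl]
    refine ⟨h.inj, ?_⟩
    rintro ⟨p, hp, hpq⟩
    exact hq p hp hpq
  · rcases Nat.lt_succ_iff_lt_or_eq.1 hq' with h₁ | rfl
    · obtain ⟨p, hp, hpq⟩ := h.cover q' h₁
      exact ⟨p, mem_insert_of_mem hp, hpq⟩
    · exact ⟨q', mem_insert_self _ _, rfl⟩
  · rcases eq_or_ne x (X q) with rfl | hx
    · simp
    · rw [Function.update_of_ne hx, h.seen_eq]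
      simp only [mem_insert, forall_eq_or_imp]
      exact ⟨fun h₁ => ⟨hx.symm, h₁⟩, fun h₁ => h₁.2⟩

/-- The first hyperedge met at each node of the old trie is selected; selected hyperedges sit at
distinct nodes, which bounds `#S`. Their numbers increase and serve as keys of a second trie whose
nodes are the classes of vertices. Only selected hyperedges are read, each once, so there are at
most as many insertions as incidences. -/
theorem runs_buildClasses {w : ℕ → ℕ} {σ tr : ℕ → Finset ℕ} (htrie : IsTrie s σ tr)
    (hw : IsInput w d n r el) (hs : s.arr aInput = w) (hr : s.reg rr = r)
    (hstart : ∀ q < r, s.arr aStart q = edgePos el q) (hseen : ∀ x, s.arr aSeen x = 0)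
    (hstride : r ≤ s.reg rStride) (hn : r + n < 2 ^ B)
    (hT : s.reg rT + ∑ q ∈ range r, (el q).length + 1 < 2 ^ B) :
    Runs B buildClasses s (∑ q ∈ range r, (16 * (el q).length + 14) + 10) fun s' =>
      s'.reg rT ≤ s.reg rT + ∑ q ∈ range r, (el q).length + 1 ∧
      ∃ S ⊆ range r, #S ≤ s.reg rT - s.reg rRoot ∧ (∀ q < r, ∃ p ∈ S, tr p = tr q) ∧
        ∃ σ', IsTrie s' σ' (classTrace (fun q => (el q).toFinset) r S) := by
  set e : ℕ → Finset ℕ := fun q => (el q).toFinset with he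
  set m : ℕ → ℕ := fun q => ∑ q' ∈ range q, (el q').length with hm
  set X : ℕ → ℕ := fun q => max (s.arr aCur q) (s.reg rRoot) with hX
  have hm_succ : ∀ q, m (q + 1) = m q + (el q).length := fun q => sum_range_succ _ _
  have hm_le : ∀ q ≤ r, m q ≤ m r := fun q hq =>
    sum_le_sum_of_subset (by simpa using hq)
  refine Runs.of_bdd fun hb => ?_
  have hrB : r < 2 ^ B := by omega
  refine Runs.mono (T₁ := (∑ q ∈ range r, ((((1 + 1) + ((((∑ _i ∈ range (el q).length,
    ((12 + 1 + 1) + 2) + 2) + 1) + 1 + 1 + 1 + 1) + 1)) + 1) + 2) + 2 + 1) + 1 + 1 + 1) ?_ ?_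
  swap
  · have : ∑ q ∈ range r, ((((1 + 1) + ((((∑ _i ∈ range (el q).length, ((12 + 1 + 1) + 2) + 2) +
        1) + 1 + 1 + 1 + 1) + 1)) + 1) + 2) ≤ ∑ q ∈ range r, (16 * (el q).length + 14) :=
      sum_le_sum fun q _ => by
        simp only [sum_const, card_range, smul_eq_mul]
        omega
    omega
  refine Runs.cons_assign (fun hb => hb.reg _) (Runs.cons_assign (fun hb => hb.reg _)
    (Runs.cons_assign (fun _ => ?_) ?_))
  · simp
    omega
  simp only [Expr.eval_reg, Expr.eval_add, Expr.eval_one, State.reg_setReg,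
    if_neg (show ¬rT = rOld by decide), if_neg (show ¬rT = rRoot by decide)]
  set s₁ := ((s.setReg rOld (s.reg rRoot)).setReg rRoot (s.reg rT)).setReg rT (s.reg rT + 1)
    with hs₁
  refine Runs.cons (T₂ := 1) (Q₁ := fun s' => s'.reg rT ≤ s.reg rT + 1 + m r ∧
      ∃ S, Selects X (s'.arr aSeen) S r ∧ ∃ σ', IsTrie s' σ' (classTrace e r S))
    -- Vertices are items from `r` on, so the second trie does not disturb the nodes of the
    -- hyperedges in the first, which are still to be consulted.
    (Runs.forLoop r (fun q s' => (∀ y < r, s'.arr aCur y = s.arr aCur y) ∧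
      s'.reg rT ≤ s.reg rT + 1 + m q ∧
      ∃ S, Selects X (s'.arr aSeen) S q ∧ ∃ σ', IsTrie s' σ' (classTrace e r S)) _ hrB
      (fun s' hs' => (hs'.reg _ rfl).trans (by simp [hs₁, hr])) ?_
      (fun q hq s₂ hs₂ hq₂ hI => ?_) fun s' _ _ hI => hI.2) fun s₃ hs₃ _ hI₃ => Runs.nil ?_
  · refine ⟨fun _ _ => rfl, by simp [hs₁, hm], ∅, ⟨by simp, by simp, by simp, by simp [hs₁, hseen]⟩,
      fun _ => ∅, ?_⟩
    have := Trie.init (htrie.root_pos.trans htrie.root_lt) htrie.cur_lt htrie.fresh htrie.lim_fresh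
      (rep := s.arr aRep)
    have h₀ : classTrace e r ∅ = fun _ => ∅ := by funext y; simp [classTrace]
    rw [h₀]
    simpa [IsTrie, hs₁] using this
  · obtain ⟨hcur₂, hT₂, S, hS, σ₂, htrie₂⟩ := hI
    have hold₂ : s₂.reg rOld = s.reg rRoot := (hs₂.reg _ rfl).trans (by simp [hs₁])
    have hr₂ : s₂.reg rr = r := (hs₂.reg _ rfl).trans (by simp [hs₁, hr])
    have hstr₂ : s₂.reg rStride = s.reg rStride := (hs₂.reg _ rfl).trans (by simp [hs₁])
    have hstart₂ : s₂.arr aStart = s.arr aStart := hs₂.arr _ rfl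
    have hw₂ : s₂.arr aInput = w := (hs₂.arr _ rfl).trans hs
    refine Runs.cons_assign (fun hb => hb.arr _ _) ?_
    simp only [Expr.eval_get, Expr.eval_reg, hq₂, hcur₂ q hq]
    refine Runs.cons (Q₁ := fun s' => s' = s₂.setReg rClass (X q)) (Runs.ite (fun h₁ => ?_)
      fun h₁ => ?_) fun s₃ _ _ hs₃ => ?_
    · refine Runs.assign (fun hb => hb.reg _) ?_
      simp only [Expr.eval_sub, Expr.eval_reg, State.reg_setReg] at h₁ ⊢
      have : X q = s.reg rRoot := max_eq_right (by simp [hold₂] at h₁; omega)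
      rw [this]
      simp [State.setReg, hold₂]
    · refine Runs.skip ?_
      simp only [Expr.eval_sub, Expr.eval_reg, State.reg_setReg] at h₁ ⊢
      have : X q = s.arr aCur q := max_eq_left (by simp [hold₂] at h₁; omega)
      rw [this]
    subst hs₃
    refine Runs.cons (T₂ := 1) (Q₁ := fun s' => (∀ y < r, s'.arr aCur y = s.arr aCur y) ∧
      s'.reg rT ≤ s.reg rT + 1 + m (q + 1) ∧
      ∃ S, Selects X (s'.arr aSeen) S (q + 1) ∧ ∃ σ', IsTrie s' σ' (classTrace e r S))
      (Runs.ite (fun h₁ => ?_) fun h₁ => ?_) fun s₄ _ _ hI₄ => Runs.nil ?_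
    · refine (Runs.skip ?_).mono (by omega)
      simp at h₁
      exact ⟨hcur₂, by simp [hm_succ]; omega, S, hS.old h₁, σ₂, htrie₂⟩
    · simp at h₁
      refine Runs.cons_store (fun _ => ?_) (Runs.cons_assign (fun hb => hb.reg _)
        (Runs.cons_assign (fun hb => hb.arr _ _) ?_))
      · have := htrie.root_pos
        have := htrie.root_lt
        change 1 < 2 ^ B
        omega
      simp only [Expr.eval_get, Expr.eval_reg, Expr.eval_one, State.reg_setReg, State.reg_setArr,
        State.arr_setReg, State.arr_setArr, if_true, if_neg (show ¬rEdge = rClass by decide),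
        if_neg (show ¬rEdge = rKey by decide), if_neg (show ¬aStart = aSeen by decide), hq₂,
        hstart₂, hstart q hq]
      set s₄ := (((s₂.setReg rClass (X q)).setArr aSeen (X q) 1).setReg rKey q).setReg rPos
        (edgePos el q) with hs₄
      have hseen₄ : s₄.arr aSeen = Function.update (s₂.arr aSeen) (X q) 1 := by simp [hs₄]
      refine Runs.cons (T₂ := 1) (Q₁ := fun s' => (∀ y < r, s'.arr aCur y = s.arr aCur y) ∧
        s'.reg rT ≤ s.reg rT + 1 + m (q + 1) ∧
        ∃ σ', IsTrie s' σ' (partialClassTrace e r S q ((el q).take (el q).length)))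
        (Runs.forLoop (el q).length (fun i s' => (∀ y < r, s'.arr aCur y = s.arr aCur y) ∧
          s'.reg rT ≤ s.reg rT + 1 + m q + i ∧
          ∃ σ', IsTrie s' σ' (partialClassTrace e r S q ((el q).take i))) _ ?_
          (fun s' hs' => ?_) ?_ (fun i hi s₅ hs₅ hi₅ hI₅ => ?_) fun s' _ _ hI' => ?_)
        fun s₆ hs₆ _ hI₆ => Runs.nil ?_
      · have := hm_le (q + 1) hq
        rw [hm_succ] at this
        change s.reg rT + m r + 1 < 2 ^ B at hT
        omega
      · have h₂ : s'.reg rPos = edgePos el q := (hs'.reg _ rfl).trans (by simp [hs₄])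
        have h₃ : s'.arr aInput = w := (hs'.arr _ rfl).trans (by simp [hs₄, hw₂])
        simp [h₂, h₃, hw.word_pos q hq]
      · refine ⟨fun y hy => ?_, ?_, σ₂, ?_⟩
        · simpa [hs₄] using hcur₂ y hy
        · simpa [hs₄] using hT₂
        · rw [List.take_zero, partialClassTrace_nil]
          simpa [IsTrie, hs₄] using htrie₂
      · obtain ⟨hcur₅, hT₅, σ₅, htrie₅⟩ := hI₅
        have hpos₅ : s₅.reg rPos = edgePos el q := (hs₅.reg _ rfl).trans (by simp [hs₄])
        have hkey₅ : s₅.reg rKey = q := (hs₅.reg _ rfl).trans (by simp [hs₄])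
        have hr₅ : s₅.reg rr = r := (hs₅.reg _ rfl).trans (by simp [hs₄, hr₂])
        have hstr₅ : s₅.reg rStride = s.reg rStride := (hs₅.reg _ rfl).trans (by simp [hs₄, hstr₂])
        have hw₅ : s₅.arr aInput = w := (hs₅.arr _ rfl).trans (by simp [hs₄, hw₂])
        have hvn : (el q)[i] < n := hw.lt q hq _ (List.getElem_mem hi)
        have hitem : (Expr.reg rr + .get aInput (.reg rPos + 1 + .reg ri)).eval s₅ =
            r + (el q)[i] := by
          simp [hr₅, hw₅, hpos₅, hi₅, hw.word_vertex q hq i hi]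
        refine Runs.cons_assign (fun _ => by rw [hitem]; omega) ?_
        rw [hitem]
        have hmq := hm_le (q + 1) hq
        rw [hm_succ] at hmq
        change s.reg rT + m r + 1 < 2 ^ B at hT
        have hmem : (el q)[i] ∉ (el q).take i := by
          intro hmem
          obtain ⟨j, hj, hj'⟩ := List.mem_take_iff_getElem.1 hmem
          have := (hw.nodup q hq).getElem_inj_iff.1 hj'
          omega
        set s₆ := s₅.setReg rItem (r + (el q)[i]) with hs₆
        have htrie₆ : IsTrie s₆ σ₅ (partialClassTrace e r S q ((el q).take i)) := by
          simpa [IsTrie, hs₆] using htrie₅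
        have hins := runs_insertKey (B := B) htrie₆ (by simp [hs₆, hkey₅, hstr₅]; omega) ?_
          (by simp [hs₆]; omega)
        · refine Runs.cons (T₂ := 1) hins fun s₇ hs₇ _ hI₇ => Runs.nil ?_
          obtain ⟨hT₇, hcur₇, σ₇, htrie₇⟩ := hI₇
          refine ⟨fun y hy => ?_, ?_, σ₇, ?_⟩
          · have := hcur₇ y (by simp [hs₆]; omega)
            simpa [hs₆, hcur₅ y hy] using this
          · simp [hs₆] at hT₇ ⊢
            omega
          · rw [List.take_add_one, List.getElem?_eq_getElem hi, Option.toList_some,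
              partialClassTrace_append]
            simpa [IsTrie, hs₆, hkey₅] using htrie₇
        · intro j hj
          simp only [hs₆, State.reg_setReg, if_true, if_neg (show ¬rKey = rItem by decide), hkey₅,
            partialClassTrace, classTrace, mem_union] at hj ⊢
          rcases hj with hj | hj
          · rw [if_pos (by omega), mem_filter] at hj
            exact mem_range.1 (hS.subset hj.1)
          · simp [hmem] at hj
      · obtain ⟨h₁, h₂, h₃⟩ := hI'
        exact ⟨h₁, by rw [hm_succ]; omega, h₃⟩
      · obtain ⟨hcur₆, hT₆, σ₆, htrie₆⟩ := hI₆
        rw [List.take_length, partialClassTrace_toFinset] at htrie₆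
        refine ⟨hcur₆, hT₆, insert q S, ?_, σ₆, htrie₆⟩
        rw [hs₆.arr aSeen rfl, hseen₄]
        exact hS.new h₁
    · obtain ⟨h₁, h₂, S', h₃, σ', h₄⟩ := hI₄
      exact ⟨h₁, by simpa using h₂, S', h₃, σ', by simpa [IsTrie] using h₄⟩
  · obtain ⟨hT₃, S, hS, σ₃, htrie₃⟩ := hI₃
    refine ⟨by change _ ≤ s.reg rT + m r + 1; omega, S, hS.subset, ?_, fun q hq => ?_, σ₃, htrie₃⟩
    · rw [← Nat.card_Ico]
      refine card_le_card_of_injOn X (fun x _ => ?_) hS.inj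
      rw [coe_Ico]
      exact ⟨le_max_right _ _, htrie.node_lt x⟩
    · obtain ⟨p, hp, hpq⟩ := hS.cover q hq
      exact ⟨p, hp, (htrie.node_eq_iff p q).1 hpq⟩

/-! ### Writing the path -/

/-- The vertices of the class `c`. -/
def classList (cls : ℕ → ℕ) (n c : ℕ) : List ℕ := (List.range n).filter fun v => cls v = c

/-- The vertices sorted by their classes. -/
def classOrder (cls : ℕ → ℕ) (n T : ℕ) : List ℕ := (List.range T).flatMap (classList cls n)

variable {B : ℕ} {s s' : State} {n r T : ℕ} {cls : ℕ → ℕ}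

theorem mem_classList {c v : ℕ} : v ∈ classList cls n c ↔ v < n ∧ cls v = c := by
  simp [classList]

theorem classList_succ (cls : ℕ → ℕ) (n c : ℕ) :
    classList cls (n + 1) c = classList cls n c ++ if cls n = c then [n] else [] := by
  rw [classList, List.range_succ, List.filter_append, classList]
  congr 1
  by_cases h : cls n = c <;> simp [h]

theorem length_classList_le (cls : ℕ → ℕ) (n c : ℕ) : (classList cls n c).length ≤ n :=
  (List.length_filter_le _ _).trans_eq List.length_range

theorem classOrder_succ (cls : ℕ → ℕ) (n T : ℕ) :
    classOrder cls n (T + 1) = classOrder cls n T ++ classList cls n T := by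
  simp [classOrder, List.range_succ]

theorem length_classOrder (cls : ℕ → ℕ) (n T : ℕ) :
    (classOrder cls n T).length = ∑ c ∈ range T, (classList cls n c).length := by
  induction T with
  | zero => rfl
  | succ T ih => rw [classOrder_succ, List.length_append, ih, sum_range_succ]

theorem pairwise_classOrder (cls : ℕ → ℕ) (n T : ℕ) :
    (classOrder cls n T).Pairwise fun u v => cls u ≤ cls v := by
  rw [classOrder, List.pairwise_flatMap]
  refine ⟨fun c _ => ?_, ?_⟩
  · refine List.Pairwise.imp_of_mem (R := fun _ _ => True) (fun hu hv _ => ?_)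
      (List.pairwise_iff_getElem.2 fun _ _ _ _ _ => trivial)
    exact ((mem_classList.1 hu).2.trans (mem_classList.1 hv).2.symm).le
  · refine List.pairwise_lt_range.imp fun hcc' u hu v hv => ?_
    rw [(mem_classList.1 hu).2, (mem_classList.1 hv).2]
    exact hcc'.le

theorem classOrder_perm (hcls : ∀ v < n, cls v < T) : (classOrder cls n T).Perm (List.range n) := by
  rw [List.perm_ext_iff_of_nodup _ List.nodup_range]
  · intro v
    simp only [classOrder, List.mem_flatMap, List.mem_range, mem_classList]
    exact ⟨fun ⟨_, _, h, _⟩ => h, fun h => ⟨_, hcls v h, h, rfl⟩⟩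
  · rw [classOrder, List.nodup_flatMap]
    refine ⟨fun c _ => List.nodup_range.filter _, List.pairwise_lt_range.imp fun hcc' => ?_⟩
    intro v hv hv'
    have := (mem_classList.1 hv).2.symm.trans (mem_classList.1 hv').2
    omega

/-- The values of `f` from `p` on start with the list `l`. -/
def StartsWith (f : ℕ → ℕ) (p : ℕ) (l : List ℕ) : Prop :=
  ∀ i, (hi : i < l.length) → f (p + i) = l[i]

theorem StartsWith.append_singleton {f : ℕ → ℕ} {p : ℕ} {l : List ℕ}
    (h : StartsWith f p l) (v : ℕ) :
    StartsWith (Function.update f (p + l.length) v) p (l ++ [v]) := by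
  intro i hi
  rcases eq_or_ne i l.length with rfl | hne
  · simp
  · have hi' : i < l.length := by
      rw [List.length_append, List.length_singleton] at hi
      omega
    rw [Function.update_of_ne (by omega), List.getElem_append_left hi', h i hi']

theorem StartsWith.update {f : ℕ → ℕ} {p j : ℕ} {l : List ℕ} (h : StartsWith f p l)
    (hj : ∀ i < l.length, j ≠ p + i) (v : ℕ) : StartsWith (Function.update f j v) p l := by
  intro i hi
  rw [Function.update_of_ne (hj i hi).symm, h i hi]

/-- Sort the vertices by their nodes and write them to the output. -/
def writePath : Program := block [
  forLoop rVertex (.reg rn) (block [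
    .assign rClass (.get aCur (.reg rr + .reg rVertex)),
    .ite (.reg rRoot - .reg rClass) (.assign rClass (.reg rRoot)) .skip,
    .store aBucket (.reg rClass * .reg rn + .get aCount (.reg rClass)) (.reg rVertex),
    .store aCount (.reg rClass) (.get aCount (.reg rClass) + 1)]),
  .assign rPos 0,
  forLoop rClass (.reg rT) (
    forLoop ri (.get aCount (.reg rClass)) (block [
      .store aOutput (.reg rPos) (.get aBucket (.reg rClass * .reg rn + .reg ri)),
      .assign rPos (.reg rPos + 1)]))]

/-- Bucket sort: each class has `n` cells of its own, so buckets never collide. The cost is linear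
in `n` and the number of nodes, because the sizes of the buckets sum to `n`. -/
theorem runs_writePath (hn : s.reg rn = n) (hr : s.reg rr = r)
    (hcls : ∀ v < n, max (s.arr aCur (r + v)) (s.reg rRoot) < s.reg rT)
    (hcount : ∀ c, s.arr aCount c = 0) (hB : n + 1 < 2 ^ B) :
    Runs B writePath s (14 * n + 4 * s.reg rT + 10) fun s' =>
      s'.output n = classOrder (fun v => max (s.arr aCur (r + v)) (s.reg rRoot)) n (s.reg rT) := by
  set cls : ℕ → ℕ := fun v => max (s.arr aCur (r + v)) (s.reg rRoot) with hclsdef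
  set T := s.reg rT with hT
  have hperm : (classOrder cls n T).Perm (List.range n) := classOrder_perm hcls
  have hlen : (classOrder cls n T).length = n := by rw [hperm.length_eq, List.length_range]
  refine Runs.of_bdd fun hb => ?_
  refine Runs.mono (T₁ := (∑ _v ∈ range n, (((1 + 1) + (1 + 1 + 1)) + 1 + 2) + 2) +
    (((∑ c ∈ range T, (∑ _i ∈ range (classList cls n c).length, ((1 + 1 + 1) + 2) + 2 + 2) + 2) +
      1) + 1)) ?_ ?_
  swap
  · have : ∑ c ∈ range T, (∑ _i ∈ range (classList cls n c).length, ((1 + 1 + 1) + 2) + 2 + 2) =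
        5 * n + 4 * T := by
      simp only [sum_const, card_range, smul_eq_mul, sum_add_distrib, ← sum_mul]
      rw [← length_classOrder, hlen]
      omega
    rw [this]
    simp only [sum_const, card_range, smul_eq_mul]
    omega
  refine Runs.cons (Q₁ := fun s' => (∀ c, s'.arr aCount c = (classList cls n c).length) ∧
      ∀ c, StartsWith (s'.arr aBucket) (c * n) (classList cls n c))
    (Runs.forLoop n (fun v s' => (∀ c, s'.arr aCount c = (classList cls v c).length) ∧
      ∀ c, StartsWith (s'.arr aBucket) (c * n) (classList cls v c)) _ (by omega)
      (fun s' hs' => ?_) ?_ (fun v hv s₁ hs₁ hv₁ hI => ?_) fun s' _ _ hI => hI)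
    fun s₂ hs₂ _ hI₂ => ?_
  · exact (hs'.reg rn rfl).trans (by simp [hn])
  · exact ⟨fun c => by simp [hcount, classList], fun c i hi => by simp [classList] at hi⟩
  · obtain ⟨hcount₁, hbucket₁⟩ := hI
    have hroot₁ : s₁.reg rRoot = s.reg rRoot := hs₁.reg _ rfl
    have hr₁ : s₁.reg rr = r := (hs₁.reg _ rfl).trans hr
    have hn₁ : s₁.reg rn = n := (hs₁.reg _ rfl).trans hn
    have hcur₁ : s₁.arr aCur = s.arr aCur := hs₁.arr _ rfl
    refine Runs.cons_assign (T := (1 + 1) + (1 + 1 + 1)) (fun hb => hb.arr _ _) ?_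
    simp only [Expr.eval_get, Expr.eval_reg, Expr.eval_add, hr₁, hv₁, hcur₁]
    refine Runs.cons (Q₁ := fun s' => s' = s₁.setReg rClass (cls v)) (Runs.ite (fun h₁ => ?_)
      fun h₁ => ?_) fun s₃ _ _ hs₃ => ?_
    · refine Runs.assign (fun hb => hb.reg _) ?_
      simp only [Expr.eval_sub, Expr.eval_reg, State.reg_setReg] at h₁ ⊢
      have : cls v = s.reg rRoot := max_eq_right (by simp [hroot₁] at h₁; omega)
      rw [this]
      simp [State.setReg, hroot₁]
    · refine Runs.skip ?_
      simp only [Expr.eval_sub, Expr.eval_reg, State.reg_setReg] at h₁ ⊢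
      have : cls v = s.arr aCur (r + v) := max_eq_left (by simp [hroot₁] at h₁; omega)
      rw [this]
    subst hs₃
    have hlen₁ := length_classList_le cls v (cls v)
    refine Runs.cons_store (fun hb => hb.reg _) (Runs.cons_store (fun _ => ?_) (Runs.nil ?_))
    · simp [hcount₁]
      omega
    · refine ⟨fun c => ?_, fun c => ?_⟩
      · rw [classList_succ]
        rcases eq_or_ne c (cls v) with rfl | hne
        · simp [hcount₁]
        · simp [hcount₁, hne, hne.symm]
      · rw [classList_succ]
        simp only [State.arr_setReg, State.arr_setArr, State.reg_setArr, Expr.eval_add,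
          Expr.eval_mul, Expr.eval_reg, Expr.eval_get, State.reg_setReg, hn₁, hv₁, hcount₁, if_true,
          if_neg (show ¬rn = rClass by decide), if_neg (show ¬rVertex = rClass by decide),
          if_neg (show ¬aBucket = aCount by decide)]
        rcases eq_or_ne c (cls v) with rfl | hne
        · rw [if_pos rfl]
          exact (hbucket₁ _).append_singleton v
        · rw [if_neg hne.symm, List.append_nil]
          refine (hbucket₁ c).update (fun i hi heq => hne ?_) v
          have := length_classList_le cls v c
          exact (mul_add_inj (by omega) (by omega) heq).1.symm
  obtain ⟨hcount₂, hbucket₂⟩ := hI₂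
  have hn₂ : s₂.reg rn = n := (hs₂.reg _ rfl).trans hn
  have hT₂ : s₂.reg rT = T := hs₂.reg _ rfl
  refine Runs.cons_assign (fun _ => by simp) ?_
  rw [Expr.eval_zero]
  have hle : ∀ c < T, (classOrder cls n c).length + (classList cls n c).length ≤ n := by
    intro c hc
    rw [← List.length_append, ← classOrder_succ, length_classOrder]
    exact (sum_le_sum_of_subset (by simpa using hc)).trans_eq
      ((length_classOrder cls n T).symm.trans hlen)
  refine Runs.cons (T₂ := 1) (Q₁ := fun s' => StartsWith (s'.arr aOutput) 0 (classOrder cls n T))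
    (Runs.forLoop T (fun c s' => s'.reg rPos = (classOrder cls n c).length ∧
      StartsWith (s'.arr aOutput) 0 (classOrder cls n c)) _ (hb.reg rT)
      (fun s' hs' => ?_) ?_ (fun c hc s₃ hs₃ hc₃ hI₃ => ?_) fun s' _ _ hI => hI.2)
    fun s₄ _ _ hI₄ => Runs.nil ?_
  · exact (hs'.reg rT rfl).trans (by simp [hT₂])
  · exact ⟨by simp [classOrder], fun i hi => by simp [classOrder] at hi⟩
  · have hcount₃ : s₃.arr aCount = s₂.arr aCount := hs₃.arr _ rfl
    have hbucket₃ : s₃.arr aBucket = s₂.arr aBucket := hs₃.arr _ rfl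
    have hn₃ : s₃.reg rn = n := (hs₃.reg _ rfl).trans (by simp [hn₂])
    have hlec := hle c hc
    refine Runs.forLoop (classList cls n c).length (fun i s' =>
      s'.reg rPos = (classOrder cls n c ++ (classList cls n c).take i).length ∧
      StartsWith (s'.arr aOutput) 0 (classOrder cls n c ++ (classList cls n c).take i)) _ (by omega)
      (fun s' hs' => ?_) ?_ (fun i hi s₄ hs₄ hi₄ hI₄ => ?_) fun s' _ _ hI => ?_
    · have h₁ : s'.reg rClass = c := (hs'.reg _ rfl).trans hc₃
      have h₂ : s'.arr aCount = s₂.arr aCount := (hs'.arr _ rfl).trans hcount₃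
      simp [h₁, h₂, hcount₂]
    · simpa using hI₃
    · obtain ⟨hpos₄, hout₄⟩ := hI₄
      have hc₄ : s₄.reg rClass = c := (hs₄.reg _ rfl).trans hc₃
      have hn₄ : s₄.reg rn = n := (hs₄.reg _ rfl).trans hn₃
      have hbucket₄ : s₄.arr aBucket = s₂.arr aBucket := (hs₄.arr _ rfl).trans hbucket₃
      have hl : (classList cls n c).take (i + 1) =
          (classList cls n c).take i ++ [(classList cls n c)[i]] := by
        rw [List.take_add_one, List.getElem?_eq_getElem hi, Option.toList_some]
      refine Runs.cons_store (fun hb => hb.arr _ _) (Runs.cons_assign (fun _ => ?_) (Runs.nil ?_))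
      · simp only [Expr.eval_add, Expr.eval_reg, Expr.eval_one, State.reg_setArr, hpos₄,
          List.length_append, List.length_take]
        omega
      · rw [hl, ← List.append_assoc]
        refine ⟨?_, ?_⟩
        · simp [hpos₄]
          omega
        · have := hout₄.append_singleton (classList cls n c)[i]
          rw [zero_add, ← hpos₄] at this
          simpa [hc₄, hn₄, hi₄, hbucket₄, hbucket₂ c i hi] using this
    · rw [List.take_length] at hI
      rw [classOrder_succ]
      simpa using hI
  · unfold State.output
    refine List.ext_getElem (by simp [hlen]) fun i h₁ h₂ => ?_
    simpa using hI₄ i h₂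

/-! ### Hypergraphs as inputs -/

variable {n : ℕ} {L : List (List (Fin n))} {R : Finset (Finset (Fin n))}

/-- The vertices of the hyperedge number `q`. -/
def edgeList (L : List (List (Fin n))) (q : ℕ) : List ℕ := (L.getD q []).map Fin.val

theorem edgeList_eq {q : ℕ} (hq : q < L.length) : edgeList L q = L[q].map Fin.val := by
  simp [edgeList, hq]

theorem length_flatMap_take (L : List (List (Fin n))) {q : ℕ} (hq : q ≤ L.length) :
    ((L.take q).flatMap fun l => l.length :: l.map Fin.val).length =
      ∑ q' ∈ range q, ((edgeList L q').length + 1) := by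
  induction q with
  | zero => simp
  | succ q ih =>
    rw [List.take_add_one, List.getElem?_eq_getElem (by omega), Option.toList_some,
      List.flatMap_append, List.length_append, ih (by omega), sum_range_succ,
      edgeList_eq (by omega)]
    simp

theorem getElem?_encodeInput (d : ℕ) (L : List (List (Fin n))) {q : ℕ} (hq : q < L.length) {i : ℕ}
    (hi : i ≤ (edgeList L q).length) :
    (encodeInput d n L)[edgePos (edgeList L) q + i]? =
      ((edgeList L q).length :: edgeList L q)[i]? := by
  have h₁ : L = L.take q ++ L[q] :: L.drop (q + 1) := by simp
  have h₂ := length_flatMap_take L hq.le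
  set A := ∑ q' ∈ range q, ((edgeList L q').length + 1) with hA
  have h₃ : edgePos (edgeList L) q + i = A + i + 3 := by
    unfold edgePos
    omega
  clear_value A
  have hE := edgeList_eq hq
  rw [encodeInput, h₃, List.getElem?_cons_succ, List.getElem?_cons_succ, List.getElem?_cons_succ,
    h₁, List.flatMap_append, List.getElem?_append_right (by omega), h₂, Nat.add_sub_cancel_left,
    List.flatMap_cons, ← h₁, hE, List.getElem?_append_left]
  · simp
  · rw [hE] at hi
    simp at hi ⊢
    omega

theorem Presents.isInput (h : Presents L R) (d : ℕ) :
    IsInput (fun i => (encodeInput d n L).getD i 0) d n L.length (edgeList L) where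
  word_zero := rfl
  word_one := rfl
  word_two := rfl
  word_pos q hq := by
    have := getElem?_encodeInput d L hq (Nat.zero_le _)
    rw [add_zero] at this
    rw [List.getD_eq_getElem?_getD, this]
    rfl
  word_vertex q hq i hi := by
    have := getElem?_encodeInput d L hq (i := i + 1) (by omega)
    rw [List.getD_eq_getElem?_getD, Nat.add_right_comm, Nat.add_assoc, this,
      List.getElem?_cons_succ, List.getElem?_eq_getElem hi, Option.getD_some]
  nodup q hq := by
    rw [edgeList_eq hq]
    exact (h.1 _ (List.getElem_mem hq)).map Fin.val_injective
  lt q hq v hv := by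
    rw [edgeList_eq hq] at hv
    obtain ⟨u, -, rfl⟩ := List.mem_map.1 hv
    exact u.2

theorem val_mem_edgeList {q : ℕ} (hq : q < L.length) (v : Fin n) :
    v.val ∈ (edgeList L q).toFinset ↔ v ∈ L[q].toFinset := by
  rw [edgeList_eq hq, List.mem_toFinset, List.mem_toFinset, List.mem_map]
  exact ⟨fun ⟨u, hu, huv⟩ => Fin.ext huv ▸ hu, fun hv => ⟨v, hv, rfl⟩⟩

theorem Presents.exists_edge (h : Presents L R) {t : Finset (Fin n)} (ht : t ∈ R) :
    ∃ q, ∃ hq : q < L.length, L[q].toFinset = t := by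
  obtain ⟨l, hl, rfl⟩ := List.mem_map.1 ((h.2.2 t).2 ht)
  obtain ⟨q, hq, rfl⟩ := List.getElem_of_mem hl
  exact ⟨q, hq, rfl⟩

theorem Presents.mem (h : Presents L R) {q : ℕ} (hq : q < L.length) : L[q].toFinset ∈ R :=
  (h.2.2 _).1 (List.mem_map_of_mem (List.getElem_mem hq))

/-- A shattered set of numbers is itself a trace, hence consists of vertices and can be pulled back
to `Fin n`. -/
theorem Presents.vcBound (h : Presents L R) {d : ℕ} (hd : R.vcDim ≤ d) :
    VCBound (fun q => (edgeList L q).toFinset) L.length d := by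
  intro Y hY
  have hYn : ∀ v ∈ Y, v < n := by
    obtain ⟨q, hq, hqY⟩ := hY Y Subset.rfl
    intro v hv
    rw [← hqY] at hv
    exact (h.isInput d).lt q hq v (List.mem_toFinset.1 (mem_inter.1 hv).2)
  set Z : Finset (Fin n) := univ.filter fun v => v.val ∈ Y with hZ
  have hZY : Z.map Fin.valEmbedding = Y := by
    ext v
    simp only [mem_map, hZ, mem_filter, mem_univ, true_and, Fin.valEmbedding_apply]
    exact ⟨fun ⟨u, hu, huv⟩ => huv ▸ hu, fun hv => ⟨⟨v, hYn v hv⟩, hv, rfl⟩⟩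
  have hsh : R.Shatters Z := by
    intro t ht
    obtain ⟨q, hq, hqt⟩ := hY (t.map Fin.valEmbedding) (by rw [← hZY]; exact map_subset_map.2 ht)
    refine ⟨_, h.mem hq, ?_⟩
    ext v
    rw [mem_inter, ← val_mem_edgeList hq]
    have := Finset.ext_iff.1 hqt v.val
    rw [mem_inter] at this
    simp only [hZ, mem_filter, mem_univ, true_and]
    rw [this]
    exact mem_map' Fin.valEmbedding
  rw [← hZY, card_map]
  exact hsh.card_le_vcDim.trans hd

theorem Presents.sum_length (h : Presents L R) :
    ∑ q ∈ range L.length, (edgeList L q).length = hypergraphSize R := by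
  have hR : R = (L.map List.toFinset).toFinset := by
    ext t
    rw [List.mem_toFinset, h.2.2]
  rw [hypergraphSize, hR, List.sum_toFinset _ h.2.1, List.map_map, ← Fin.sum_univ_eq_sum_range,
    ← List.sum_ofFn]
  congr 1
  refine List.ext_getElem (by simp) fun i h₁ h₂ => ?_
  simp only [List.getElem_ofFn, List.getElem_map, Function.comp_apply]
  rw [edgeList_eq, List.length_map, List.toFinset_card_of_nodup (h.1 _ (List.getElem_mem _))]

theorem Presents.injOn (h : Presents L R) :
    Set.InjOn (fun q => (edgeList L q).toFinset) (range L.length) := by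
  intro q hq q' hq' heq
  rw [coe_range, Set.mem_Iio] at hq hq'
  have : L[q].toFinset = L[q'].toFinset := by
    ext v
    rw [← val_mem_edgeList hq, ← val_mem_edgeList hq', show (edgeList L q).toFinset = _ from heq]
  exact (h.2.1.getElem_inj_iff (hi := by simpa using hq) (hj := by simpa using hq')).1
    (by simpa using this)

/-- The hyperedges are distinct, so at most one is empty, and every other contributes to the size.
-/
theorem Presents.length_le (h : Presents L R) : L.length ≤ hypergraphSize R + 1 := by
  have h₁ : #((range L.length).filter fun q => (edgeList L q).toFinset = ∅) ≤ 1 := by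
    refine card_le_one.2 fun a ha b hb => ?_
    rw [mem_filter] at ha hb
    exact h.injOn ha.1 hb.1 (ha.2.trans hb.2.symm)
  rw [card_filter] at h₁
  rw [← h.sum_length]
  calc L.length = ∑ q ∈ range L.length, 1 := by simp
    _ ≤ ∑ q ∈ range L.length, ((edgeList L q).length +
        if (edgeList L q).toFinset = ∅ then 1 else 0) := sum_le_sum fun q _ => by
      split
      · omega
      · rename_i hne
        rw [List.toFinset_eq_empty_iff, ← List.length_eq_zero_iff] at hne
        omega
    _ ≤ _ := by
      rw [sum_add_distrib]
      omega

theorem Presents.length_edgeList_le (h : Presents L R) (q : ℕ) : (edgeList L q).length ≤ n := by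
  rcases Nat.lt_or_ge q L.length with hq | hq
  · rw [edgeList_eq hq, List.length_map]
    simpa using (h.1 _ (List.getElem_mem hq)).length_le_card
  · simp [edgeList, hq]

theorem Presents.bdd (h : Presents L R) {d B : ℕ} (hd : d < 2 ^ B) (hn : n < 2 ^ B)
    (hr : L.length < 2 ^ B) (hB : 0 < B) : Bdd B (initState (encodeInput d n L)) := by
  refine ⟨hB, fun x => by simp [initState], fun a i => ?_⟩
  have key : ∀ x ∈ encodeInput d n L, x < 2 ^ B := by
    intro x hx
    simp only [encodeInput, List.mem_cons, List.mem_flatMap, List.mem_map] at hx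
    rcases hx with rfl | rfl | rfl | ⟨l, hl, rfl | ⟨v, -, rfl⟩⟩
    · exact hd
    · exact hn
    · exact hr
    · exact lt_of_le_of_lt (by simpa using (h.1 l hl).length_le_card) hn
    · exact v.2.trans hn
  simp only [initState]
  split
  · rcases Nat.lt_or_ge i (encodeInput d n L).length with hi | hi
    · rw [List.getD_eq_getElem _ _ hi]
      exact key _ (List.getElem_mem hi)
    · rw [List.getD_eq_default _ _ hi]
      positivity
  · positivity

/-! ### Paths sorted by classes -/

theorem exists_path {l : List ℕ} (hl : l.Perm (List.range n)) :
    ∃ P : List (Fin n), P.map Fin.val = l ∧ IsSpanningPath P := by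
  have hlt : ∀ v ∈ l, v < n := fun v hv => List.mem_range.1 (hl.mem_iff.1 hv)
  have hmap : (l.pmap Fin.mk hlt).map Fin.val = l := by
    rw [List.map_pmap]
    simp
  refine ⟨l.pmap Fin.mk hlt, hmap, ?_, fun v => ?_⟩
  · refine List.Nodup.of_map Fin.val ?_
    rw [hmap]
    exact hl.nodup_iff.2 List.nodup_range
  · exact List.mem_pmap.2 ⟨v, hl.mem_iff.2 (List.mem_range.2 v.2), rfl⟩

theorem diffCount_eq_card {e : ℕ → Finset ℕ} {p q N : ℕ} :
    diffCount e p q id (range N) = #((range N).filter fun v => v ∈ symmDiff (e p) (e q)) := by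
  rw [diffCount, card_filter]
  rfl

/-- The stabbing number of a path sorted by the sets of the hyperedges in `S` that contain a
vertex. -/
theorem stabbingNumber_le (h : Presents L R) {d δ N : ℕ} (hd : R.vcDim ≤ d) (hnN : n ≤ N)
    {S : Finset ℕ} (hS : S ⊆ range L.length)
    (hcover : ∀ q < L.length, ∃ p ∈ S,
      diffCount (fun q => (edgeList L q).toFinset) p q id (range N) ≤ δ)
    {cls : ℕ → ℕ} {σ : ℕ → Finset ℕ}
    (hσ : ∀ v, σ (cls v) = S.filter fun q => v ∈ (edgeList L q).toFinset)
    (hcls : ∀ u v, cls u = cls v ↔ (S.filter fun q => u ∈ (edgeList L q).toFinset) =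
      S.filter fun q => v ∈ (edgeList L q).toFinset)
    {P : List (Fin n)} (hP : P.Nodup)
    (hsorted : P.Pairwise fun u v : Fin n => cls u.val ≤ cls v.val) :
    stabbingNumber R P ≤ (#S + 1) ^ 2 ^ (d + 1) + 2 * δ := by
  refine Finset.sup_le fun t ht => ?_
  obtain ⟨q, hq, rfl⟩ := h.exists_edge ht
  obtain ⟨p, hp, hpq⟩ := hcover q hq
  have hpL := mem_range.1 (hS hp)
  set D : Finset (Fin n) := symmDiff L[p].toFinset L[q].toFinset with hD
  have hDcard : #D ≤ δ := by
    refine le_trans ?_ hpq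
    rw [diffCount_eq_card]
    refine card_le_card_of_injOn Fin.val (fun v hv => ?_) (Fin.val_injective.injOn)
    rw [mem_coe, hD, mem_symmDiff, ← val_mem_edgeList hpL, ← val_mem_edgeList hq] at hv
    rw [mem_coe, mem_filter, mem_range, mem_symmDiff]
    exact ⟨v.2.trans_le hnN, hv⟩
  -- `σ` embeds the classes into the dual traces on `S`.
  have hclasses : #(P.map fun v => cls v.val).toFinset ≤ (#S + 1) ^ 2 ^ (d + 1) := by
    refine le_trans ?_ ((h.vcBound hd).card_dual_traces_le hS (range n))
    have hmem : ∀ c ∈ (P.map fun v => cls v.val).toFinset, ∃ v : Fin n, cls v.val = c :=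
        fun c hc => by
      obtain ⟨v, -, hv⟩ := List.mem_map.1 (List.mem_toFinset.1 hc)
      exact ⟨v, hv⟩
    refine card_le_card_of_injOn σ (fun c hc => ?_) fun c hc c' hc' heq => ?_
    · obtain ⟨v, rfl⟩ := hmem c hc
      rw [hσ]
      exact mem_image_of_mem _ (mem_range.2 v.2)
    · obtain ⟨u, rfl⟩ := hmem c hc
      obtain ⟨v, rfl⟩ := hmem c' hc'
      rw [hσ, hσ] at heq
      exact (hcls u v).2 heq
  refine (length_stabbedEdges_le hP (fun v => cls v.val) hsorted L[q].toFinset D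
    fun u v huv' huv hcard => ?_).trans (Nat.add_le_add hclasses (Nat.mul_le_mul_left _ hDcard))
  -- Within a class `p ∈ S` contains both endpoints or neither, while `q` contains exactly one; so
  -- `p` and `q` differ at one of them.
  have h₁ : u ∈ L[p].toFinset ↔ v ∈ L[p].toFinset := by
    have := Finset.ext_iff.1 ((hcls u v).1 huv) p
    rw [mem_filter, mem_filter, val_mem_edgeList hpL, val_mem_edgeList hpL] at this
    tauto
  have h₂ : ¬(u ∈ L[q].toFinset ↔ v ∈ L[q].toFinset) := by
    intro hiff
    by_cases hu : u ∈ L[q].toFinset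
    · rw [inter_eq_right.2 (insert_subset hu (singleton_subset_iff.2 (hiff.1 hu))),
        card_pair huv'] at hcard
      omega
    · rw [inter_insert_of_notMem hu, inter_singleton_of_notMem fun hv => hu (hiff.2 hv),
        card_empty] at hcard
      omega
  rw [hD, mem_symmDiff, mem_symmDiff]
  tauto

/-! ### The algorithm -/

/-- The algorithm. -/
def spanningPath : Program :=
  block [setParams, readEdges, initSample, reduceSample, buildClasses, writePath]

/-- The bound on the number of nodes of a trie of traces on a group. -/
def nodeBound (d n : ℕ) : ℕ := (2 * (2 ^ accuracyExp d n * 2 ^ accuracyExp d n) + 1) ^ (d + 1)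

variable {B : ℕ} {s s' : State} {d n r : ℕ} {el : ℕ → List ℕ}

/-- Double counting of incidences; only an inequality, since hyperedges might reach beyond `N`. -/
theorem sum_length_incidentEdges_le (e : ℕ → Finset ℕ) (r N : ℕ) :
    ∑ v ∈ range N, (incidentEdges e r v).length ≤ ∑ q ∈ range r, #(e q) := by
  have h : ∀ v, (incidentEdges e r v).length = ∑ q ∈ range r, if v ∈ e q then 1 else 0 :=
      fun v => by
    rw [← card_filter, ← List.toFinset_card_of_nodup (nodup_incidentEdges e r v)]
    congr 1
    ext q
    simp [mem_incidentEdges]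
  simp_rw [h]
  rw [sum_comm]
  refine sum_le_sum fun q _ => ?_
  rw [← card_filter]
  exact card_le_card fun v hv => (mem_filter.1 hv).2

theorem runs_spanningPath {w : ℕ → ℕ} (hw : IsInput w d n r el)
    (hvc : VCBound (fun q => (el q).toFinset) r d) (hs : s.arr aInput = w)
    (hzero : ∀ a ≠ aInput, ∀ i, s.arr a i = 0)
    (hB : epsInv d + ∑ q ∈ range r, (el q).length + r + n +
      sampleExp n * (2 ^ sampleExp n * (nodeBound d n * nodeBound d n)) + 4 < 2 ^ B) :
    Runs B spanningPath s (310 * sampleExp n * (∑ q ∈ range r, (el q).length + r + d +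
        2 ^ sampleExp n * (nodeBound d n * nodeBound d n)))
      fun s' => ∃ S ⊆ range r, #S ≤ nodeBound d n ∧
        (∀ q < r, ∃ p ∈ S, 2 * 2 ^ accuracyExp d n *
          diffCount (fun q => (el q).toFinset) p q id (range (2 ^ sampleExp n)) ≤
            sampleExp n * 2 ^ sampleExp n * (B + 2)) ∧
        ∃ (cls : ℕ → ℕ) (σ : ℕ → Finset ℕ) (T : ℕ), s'.output n = classOrder cls n T ∧
          (∀ v, cls v < T) ∧ (∀ v, σ (cls v) = S.filter fun q => v ∈ (el q).toFinset) ∧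
          ∀ u v, cls u = cls v ↔
            (S.filter fun q => u ∈ (el q).toFinset) = S.filter fun q => v ∈ (el q).toFinset := by
  set e : ℕ → Finset ℕ := fun q => (el q).toFinset with he
  set m := ∑ q ∈ range r, (el q).length with hm
  set J := sampleExp n with hJ
  set N := 2 ^ J with hN
  set K := 2 ^ accuracyExp d n with hK
  set τ := nodeBound d n with hτ
  have hτ' : (2 * (K * K) + 1) ^ (d + 1) = τ := rfl
  have hJpos : 1 ≤ J := le_max_left _ _
  have hKpos : 0 < K := by positivity
  have hτpos : 1 ≤ τ := Nat.one_le_pow _ _ (Nat.succ_pos _)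
  have hnN : n ≤ N := le_two_pow_sampleExp n
  have hττ : τ ≤ τ * τ := Nat.le_mul_of_pos_left _ hτpos
  have hNτ : N * τ ≤ N * (τ * τ) := Nat.mul_le_mul_left _ hττ
  have hNτ' : N ≤ N * τ := Nat.le_mul_of_pos_right _ hτpos
  have hJN : N * (τ * τ) ≤ J * (N * (τ * τ)) := Nat.le_mul_of_pos_left _ hJpos
  have hNpos : 1 ≤ N := Nat.one_le_two_pow
  have hdE : d ≤ epsInv d := by
    unfold epsInv
    nlinarith [Nat.one_le_two_pow (n := d + 1)]
  have hmdef : ∑ q ∈ range r, #(e q) ≤ m := sum_le_sum fun q _ => List.toFinset_card_le _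
  have hjJ := two_mul_accuracyExp_lt d n
  set L := J - (2 * accuracyExp d n + 1) with hLdef
  have hLJ : L + 1 ≤ J := by omega
  -- The padded vertex set splits into exactly `2 ^ L` groups.
  have hgN : 2 ^ L * (2 * (K * K)) = N := by
    rw [hN, show J = L + (accuracyExp d n + accuracyExp d n + 1) by omega, pow_add, pow_add,
      pow_add]
    ring
  have hKK : 1 ≤ K * K := Nat.mul_pos hKpos hKpos
  have hLN : 2 ^ L ≤ N := by
    rw [← hgN]
    exact Nat.le_mul_of_pos_right _ (by omega)
  have hgle : 2 * (K * K) ≤ N := by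
    rw [← hgN]
    exact Nat.le_mul_of_pos_left _ (by positivity)
  have hnodes : (L * 2 ^ L + 1) * τ ≤ J * (N * τ) := by
    rw [← Nat.mul_assoc]
    refine Nat.mul_le_mul_right _ ?_
    calc L * 2 ^ L + 1 ≤ L * N + N := Nat.add_le_add (Nat.mul_le_mul_left _ hLN) hNpos
      _ = (L + 1) * N := by ring
      _ ≤ J * N := Nat.mul_le_mul_right _ hLJ
  have hJNτ : J * (N * τ) ≤ J * (N * (τ * τ)) := Nat.mul_le_mul_left _ hNτ
  set c₄ := (L + 1) * (16 * m + 2 ^ L * (90 * (K * K + 1) * (τ * τ + 1)) + 20) with hc₄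
  have hc₄le : c₄ ≤ J * (16 * m + 180 * (N * (τ * τ)) + 20) := by
    refine Nat.mul_le_mul hLJ (Nat.add_le_add_right (Nat.add_le_add_left ?_ _) _)
    calc 2 ^ L * (90 * (K * K + 1) * (τ * τ + 1))
        ≤ 2 ^ L * (90 * (2 * (K * K)) * (2 * (τ * τ))) := by
          have : 1 ≤ τ * τ := hτpos.trans hττ
          gcongr <;> omega
      _ = 180 * ((2 ^ L * (2 * (K * K))) * (τ * τ)) := by ring
      _ = 180 * (N * (τ * τ)) := by rw [hgN]
  -- One summand for each of the six phases, and `1` for the end of the block.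
  refine Runs.mono (T₁ := (6 * n + 3 * d + 3 * J + 30) + ((7 * m + 12 * r + 10) + ((3 * N + 2) +
    (c₄ + ((16 * m + 14 * r + 10) + ((14 * n + 4 * (J * (N * τ) + m + 2) + 10) + 1)))))) ?_ ?_
  swap
  · have h₁ : m ≤ J * m := Nat.le_mul_of_pos_left _ hJpos
    have h₂ : r ≤ J * r := Nat.le_mul_of_pos_left _ hJpos
    have h₃ : d ≤ J * d := Nat.le_mul_of_pos_left _ hJpos
    have h₄ : J ≤ J * (N * (τ * τ)) := Nat.le_mul_of_pos_right _ (by omega)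
    have h₅ : J * (16 * m + 180 * (N * (τ * τ)) + 20) =
      16 * (J * m) + 180 * (J * (N * (τ * τ))) + 20 * J := by ring
    have h₆ : 310 * J * (m + r + d + N * (τ * τ)) =
      310 * (J * m) + 310 * (J * r) + 310 * (J * d) + 310 * (J * (N * (τ * τ))) := by ring
    omega
  refine Runs.of_bdd fun hb₀ => ?_
  refine Runs.cons (runs_setParams (d := d) (n := n) (r := r) (by rw [hs]; exact hw.word_zero)
    (by rw [hs]; exact hw.word_one) (by rw [hs]; exact hw.word_two) (by change N + r < 2 ^ B; omega)
    (by omega))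
    fun s₁ hs₁ hb₁ hp => ?_
  have hw₁ : s₁.arr aInput = w := (hs₁.arr _ rfl).trans hs
  have hL₁ : s₁.reg rLevels = L := by
    have := hp.reg_levels
    omega
  have hh₁ : s₁.reg rh = K * K := by rw [hp.reg_h, hp.reg_K]
  have hg₁ : s₁.reg rg = 2 * (K * K) := by rw [hp.reg_g, hh₁]
  have hpos : edgePos el r = 3 + (m + r) := by
    unfold edgePos
    rw [sum_add_distrib, sum_const, card_range, smul_eq_mul, mul_one]
  refine Runs.cons ((runs_readEdges (B := B) hw hw₁ hp.reg_r (hp.reg_N ▸ hnN)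
    (fun v => by rw [hs₁.arr aDeg rfl]; exact hzero _ (by decide) _)
    (fun v => by rw [hs₁.arr aInc rfl]; exact hzero _ (by decide) _) (by omega)).mono ?_)
    fun s₂ hs₂ hb₂ ⟨hstart₂, hadj₂, hinc₂⟩ => ?_
  · rw [sum_add_distrib, ← mul_sum, sum_const, card_range, smul_eq_mul]
    omega
  have hN₂ : s₂.reg rN = N := (hs₂.reg _ rfl).trans hp.reg_N
  refine Runs.cons ((runs_initSample (B := B) (s := s₂) fun i => by
    rw [hs₂.arr aSample rfl, hs₁.arr aSample rfl]; exact hzero _ (by decide) _).mono (by rw [hN₂]))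
    fun s₃ hs₃ hb₃ ⟨hsam₃, hsam₃'⟩ => ?_
  have hreg₃ : ∀ x, (x = rr ∨ x = rn ∨ x = rN ∨ x = rK ∨ x = rh ∨ x = rg ∨ x = rStride ∨
      x = rGroups ∨ x = rLevels ∨ x = rT) → s₃.reg x = s₁.reg x := by
    rintro x (rfl | rfl | rfl | rfl | rfl | rfl | rfl | rfl | rfl | rfl) <;>
      exact (hs₃.reg _ rfl).trans (hs₂.reg _ rfl)
  have harr₃ : ∀ a, (a = aCur ∨ a = aCh ∨ a = aLim ∨ a = aSeen ∨ a = aCount) →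
      ∀ i, s₃.arr a i = 0 := by
    rintro a ha i
    have h₁ : s₃.arr a = s.arr a := by
      rcases ha with rfl | rfl | rfl | rfl | rfl <;>
        exact (hs₃.arr _ rfl).trans ((hs₂.arr _ rfl).trans (hs₁.arr _ rfl))
    rw [h₁]
    exact hzero _ (by rcases ha with rfl | rfl | rfl | rfl | rfl <;> decide) _
  have hg₃ : s₃.reg rg = 2 * (K * K) := (hreg₃ _ (by simp)).trans hg₁
  have hh₃ : s₃.reg rh = K * K := (hreg₃ _ (by simp)).trans hh₁
  have hK₃ : s₃.reg rK = K := (hreg₃ _ (by simp)).trans hp.reg_K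
  have hN₃ : s₃.reg rN = N := (hreg₃ _ (by simp)).trans hp.reg_N
  have hT₃ : s₃.reg rT = 1 := (hreg₃ _ (by simp)).trans hp.reg_T
  have hL₃ : s₃.reg rLevels = L := (hreg₃ _ (by simp)).trans hL₁
  have hr₃ : s₃.reg rr = r := (hreg₃ _ (by simp)).trans hp.reg_r
  have hstr₃ : s₃.reg rStride = 2 * (K * K) + r := by
    rw [hreg₃ _ (by simp), hp.reg_stride, hg₁]
  have hG₃ : s₃.reg rGroups = 2 ^ L := by
    rw [hreg₃ _ (by simp), hp.reg_groups, hL₁]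
  rw [hN₂] at hsam₃ hsam₃'
  have hadj₃ : HasAdj s₃ e r := by
    refine ⟨hr₃, ?_, ?_⟩
    · rw [hs₃.arr aDeg rfl]; exact hadj₂.deg
    · rw [hs₃.arr aAdj rfl]; exact hadj₂.adj
  have hinc₃ : HasInc s₃ e r := by
    unfold HasInc
    rw [hN₃, hs₃.arr aInc rfl, ← hN₂]
    exact hinc₂
  have henv₃ : SampleEnv s₃ e r d B := by
    refine ⟨hvc, hadj₃, hinc₃, by rw [hg₃, hh₃], by rw [hh₃, hK₃], by rw [hK₃]; exact hKpos,
      by omega, ?_⟩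
    rw [hg₃, hh₃, hτ']
    calc τ * τ * (1 + K * K) ≤ τ * τ * N := Nat.mul_le_mul_left _ (by omega)
      _ = N * (τ * τ) := Nat.mul_comm _ _
      _ < 2 ^ B := by omega
  have hfresh₃ : FreshTrie s₃ := by
    refine ⟨by omega, fun y => ?_, fun j _ => harr₃ _ (by simp) _, fun x _ => harr₃ _ (by simp) _⟩
    rw [harr₃ _ (by simp), hT₃]
    exact one_pos
  have hreduce := runs_reduceSample (L := L) (m := m) henv₃ hfresh₃ (fun i => ?_) hL₃ hG₃ ?_ ?_ ?_
  rotate_left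
  · rw [hN₃]
    rcases Nat.lt_or_ge i N with hi | hi
    · rw [hsam₃ i hi]; exact hi
    · rw [hsam₃' i hi]; omega
  · rw [hT₃, hg₃, hτ']
    omega
  · rw [hg₃, hgN]
    omega
  · rw [hg₃, hgN]
    refine (le_of_eq (sum_congr rfl fun j hj => ?_)).trans
      ((sum_length_incidentEdges_le e r N).trans hmdef)
    rw [hsam₃ j (mem_range.1 hj), hadj₃.deg]
  rw [hg₃, hh₃, hK₃, hT₃, hτ', hgN] at hreduce
  refine Runs.cons hreduce fun s₄ hs₄ hb₄ ⟨hT₄, hroot₄, σ, tr, htrie₄, hdiff⟩ => ?_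
  have hr₄ : s₄.reg rr = r := (hs₄.reg _ rfl).trans hr₃
  have hstr₄ : s₄.reg rStride = 2 * (K * K) + r := (hs₄.reg _ rfl).trans hstr₃
  have hclasses := runs_buildClasses (B := B) htrie₄ hw
    ((hs₄.arr _ rfl).trans ((hs₃.arr _ rfl).trans ((hs₂.arr _ rfl).trans hw₁))) hr₄
    (fun q hq => by rw [hs₄.arr aStart rfl, hs₃.arr aStart rfl]; exact hstart₂ q hq)
    (fun x => by rw [hs₄.arr aSeen rfl]; exact harr₃ _ (by simp) _) (by omega) (by omega) (by omega)
  refine Runs.cons (hclasses.mono ?_) fun s₅ hs₅ hb₅ ⟨hT₅, S, hS, hScard, hScover, σ', htrie₅⟩ => ?_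
  · rw [sum_add_distrib, ← mul_sum, sum_const, card_range, smul_eq_mul]
    omega
  have hn₅ : s₅.reg rn = n := (hs₅.reg _ rfl).trans ((hs₄.reg _ rfl).trans
    ((hreg₃ _ (by simp)).trans hp.reg_n))
  have hr₅ : s₅.reg rr = r := (hs₅.reg _ rfl).trans hr₄
  refine Runs.cons ((runs_writePath (B := B) hn₅ hr₅ (fun v _ => htrie₅.node_lt _)
    (fun c => by rw [hs₅.arr aCount rfl, hs₄.arr aCount rfl]; exact harr₃ _ (by simp) _)
    (by omega)).mono (by omega)) fun s₆ _ _ hout => Runs.nil ?_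
  have htrace : ∀ v, classTrace e r S (r + v) = S.filter fun q => v ∈ (el q).toFinset := fun v => by
    simp [classTrace, he]
  refine ⟨S, hS, by omega, fun q hq => ?_, _, σ', _, hout, fun v => htrie₅.node_lt _, fun v => ?_,
    fun u v => ?_⟩
  · obtain ⟨p, hp', hpq⟩ := hScover q hq
    refine ⟨p, hp', ?_⟩
    have h₁ := hdiff p (mem_range.1 (hS hp')) q hq hpq
    have h₂ : diffCount e p q (s₃.arr aSample) (range N) = diffCount e p q id (range N) :=
      sum_congr rfl fun j hj => by rw [hsam₃ j (mem_range.1 hj), id]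
    rw [h₂] at h₁
    -- Multiplying by `2K` turns the error `2^L K` per level into `2^L · 2K² = N` and avoids
    -- division.
    calc 2 * K * diffCount e p q id (range N)
        ≤ 2 * K * (L * (2 ^ L * (K * (B + 2)))) := Nat.mul_le_mul_left _ h₁
      _ = L * (2 ^ L * (2 * (K * K))) * (B + 2) := by ring
      _ = L * N * (B + 2) := by rw [hgN]
      _ ≤ J * N * (B + 2) := by gcongr; omega
  · rw [htrie₅.node, htrace]
  · rw [htrie₅.node_eq_iff, htrace, htrace]

/-! ### Estimates -/

/-- This linear bound is enough for the running time and the bit lengths; only `classes_bound` needs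
the factor `2^(d+1)`. -/
theorem le_epsInv (d : ℕ) : 10 * d + 9 ≤ epsInv d := by
  have : 2 ≤ 2 ^ (d + 1) := by
    rw [pow_succ]
    have := Nat.one_le_two_pow (n := d)
    omega
  unfold epsInv
  nlinarith

theorem stabbingEps_five (d : ℕ) : stabbingEps 5 d = 1 / (epsInv d : ℝ) := by
  unfold stabbingEps epsInv
  push_cast
  congr 1
  ring

theorem nodeBound_le (d n : ℕ) :
    nodeBound d n ≤ 3 ^ (d + 1) * (2 ^ accuracyExp d n) ^ (2 * (d + 1)) := by
  unfold nodeBound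
  have : 1 ≤ 2 ^ accuracyExp d n * 2 ^ accuracyExp d n :=
    Nat.mul_pos (by positivity) (by positivity)
  calc (2 * (2 ^ accuracyExp d n * 2 ^ accuracyExp d n) + 1) ^ (d + 1)
      ≤ (3 * (2 ^ accuracyExp d n * 2 ^ accuracyExp d n)) ^ (d + 1) :=
        Nat.pow_le_pow_left (by omega) _
    _ = _ := by rw [mul_pow, ← sq, ← pow_mul (2 ^ accuracyExp d n)]

/-- `K ≤ N^(1/E)` because the exponent of `K` is rounded down, and `a / E ≤ 1 - 1 / E`. -/
theorem two_pow_accuracyExp_pow_le {d n a : ℕ} (ha : a + 1 ≤ epsInv d) :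
    ((2 : ℝ) ^ accuracyExp d n) ^ a ≤ ((2 : ℝ) ^ sampleExp n) ^ (1 - 1 / (epsInv d : ℝ)) := by
  have hE : (0 : ℝ) < epsInv d := by exact_mod_cast (show 0 < epsInv d by omega)
  have h₁ : ((accuracyExp d n * epsInv d : ℕ) : ℝ) ≤ sampleExp n := by
    exact_mod_cast Nat.div_mul_le_self _ _
  have h₂ : (a : ℝ) + 1 ≤ epsInv d := by exact_mod_cast ha
  rw [← pow_mul, ← Real.rpow_natCast, ← Real.rpow_natCast, ← Real.rpow_mul two_pos.le]
  refine Real.rpow_le_rpow_of_exponent_le one_le_two ?_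
  push_cast at h₁ ⊢
  have h₃ : (accuracyExp d n : ℝ) ≤ sampleExp n / epsInv d := by rwa [le_div_iff₀ hE]
  have h₄ : (0 : ℝ) ≤ epsInv d - 1 := by linarith [Nat.cast_nonneg (α := ℝ) a]
  calc (accuracyExp d n : ℝ) * a ≤ accuracyExp d n * (epsInv d - 1) := by gcongr; linarith
    _ ≤ sampleExp n / epsInv d * (epsInv d - 1) := by gcongr
    _ = _ := by field_simp

/-- The counterpart: rounding down loses at most a factor of two, so `2K ≥ N^(1/E)`. -/
theorem two_pow_sampleExp_le_mul (d n : ℕ) : (2 : ℝ) ^ sampleExp n ≤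
    2 * 2 ^ accuracyExp d n * ((2 : ℝ) ^ sampleExp n) ^ (1 - 1 / (epsInv d : ℝ)) := by
  have hE' : 0 < epsInv d := by have := le_epsInv d; omega
  have hE : (0 : ℝ) < epsInv d := by exact_mod_cast hE'
  have h₁ : (sampleExp n : ℝ) ≤ (accuracyExp d n + 1) * epsInv d := by
    have := (Nat.lt_div_mul_add hE' (a := sampleExp n)).le
    have h₂ : sampleExp n ≤ (accuracyExp d n + 1) * epsInv d := by
      rw [Nat.add_mul, one_mul]
      exact this
    exact_mod_cast h₂
  rw [← div_le_iff₀ hE] at h₁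
  rw [← pow_succ', ← Real.rpow_natCast, ← Real.rpow_natCast, ← Real.rpow_mul two_pos.le,
    ← Real.rpow_add two_pos]
  refine Real.rpow_le_rpow_of_exponent_le one_le_two ?_
  push_cast
  have : (sampleExp n : ℝ) * (1 - 1 / epsInv d) = sampleExp n - sampleExp n / epsInv d := by
    field_simp
  linarith

/-- From `2^J ≤ 2n + 2 ≤ (n + 2)²`, as `2 / log 2 < 3`. -/
theorem sampleExp_le_log (n : ℕ) : (sampleExp n : ℝ) ≤ 3 * Real.log ((n : ℝ) + 2) := by
  have h₁ : 2 ^ sampleExp n ≤ (n + 2) ^ 2 := (two_pow_sampleExp_le n).trans (by nlinarith)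
  have h₂ : (2 : ℝ) ^ sampleExp n ≤ ((n : ℝ) + 2) ^ 2 := by exact_mod_cast h₁
  have h₃ := Real.log_le_log (by positivity) h₂
  rw [Real.log_pow, Real.log_pow] at h₃
  push_cast at h₃
  have h₄ := Real.log_two_gt_d9
  have h₅ : (0 : ℝ) ≤ sampleExp n := Nat.cast_nonneg _
  nlinarith

theorem rpow_sampleExp_le {n : ℕ} (hn : 0 < n) {x : ℝ} (hx : 0 ≤ x) :
    ((2 : ℝ) ^ sampleExp n) ^ x ≤ 4 ^ x * (n : ℝ) ^ x := by
  have h₁ : 2 ^ sampleExp n ≤ 4 * n := (two_pow_sampleExp_le n).trans (by omega)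
  rw [← Real.mul_rpow (by norm_num) (Nat.cast_nonneg _)]
  exact Real.rpow_le_rpow (by positivity) (by exact_mod_cast h₁) hx

theorem rpow_sampleExp_le_add (n : ℕ) {x : ℝ} (hx : 0 ≤ x) (hx₂ : x ≤ 2) :
    ((2 : ℝ) ^ sampleExp n) ^ x ≤ 16 * ((n : ℝ) ^ x + 1) := by
  have h₁ : (4 : ℝ) ^ x ≤ 16 := by
    calc (4 : ℝ) ^ x ≤ 4 ^ (2 : ℝ) := Real.rpow_le_rpow_of_exponent_le (by norm_num) hx₂
      _ = 16 := by norm_num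
  have h₂ : (0 : ℝ) ≤ (n : ℝ) ^ x := by positivity
  rcases Nat.eq_zero_or_pos n with rfl | hn
  · have h₃ : ((2 : ℝ) ^ sampleExp 0) ^ x ≤ 4 ^ x :=
      Real.rpow_le_rpow (by positivity) (by norm_num [sampleExp]) hx
    linarith
  · have := rpow_sampleExp_le hn hx
    nlinarith

/-- Each of the six summands is at most `2^(E J)`, since `E ≥ 10d + 9` exceeds the degree of every
polynomial involved; the `3` in the exponent provides a factor `8`. -/
theorem entries_lt {d n r m : ℕ} (hr : r ≤ (n + 1) ^ d) (hm : m ≤ n * r) :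
    epsInv d + m + r + n +
      sampleExp n * (2 ^ sampleExp n * (nodeBound d n * nodeBound d n)) + 4 <
        2 ^ ((epsInv d + 3) * sampleExp n) := by
  have hE := le_epsInv d
  have hn := le_two_pow_sampleExp n
  have hj := two_mul_accuracyExp_lt d n
  have hτ := nodeBound_le d n
  set E := epsInv d
  set J := sampleExp n with hJ
  have hJ₁ : 1 ≤ J := le_max_left _ _
  have hpow : ∀ a ≤ E * J, 2 ^ a ≤ 2 ^ (E * J) := fun a ha => Nat.pow_le_pow_right two_pos ha
  have h₁ : E ≤ 2 ^ (E * J) :=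
    Nat.lt_two_pow_self.le.trans (hpow _ (Nat.le_mul_of_pos_right _ hJ₁))
  have h₂ : 4 ≤ 2 ^ (E * J) := hpow 2 (by nlinarith)
  have h₃ : n ≤ 2 ^ (E * J) := hn.trans (hpow _ (by nlinarith))
  have hn₁ : n + 1 ≤ 2 ^ (2 * J) := by
    rw [two_mul, pow_add]
    nlinarith [Nat.pow_le_pow_right two_pos hJ₁]
  have hr₁ : r ≤ 2 ^ (2 * J * d) := by
    rw [pow_mul]
    exact hr.trans (Nat.pow_le_pow_left hn₁ _)
  have h₄ : r ≤ 2 ^ (E * J) := hr₁.trans (hpow _ (by nlinarith))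
  have h₅ : m ≤ 2 ^ (E * J) := by
    refine (hm.trans (Nat.mul_le_mul hn hr₁)).trans ?_
    rw [← pow_add]
    exact hpow _ (by nlinarith)
  have hτ₁ : nodeBound d n ≤ 2 ^ (2 * J * (d + 1)) := by
    refine hτ.trans ?_
    rw [pow_mul (2 ^ accuracyExp d n), ← mul_pow, pow_mul 2 (2 * J)]
    refine Nat.pow_le_pow_left ?_ _
    calc 3 * (2 ^ accuracyExp d n) ^ 2 ≤ 2 ^ 2 * (2 ^ accuracyExp d n) ^ 2 :=
          Nat.mul_le_mul_right _ (by norm_num)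
      _ = 2 ^ (2 + accuracyExp d n * 2) := by rw [← pow_mul, ← pow_add]
      _ ≤ 2 ^ (2 * J) := Nat.pow_le_pow_right two_pos (by omega)
  have h₆ : J * (2 ^ J * (nodeBound d n * nodeBound d n)) ≤ 2 ^ (E * J) := by
    calc J * (2 ^ J * (nodeBound d n * nodeBound d n))
        ≤ 2 ^ J * (2 ^ J * (2 ^ (2 * J * (d + 1)) * 2 ^ (2 * J * (d + 1)))) := by
          gcongr
          exact Nat.lt_two_pow_self.le
      _ = 2 ^ (J * (4 * d + 6)) := by
          rw [← pow_add, ← pow_add, ← pow_add]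
          congr 1
          ring
      _ ≤ 2 ^ (E * J) := hpow _ (by nlinarith)
  have h₇ : 2 ^ 3 * 2 ^ (E * J) ≤ 2 ^ ((E + 3) * J) := by
    rw [← pow_add]
    exact Nat.pow_le_pow_right two_pos (by nlinarith)
  have h₈ : 0 < 2 ^ (E * J) := by positivity
  omega

/-- The main term is `N τ² ≤ 9^(d+1) N K^(4(d+1))`, and `4(d + 1) + 1 ≤ E` turns the power of `K`
into `N^(1-1/E)`. -/
theorem time_bound {d n m r : ℕ} (hr : r ≤ m + 1) :
    ((m + r + d + 2 ^ sampleExp n * (nodeBound d n * nodeBound d n) : ℕ) : ℝ) ≤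
      (3 + d + 16 * 9 ^ (d + 1)) * (m + (n : ℝ) ^ (2 - 1 / (epsInv d : ℝ)) + 1) := by
  have hE := le_epsInv d
  have hE' : (1 : ℝ) ≤ epsInv d := by exact_mod_cast (show 1 ≤ epsInv d by omega)
  have hE₁ : 1 / (epsInv d : ℝ) ≤ 1 := by rw [div_le_one (by linarith)]; exact hE'
  have hE₀ : 0 ≤ 1 / (epsInv d : ℝ) := by positivity
  set x : ℝ := 2 - 1 / (epsInv d : ℝ) with hx
  set N : ℝ := (2 : ℝ) ^ sampleExp n with hN
  have hNpos : 0 < N := by positivity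
  have hτ : (nodeBound d n : ℝ) ≤ 3 ^ (d + 1) * (2 ^ accuracyExp d n) ^ (2 * (d + 1)) := by
    exact_mod_cast nodeBound_le d n
  have h₁ : N * ((nodeBound d n : ℝ) * nodeBound d n) ≤ 16 * 9 ^ (d + 1) * ((n : ℝ) ^ x + 1) := by
    calc N * ((nodeBound d n : ℝ) * nodeBound d n)
        ≤ N * ((3 ^ (d + 1) * (2 ^ accuracyExp d n) ^ (2 * (d + 1))) *
          (3 ^ (d + 1) * (2 ^ accuracyExp d n) ^ (2 * (d + 1)))) := by gcongr
      _ = 9 ^ (d + 1) * (N * (2 ^ accuracyExp d n) ^ (4 * (d + 1))) := by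
          rw [show (9 : ℝ) = 3 * 3 by norm_num, mul_pow]
          ring
      _ ≤ 9 ^ (d + 1) * (N * N ^ (1 - 1 / (epsInv d : ℝ))) := by
          gcongr
          exact two_pow_accuracyExp_pow_le (by omega)
      _ = 9 ^ (d + 1) * N ^ x := by
          rw [hx, show (2 : ℝ) - 1 / epsInv d = 1 + (1 - 1 / epsInv d) by ring,
            Real.rpow_add hNpos, Real.rpow_one]
      _ ≤ 9 ^ (d + 1) * (16 * ((n : ℝ) ^ x + 1)) := by
          gcongr
          exact rpow_sampleExp_le_add n (by linarith) (by linarith)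
      _ = _ := by ring
  have h₂ : (r : ℝ) ≤ m + 1 := by exact_mod_cast hr
  have h₃ : (0 : ℝ) ≤ (n : ℝ) ^ x := by positivity
  have h₄ : (0 : ℝ) ≤ m := Nat.cast_nonneg _
  have h₅ : (0 : ℝ) ≤ d := Nat.cast_nonneg _
  have h₆ : (0 : ℝ) ≤ 16 * 9 ^ (d + 1) := by positivity
  have h₇ := mul_nonneg h₆ h₄
  have h₈ := mul_nonneg h₅ h₄
  have h₉ := mul_nonneg h₅ h₃
  push_cast
  rw [← hN]
  nlinarith

/-- Here `τ + 1 ≤ 6^(d+1) K^(2(d+1))`, so `K` gets the exponent `2(d+1)2^(d+1)`, which is at most `E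
- 1 = 2^(d+1)(5d + 4)`. This is what forces the factor `2^(d+1)` in `ε_d`. -/
theorem classes_bound (d n : ℕ) : ((nodeBound d n + 1 : ℕ) : ℝ) ^ 2 ^ (d + 1) ≤
    6 ^ ((d + 1) * 2 ^ (d + 1)) * ((2 : ℝ) ^ sampleExp n) ^ (1 - 1 / (epsInv d : ℝ)) := by
  have hτ : (nodeBound d n : ℝ) ≤ 3 ^ (d + 1) * (2 ^ accuracyExp d n) ^ (2 * (d + 1)) := by
    exact_mod_cast nodeBound_le d n
  have h₁ : (1 : ℝ) ≤ 3 ^ (d + 1) * (2 ^ accuracyExp d n) ^ (2 * (d + 1)) :=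
    one_le_mul_of_one_le_of_one_le (one_le_pow₀ (by norm_num))
      (one_le_pow₀ (one_le_pow₀ (by norm_num)))
  have h₂ : (2 : ℝ) ≤ 2 ^ (d + 1) := by
    rw [pow_succ]
    have : (1 : ℝ) ≤ 2 ^ d := one_le_pow₀ (by norm_num)
    linarith
  calc ((nodeBound d n + 1 : ℕ) : ℝ) ^ 2 ^ (d + 1)
      ≤ (2 ^ (d + 1) * (3 ^ (d + 1) * (2 ^ accuracyExp d n) ^ (2 * (d + 1)))) ^ 2 ^ (d + 1) := by
        gcongr
        push_cast
        nlinarith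
    _ = 6 ^ ((d + 1) * 2 ^ (d + 1)) * (2 ^ accuracyExp d n) ^ (2 * (d + 1) * 2 ^ (d + 1)) := by
        rw [← mul_assoc, ← mul_pow, mul_pow, ← pow_mul, ← pow_mul]
        norm_num
    _ ≤ _ := by
        gcongr
        refine two_pow_accuracyExp_pow_le ?_
        unfold epsInv
        nlinarith [Nat.zero_le (2 ^ (d + 1) * d), Nat.zero_le (2 ^ (d + 1))]

/-- Both terms are `N^(1-1/E)` up to a factor `J²`. The constant `36` is `3² · 4`, from `J ≤ 3 log
(n + 2)` and `N^x ≤ 4 n^x`. -/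
theorem stabbing_bound {d n k : ℕ} (hn : 0 < n)
    (hk : k ≤ (nodeBound d n + 1) ^ 2 ^ (d + 1) + 2 * (sampleExp n * 2 ^ sampleExp n *
      ((epsInv d + 3) * sampleExp n + 2) / (2 * 2 ^ accuracyExp d n))) :
    (k : ℝ) ≤ 36 * (6 ^ ((d + 1) * 2 ^ (d + 1)) + 2 * (epsInv d + 5)) *
      (n : ℝ) ^ (1 - 1 / (epsInv d : ℝ)) * Real.log ((n : ℝ) + 2) ^ 2 := by
  have hE := le_epsInv d
  have hE' : (1 : ℝ) ≤ epsInv d := by exact_mod_cast (show 1 ≤ epsInv d by omega)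
  have hE₁ : 1 / (epsInv d : ℝ) ≤ 1 := by rw [div_le_one (by linarith)]; exact hE'
  have hE₀ : 0 ≤ 1 / (epsInv d : ℝ) := by positivity
  set x : ℝ := 1 - 1 / (epsInv d : ℝ) with hx
  set N : ℝ := (2 : ℝ) ^ sampleExp n with hN
  have hNx : N ^ x ≤ 4 * (n : ℝ) ^ x := by
    refine (rpow_sampleExp_le hn (by linarith)).trans ?_
    gcongr
    calc (4 : ℝ) ^ x ≤ 4 ^ (1 : ℝ) := Real.rpow_le_rpow_of_exponent_le (by norm_num) (by linarith)
      _ = 4 := by norm_num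
  have hJ₁ : (1 : ℝ) ≤ sampleExp n := by exact_mod_cast le_max_left 1 (Nat.clog 2 n)
  have hJlog := sampleExp_le_log n
  have hc := classes_bound d n
  have hNK := two_pow_sampleExp_le_mul d n
  rw [← hN, ← hx] at hc hNK
  set J : ℝ := (sampleExp n : ℝ) with hJ
  set c : ℝ := 6 ^ ((d + 1) * 2 ^ (d + 1)) with hcdef
  have hc₀ : 0 ≤ c := by positivity
  set δ := sampleExp n * 2 ^ sampleExp n * ((epsInv d + 3) * sampleExp n + 2) /
    (2 * 2 ^ accuracyExp d n) with hδ
  have hδ' : (δ : ℝ) ≤ J * ((epsInv d + 5) * J) * N ^ x := by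
    have h₁ : (δ : ℝ) ≤ J * N * ((epsInv d + 3) * J + 2) / (2 * 2 ^ accuracyExp d n) := by
      refine Nat.cast_div_le.trans (le_of_eq ?_)
      push_cast
      rfl
    refine h₁.trans ?_
    rw [div_le_iff₀ (by positivity)]
    calc J * N * ((epsInv d + 3) * J + 2) ≤ J * N * ((epsInv d + 5) * J) := by
          gcongr
          nlinarith
      _ = J * ((epsInv d + 5) * J) * N := by ring
      _ ≤ J * ((epsInv d + 5) * J) * (2 * 2 ^ accuracyExp d n * N ^ x) := by gcongr
      _ = _ := by ring
  have hk' : (k : ℝ) ≤ ((nodeBound d n + 1 : ℕ) : ℝ) ^ 2 ^ (d + 1) + 2 * δ := by exact_mod_cast hk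
  have hNx₀ : 0 ≤ N ^ x := by positivity
  have hJJ : 1 ≤ J ^ 2 := one_le_pow₀ hJ₁
  calc (k : ℝ) ≤ c * N ^ x + 2 * (J * ((epsInv d + 5) * J) * N ^ x) := by linarith
    _ ≤ c * J ^ 2 * N ^ x + 2 * (J * ((epsInv d + 5) * J) * N ^ x) := by
        gcongr
        nlinarith
    _ = (c + 2 * (epsInv d + 5)) * J ^ 2 * N ^ x := by ring
    _ ≤ (c + 2 * (epsInv d + 5)) * (3 * Real.log ((n : ℝ) + 2)) ^ 2 * (4 * (n : ℝ) ^ x) := by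
        gcongr
    _ = _ := by ring

end Stabbing

/-! ### The theorem -/

theorem theorem2 :
    ∃ c : ℝ, 2 < c ∧ ∃ A : Stabbing.Program, ∀ d : ℕ, 0 < d →
      0 < Stabbing.stabbingEps c d ∧ Stabbing.stabbingEps c d < 1 ∧
      ∃ (C : ℝ) (k : ℕ), ∀ (n : ℕ) (R : Finset (Finset (Fin n))), R.vcDim ≤ d →
        ∀ L : List (List (Fin n)), Stabbing.Presents L R →
          ∃ (t : ℕ) (s : Stabbing.State) (P : List (Fin n)),
            Stabbing.Exec A (Stabbing.initState (Stabbing.encodeInput d n L)) t s ∧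
            s.output n = P.map Fin.val ∧
            Stabbing.IsSpanningPath P ∧
            (Stabbing.stabbingNumber R P : ℝ) ≤
              C * (n : ℝ) ^ (1 - Stabbing.stabbingEps c d) * Real.log ((n : ℝ) + 2) ^ k ∧
            (t : ℝ) ≤
              C * ((Stabbing.hypergraphSize R : ℝ) +
                  (n : ℝ) ^ (2 - Stabbing.stabbingEps c d) + 1) *
                Real.log ((n : ℝ) + 2) ^ k := by
  -- For an integer `c` the reciprocal of `ε_d` is a natural number, which the program can compute.
  refine ⟨5, by norm_num, Stabbing.spanningPath, fun d hd => ?_⟩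
  have hE := Stabbing.le_epsInv d
  have hE' : (1 : ℝ) < Stabbing.epsInv d := by
    exact_mod_cast (show 1 < Stabbing.epsInv d by omega)
  rw [Stabbing.stabbingEps_five]
  refine ⟨by positivity, by rw [div_lt_one (by linarith)]; exact hE', ?_⟩
  set C₁ : ℝ := 36 * (6 ^ ((d + 1) * 2 ^ (d + 1)) + 2 * (Stabbing.epsInv d + 5)) with hC₁
  -- `310` instructions of cost `1000 B` each, and `9 = 3²` from replacing `J²` by logarithms.
  set C₂ : ℝ := 310000 * 9 * (Stabbing.epsInv d + 3) * (3 + d + 16 * 9 ^ (d + 1)) with hC₂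
  have hC₁₀ : 0 ≤ C₁ := by positivity
  have hC₂₀ : 0 ≤ C₂ := by positivity
  -- Two logarithms: one from the number of levels and one from the bit length `B`.
  refine ⟨C₁ + C₂, 2, fun n R hR L hL => ?_⟩
  set m := Stabbing.hypergraphSize R with hm
  set J := Stabbing.sampleExp n with hJ
  set B := (Stabbing.epsInv d + 3) * J with hB
  have hin := hL.isInput d
  have hvc := hL.vcBound hR
  have hsum := hL.sum_length
  have hr : L.length ≤ (n + 1) ^ d := hvc.card_le (n := n) (fun q hq v hv =>
    Finset.mem_range.2 (hin.lt q hq v (List.mem_toFinset.1 hv))) hL.injOn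
  have hmn : m ≤ n * L.length := by
    rw [hm, ← hsum, Nat.mul_comm]
    refine (Finset.sum_le_card_nsmul _ _ n fun q _ => hL.length_edgeList_le q).trans ?_
    rw [Finset.card_range, smul_eq_mul]
  have hlt := Stabbing.entries_lt hr hmn
  rw [← hJ, ← hB] at hlt
  have hJ₁ : 1 ≤ J := le_max_left _ _
  have hrun := Stabbing.runs_spanningPath (B := B)
    (s := Stabbing.initState (Stabbing.encodeInput d n L)) hin hvc
    (by funext i; simp [Stabbing.initState]) (fun a ha i => by simp [Stabbing.initState, ha])
    (by rw [hsum]; exact hlt)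
  obtain ⟨t, s, hexec, ht, -, S, hS, hScard, hcover, cls, σ, T, hout, hclsT, hσ, hcls⟩ :=
    hrun (hL.bdd (by omega) (by omega) (by omega) (Nat.mul_pos (by omega) hJ₁))
  obtain ⟨P, hP, hPspan⟩ := Stabbing.exists_path
    (Stabbing.classOrder_perm (cls := cls) (n := n) fun v _ => hclsT v)
  have hsorted : P.Pairwise fun u v : Fin n => cls u.val ≤ cls v.val := by
    have := Stabbing.pairwise_classOrder cls n T
    rwa [← hP, List.pairwise_map] at this
  refine ⟨t, s, P, hexec, hout.trans hP.symm, hPspan, ?_, ?_⟩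
  · have hlog : 0 ≤ Real.log ((n : ℝ) + 2) :=
      Real.log_nonneg (by linarith [Nat.cast_nonneg (α := ℝ) n])
    have hstab := Stabbing.stabbingNumber_le hL hR (Stabbing.le_two_pow_sampleExp n) hS
      (δ := J * 2 ^ J * (B + 2) / (2 * 2 ^ Stabbing.accuracyExp d n)) (fun q hq => by
        obtain ⟨p, hp, hpq⟩ := hcover q hq
        refine ⟨p, hp, (Nat.le_div_iff_mul_le (by positivity)).2 ?_⟩
        rw [Nat.mul_comm]
        exact hpq) hσ hcls hPspan.1 hsorted
    -- For `n = 0` the bound itself vanishes, so the stabbing number of the empty path has to be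
    -- computed exactly.
    rcases Nat.eq_zero_or_pos n with rfl | hn
    · have hP₀ : P = [] := by
        rcases P with _ | ⟨v, P⟩
        · rfl
        · exact v.elim0
      have h₀ : Stabbing.stabbingNumber R P = 0 := by
        subst hP₀
        exact Nat.eq_zero_of_le_zero (Finset.sup_le fun q _ => by
          simp [Stabbing.stabbedEdges, Stabbing.pathEdges])
      rw [h₀]
      push_cast
      positivity
    · refine (Stabbing.stabbing_bound hn (hstab.trans (Nat.add_le_add_right
        (Nat.pow_le_pow_left (Nat.succ_le_succ hScard) _) _))).trans ?_
      gcongr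
      linarith
  · rw [hsum] at ht
    have hlog := Stabbing.sampleExp_le_log n
    have htime := Stabbing.time_bound (d := d) (n := n) hL.length_le
    set X : ℝ := (m : ℝ) + (n : ℝ) ^ (2 - 1 / (Stabbing.epsInv d : ℝ)) + 1 with hX
    have hX₀ : 0 ≤ X := by positivity
    set Y := m + L.length + d + 2 ^ J * (Stabbing.nodeBound d n * Stabbing.nodeBound d n) with hY
    have ht' : (t : ℝ) ≤ 310 * J * Y * (1000 * ((Stabbing.epsInv d + 3) * J)) := by
      have : t ≤ 310 * J * Y * (1000 * ((Stabbing.epsInv d + 3) * J)) := ht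
      exact_mod_cast this
    calc (t : ℝ) ≤ 310 * J * Y * (1000 * ((Stabbing.epsInv d + 3) * J)) := ht'
      _ = 310000 * (Stabbing.epsInv d + 3) * (J : ℝ) ^ 2 * Y := by ring
      _ ≤ 310000 * (Stabbing.epsInv d + 3) * (3 * Real.log ((n : ℝ) + 2)) ^ 2 *
          ((3 + d + 16 * 9 ^ (d + 1)) * X) := by
        gcongr
      _ = C₂ * X * Real.log ((n : ℝ) + 2) ^ 2 := by
        rw [hC₂]
        ring
      _ ≤ (C₁ + C₂) * X * Real.log ((n : ℝ) + 2) ^ 2 := by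
        gcongr
        linarith
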